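/- Let $n>2$ be an even integer, let $M$ be a smooth $n$-manifold (without boundary, not necessarily compact), let $h$ be a smooth Riemannian metric on $M$, and let $X=M\times[0,\epsilon)$ for some $\epsilon>0$, with $x\in[0,\epsilon)$ the second coordinate. Let $g$ be a Poincaré metric on $X$ associated to the conformal class $[h]$, for which $x$ is the special defining function associated to the representative $h$. That is, $$g=x^{-2}(h_x+dx^2)\quad\text{on } M\times(0,\epsilon),\qquad h_0=h,$$ where $h_x$ is a one-parameter family of Riemannian metrics on $M$, smooth on $M\times[0,\epsilon)$, and $$\operatorname{Ric}(g)+ng=O(x^{n-2}),\qquad \operatorname{tr}_g(\operatorname{Ric}(g)+ng)=O(x^{n+2}).$$ Here the first condition is meant for the components in the charts of $X$ induced by smooth charts of $M$, and every $O(\cdot)$ is as $x\to0^+$, locally uniformly on $M$ (or on the domain of the chart). Let $\Delta_g=-\operatorname{div}_g\operatorname{grad}_g$ be the Laplacian of $g$, with the nonnegative sign convention. Consider smooth functions $U$ on $M\times(0,\epsilon)$ such that $$\Delta_gU=n+O(x^{n+1}\log x),\qquad U=\log x+A+Bx^n\log x+O(x^n),\qquad (*)$$ with $A,B\in C^\infty(X)$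 (smooth up to the boundary) and $A|_{x=0}=0$. Then: 1. (Existence) There is such a $U$; it can be taken of the form $U=\log x+A+Bx^n\log x$ exactly. 2. (Uniqueness modulo $O(x^n)$) If $U$ and $U'$ are two such functions, then $U-U'=O(x^n)$. 3. ($A$ mod $O(x^n)$ and $B|_M$ are formally, i.e. locally, determined by $h$) There are polynomials $P_0,\dots,P_{n-1}$ and $Q$ depending only on $n$, in the components $h^{ij}$ of the inverse metric and finitely many of the partial derivatives $\partial^\alpha h_{ij}$ ($|\alpha|\ge0$), such that for all $M,\epsilon,h,g$ as above, all $U,A,B$ as in $(*)$, and in every smooth chart of $M$, the following hold, with the polynomials evaluated on the components of $h$ and their derivatives at the point: $$A(p,x)=\sum_{j=0}^{n-1}P_j(p)\,x^j+O(x^n),\qquad B(p,0)=Q(p).$$ -/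

import Mathlib

open Set Filter Topology Bundle
open scoped Manifold ContDiff

/-!  Riemannian geometry in coordinates.

A (pseudo-)Riemannian metric on a manifold is a field of bilinear forms on the tangent spaces.
Its Christoffel symbols, Ricci tensor and Laplacian are given by the classical formulas in terms of
the matrix `G` of components in a chart, with respect to a basis of the model vector space. -/

section Coordinates

variable {V : Type*} [NormedAddCommGroup V] [NormedSpace ℝ V] {ι : Type*}

/-- The partial derivative in the direction of the `i`-th basis vector. -/
noncomputable def partialDeriv (b : Module.Basis ι ℝ V) (i : ι) (f : V → ℝ) : V → ℝ :=
  fun y => fderiv ℝ f y (b i)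

variable [Fintype ι] [DecidableEq ι]

/-- `Γᵏᵢⱼ = ½ ∑ₗ Gᵏˡ (∂ᵢ Gⱼₗ + ∂ⱼ Gᵢₗ - ∂ₗ Gᵢⱼ)`. -/
noncomputable def christoffel (b : Module.Basis ι ℝ V) (G : V → Matrix ι ι ℝ) (k i j : ι) :
    V → ℝ :=
  fun y => (1 / 2 : ℝ) * ∑ l, (G y)⁻¹ k l *
    (partialDeriv b i (fun z => G z j l) y + partialDeriv b j (fun z => G z i l) y
      - partialDeriv b l (fun z => G z i j) y)

/-- `Ricᵢⱼ = ∑ₖ (∂ₖ Γᵏᵢⱼ - ∂ⱼ Γᵏᵢₖ) + ∑ₖₗ (Γᵏₖₗ Γˡᵢⱼ - Γᵏⱼₗ Γˡᵢₖ)`. -/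
noncomputable def ricciCoord (b : Module.Basis ι ℝ V) (G : V → Matrix ι ι ℝ) (i j : ι) :
    V → ℝ :=
  fun y =>
    (∑ k, (partialDeriv b k (christoffel b G k i j) y - partialDeriv b j (christoffel b G k i k) y))
      + ∑ k, ∑ l, (christoffel b G k k l y * christoffel b G l i j y
          - christoffel b G k j l y * christoffel b G l i k y)

/-- The Laplacian with the nonnegative sign convention, `Δ f = - tr (Hess f)`, that is
`Δ f = - ∑ᵢⱼ Gⁱʲ (∂ᵢ ∂ⱼ f - ∑ₖ Γᵏᵢⱼ ∂ₖ f)`. -/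
noncomputable def laplacianCoord (b : Module.Basis ι ℝ V) (G : V → Matrix ι ι ℝ) (f : V → ℝ) :
    V → ℝ :=
  fun y => - ∑ i, ∑ j, (G y)⁻¹ i j *
    (partialDeriv b i (partialDeriv b j f) y
      - ∑ k, christoffel b G k i j y * partialDeriv b k f y)

end Coordinates

section Charts

variable {V : Type*} [NormedAddCommGroup V] [NormedSpace ℝ V] {ι : Type*}
  {H : Type*} [TopologicalSpace H] (I : ModelWithCorners ℝ V H)
  {N : Type*} [TopologicalSpace N] [ChartedSpace H N]

/-- The components of the field of bilinear forms `g` in the chart `φ` of `N`, as functions on the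
model vector space (meaningful on the target of the chart). -/
noncomputable def metricInChart (b : Module.Basis ι ℝ V) (φ : OpenPartialHomeomorph N H)
    (g : ∀ q : N, TangentSpace I q →L[ℝ] TangentSpace I q →L[ℝ] ℝ) : V → Matrix ι ι ℝ :=
  fun y => Matrix.of fun i j =>
    g ((φ.extend I).symm y)
      (mfderiv 𝓘(ℝ, V) I (φ.extend I).symm y (b i))
      (mfderiv 𝓘(ℝ, V) I (φ.extend I).symm y (b j))

/-- The Laplacian `Δ_g f` of a function on a manifold without boundary, computed at `q` in the
preferred chart at `q`; as usual the value does not depend on the chart. -/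
noncomputable def laplacian [Fintype ι] [DecidableEq ι] (b : Module.Basis ι ℝ V)
    (g : ∀ q : N, TangentSpace I q →L[ℝ] TangentSpace I q →L[ℝ] ℝ) (f : N → ℝ) : N → ℝ :=
  fun q => laplacianCoord b (metricInChart I b (chartAt H q) g)
    (fun y => f (((chartAt H q).extend I).symm y)) ((chartAt H q).extend I q)

end Charts

/-- `f = O(w(x))` as `x → 0+`, locally uniformly on `S`: for functions `f (y, x)`, the bound is
uniform for `y` in each compact subset of `S`. -/
def IsBigOAtBoundary {Y : Type*} [TopologicalSpace Y] (S : Set Y) (f : Y × ℝ → ℝ) (w : ℝ → ℝ) :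
    Prop :=
  ∀ K ⊆ S, IsCompact K → f =O[𝓟 K ×ˢ 𝓝[>] (0 : ℝ)] fun q => w q.2

section Collar

/-- The standard basis of `ℝⁿ`. -/
noncomputable abbrev stdBasis (n : ℕ) : Module.Basis (Fin n) ℝ (EuclideanSpace ℝ (Fin n)) :=
  (EuclideanSpace.basisFun (Fin n) ℝ).toBasis

/-- The standard basis of `ℝⁿ × ℝ`. -/
noncomputable abbrev collarBasis (n : ℕ) :
    Module.Basis (Fin n ⊕ Unit) ℝ (EuclideanSpace ℝ (Fin n) × ℝ) :=
  (stdBasis n).prod (Module.Basis.singleton Unit ℝ)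

/-- The model with corners of `M × ℝ`; the collar `X = M × [0, ε)` and its interior `M × (0, ε)`
are regarded as subsets of `M × ℝ`. -/
noncomputable abbrev collarModel (n : ℕ) :
    ModelWithCorners ℝ (EuclideanSpace ℝ (Fin n) × ℝ) (ModelProd (EuclideanSpace ℝ (Fin n)) ℝ) :=
  (𝓡 n).prod 𝓘(ℝ, ℝ)

variable {n : ℕ} {M : Type*} [TopologicalSpace M] [ChartedSpace (EuclideanSpace ℝ (Fin n)) M]

/-- The chart `(p, x) ↦ (e p, x)` of `M × ℝ` induced by a chart `e` of `M`. -/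
noncomputable def collarChart (e : OpenPartialHomeomorph M (EuclideanSpace ℝ (Fin n))) :
    OpenPartialHomeomorph (M × ℝ) (ModelProd (EuclideanSpace ℝ (Fin n)) ℝ) :=
  e.prod (OpenPartialHomeomorph.refl ℝ)

variable [IsManifold (𝓡 n) ∞ M]

/-- A smooth Riemannian metric on `M`. -/
abbrev SmoothMetric (n : ℕ) (M : Type*) [TopologicalSpace M]
    [ChartedSpace (EuclideanSpace ℝ (Fin n)) M] [IsManifold (𝓡 n) ∞ M] : Type _ :=
  ContMDiffRiemannianMetric (𝓡 n) ∞ (EuclideanSpace ℝ (Fin n))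
    (fun p : M => TangentSpace (𝓡 n) p)

/-- `k x`, `0 ≤ x < ε`, is a one-parameter family of Riemannian metrics on `M`, smooth on
`M × [0, ε)` (up to and including `x = 0`). -/
structure IsSmoothMetricFamily (ε : ℝ)
    (k : ℝ → ∀ p : M, TangentSpace (𝓡 n) p →L[ℝ] TangentSpace (𝓡 n) p →L[ℝ] ℝ) : Prop where
  symm : ∀ x ∈ Ico 0 ε, ∀ (p : M) (v w : TangentSpace (𝓡 n) p), k x p v w = k x p w v
  pos : ∀ x ∈ Ico 0 ε, ∀ (p : M) (v : TangentSpace (𝓡 n) p), v ≠ 0 → 0 < k x p v v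
  smooth : ContMDiffOn (collarModel n)
    ((𝓡 n).prod 𝓘(ℝ, EuclideanSpace ℝ (Fin n) →L[ℝ] EuclideanSpace ℝ (Fin n) →L[ℝ] ℝ)) ∞
    (fun q : M × ℝ => TotalSpace.mk'
      (E := fun p : M => TangentSpace (𝓡 n) p →L[ℝ] TangentSpace (𝓡 n) p →L[ℝ] ℝ)
      (EuclideanSpace ℝ (Fin n) →L[ℝ] EuclideanSpace ℝ (Fin n) →L[ℝ] ℝ) q.1 (k q.2 q.1))
    (univ ×ˢ Ico 0 ε)

/-- On `M × (0, ε)` the field `g` is the metric `x⁻² (k_x + dx²)`. -/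
def HasNormalForm (ε : ℝ)
    (k : ℝ → ∀ p : M, TangentSpace (𝓡 n) p →L[ℝ] TangentSpace (𝓡 n) p →L[ℝ] ℝ)
    (g : ∀ q : M × ℝ, TangentSpace (collarModel n) q →L[ℝ] TangentSpace (collarModel n) q →L[ℝ] ℝ) :
    Prop :=
  ∀ (p : M), ∀ x ∈ Ioo 0 ε, ∀ (v w : TangentSpace (𝓡 n) p) (s t : ℝ),
    g (p, x) ((v, s) : EuclideanSpace ℝ (Fin n) × ℝ) ((w, t) : EuclideanSpace ℝ (Fin n) × ℝ)
      = (x ^ 2)⁻¹ * (k x p v w + s * t)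

/-- The components of the tensor `Ric(g) + n g` in the chart of `M × ℝ` induced by the chart `e`
of `M`. -/
noncomputable def einsteinDefect
    (g : ∀ q : M × ℝ, TangentSpace (collarModel n) q →L[ℝ] TangentSpace (collarModel n) q →L[ℝ] ℝ)
    (e : OpenPartialHomeomorph M (EuclideanSpace ℝ (Fin n))) (i j : Fin n ⊕ Unit) :
    EuclideanSpace ℝ (Fin n) × ℝ → ℝ :=
  fun y =>
    ricciCoord (collarBasis n) (metricInChart (collarModel n) (collarBasis n) (collarChart e) g) i j y
      + n * metricInChart (collarModel n) (collarBasis n) (collarChart e) g y i j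

/-- For even `n`: `g` is, on the collar `M × [0, ε)`, a Poincaré metric associated to the conformal
class of `h`, and the projection `x` to the second factor is the special defining function
associated to the representative `h`. That is, `g = x⁻² (h_x + dx²)` for a smooth family of
metrics `h_x` with `h_0 = h`, and `g` is asymptotically Einstein: `Ric(g) + n g = O(x^(n-2))`
(componentwise in the charts of `M × [0, ε)` coming from smooth charts of `M`) and
`tr_g (Ric(g) + n g) = O(x^(n+2))`. -/
structure IsPoincareMetric (ε : ℝ) (h : SmoothMetric n M)
    (g : ∀ q : M × ℝ, TangentSpace (collarModel n) q →L[ℝ] TangentSpace (collarModel n) q →L[ℝ] ℝ) :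
    Prop where
  normal_form : ∃ k : ℝ → ∀ p : M, TangentSpace (𝓡 n) p →L[ℝ] TangentSpace (𝓡 n) p →L[ℝ] ℝ,
    IsSmoothMetricFamily ε k ∧ k 0 = h.inner ∧ HasNormalForm ε k g
  einstein : ∀ e ∈ IsManifold.maximalAtlas (𝓡 n) ∞ M, ∀ i j,
    IsBigOAtBoundary e.target (einsteinDefect g e i j) (fun x => x ^ (n - 2))
  trace_einstein : ∀ e ∈ IsManifold.maximalAtlas (𝓡 n) ∞ M,
    IsBigOAtBoundary e.target
      (fun y => ∑ i, ∑ j,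
        (metricInChart (collarModel n) (collarBasis n) (collarChart e) g y)⁻¹ i j
          * einsteinDefect g e i j y)
      (fun x => x ^ (n + 2))

/-- `U` is a smooth function on `M × (0, ε)` with `Δ_g U = n + O(x^(n+1) log x)` and
`U = log x + A + B x^n log x + O(x^n)`, where `A`, `B` are smooth on `M × [0, ε)` (up to the
boundary) and `A = 0` on the boundary. -/
structure IsFormalSolution (ε : ℝ)
    (g : ∀ q : M × ℝ, TangentSpace (collarModel n) q →L[ℝ] TangentSpace (collarModel n) q →L[ℝ] ℝ)
    (U A B : M × ℝ → ℝ) : Prop where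
  smooth_U : ContMDiffOn (collarModel n) 𝓘(ℝ, ℝ) ∞ U (univ ×ˢ Ioo 0 ε)
  smooth_A : ContMDiffOn (collarModel n) 𝓘(ℝ, ℝ) ∞ A (univ ×ˢ Ico 0 ε)
  smooth_B : ContMDiffOn (collarModel n) 𝓘(ℝ, ℝ) ∞ B (univ ×ˢ Ico 0 ε)
  A_boundary : ∀ p : M, A (p, 0) = 0
  expansion : IsBigOAtBoundary univ
    (fun q => U q - (Real.log q.2 + A q + B q * q.2 ^ n * Real.log q.2)) (fun x => x ^ n)
  equation : IsBigOAtBoundary univ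
    (fun q => laplacian (collarModel n) (collarBasis n) g U q - n)
    (fun x => x ^ (n + 1) * Real.log x)

/-- Indices of the variables of a polynomial in the inverse metric and the iterated partial
derivatives of the metric: `Sum.inl (i, j)` stands for `hⁱʲ`, and `Sum.inr ([i₁, …, i_r], i, j)`
for `∂_{i₁} ⋯ ∂_{i_r} hᵢⱼ`. -/
abbrev JetVar (n : ℕ) : Type := (Fin n × Fin n) ⊕ (List (Fin n) × Fin n × Fin n)

/-- The values of the jet variables for the metric `h` in the chart `e` at the point with
coordinates `y`. -/
noncomputable def metricJet (h : SmoothMetric n M)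
    (e : OpenPartialHomeomorph M (EuclideanSpace ℝ (Fin n))) (y : EuclideanSpace ℝ (Fin n)) :
    JetVar n → ℝ
  | Sum.inl (i, j) => (metricInChart (𝓡 n) (stdBasis n) e h.inner y)⁻¹ i j
  | Sum.inr (l, i, j) =>
      l.foldr (partialDeriv (stdBasis n))
        (fun z => metricInChart (𝓡 n) (stdBasis n) e h.inner z i j) y

end Collar

/-! Write g = x⁻²(K + dx²), T = tr(K⁻¹K'), and L for the trace of the Hessian with respect to K(·,
x). Then -Δ_g f = x²f'' + (1-n)xf' + ½x²Tf' + x²Lf, which gives -Δ_g(a xˢ) = s(s-n) a xˢ + O(xˢ⁺¹)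
and -Δ_g(log x) = -n + ½xT.

Existence is a Frobenius argument. For 1 ≤ j < n the indicial factor j(j-n) is nonzero, so a_j can
be chosen to cancel the residual of order j. At j = n the factor vanishes, but its derivative there
is n, so -Δ_g(b xⁿ log x) = n b xⁿ + O(xⁿ⁺¹ log x), and b absorbs the residual of order n
(`exists_formal_solution`).

Locality needs the Taylor coefficients of K that enter these residuals. The tangential Einstein
equation of order m fixes (n-1-m)k_{m+1} + k₀ tr k_{m+1} in terms of earlier coefficients, hence
k_{m+1} for m+1 < n (`universalTo_metric`). At order n only tr k_n is needed, because k_n enters the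
residuals only through T; the scalar equation gives it (`universalTo_traceDeriv`). To make "given by
a universal polynomial" a property closed under the calculus, a jet is a point of a polynomial ring
on which ∂_i acts by the derivation `totalDeriv`, and functions smooth up to the boundary are
replaced by their normal Taylor series `bdrySeries`, on which products act as Cauchy products.

Uniqueness cannot be read off from coefficients: the remainder O(xⁿ) is only a bound on size and
must not be differentiated. The difference W of two solutions satisfies Δ_g W = O(xⁿ⁺¹ log x) and W
= a + b xⁿ log x + O(xⁿ), and the maximum principle replaces differentiation. For 0 < s < n the
power xˢ is a strict supersolution near the boundary since s(n-s) > 0. Comparison on a half ball,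
with a multiple of |y-p|²xˢ controlling the lateral boundary, improves the decay of W by one power
as long as the new exponent stays below n (`IsMetricFamily.le_barrier`). This kills the coefficients
of a below order n one after another. The barrier xⁿ - xⁿ⁺¹ᐟ² finally yields W = O(xⁿ), so that b =
O(1/log x) and b vanishes on the boundary (`IsMetricFamily.vanishing`).

Uniqueness also globalizes existence. By invariance of the Laplacian
(`IsMetricFamily.laplacianCoord_comp`) the formal solutions built from the polynomials in two charts
solve the same problem on the overlap, hence the polynomials take the same values in both charts
(`IsPoincareMetric.eval_metricJet_transition`) and define functions on M. -/

set_option linter.unusedSectionVars false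
set_option linter.unusedVariables false

/-! ### Calculus on a half space up to the boundary, and normal Taylor series. -/

section BoundaryCalculus

variable {V : Type*} [NormedAddCommGroup V] [NormedSpace ℝ V]

/-- The closed half space `V × [0, ∞)`. -/
def closedHalfSpace (V : Type*) : Set (V × ℝ) := univ ×ˢ Ici 0

/-- The derivative of `f` along `w`, one-sided at the boundary of the half space. -/
noncomputable def halfDeriv (w : V × ℝ) (f : V × ℝ → ℝ) : V × ℝ → ℝ :=
  fun q => fderivWithin ℝ f (closedHalfSpace V) q w

/-- `f` is smooth on `S × [0, ε)`, up to the boundary. -/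
def SmoothUpTo (S : Set V) (ε : ℝ) (f : V × ℝ → ℝ) : Prop :=
  ContDiffOn ℝ ∞ f (S ×ˢ Ico 0 ε)

theorem uniqueDiffOn_closedHalfSpace : UniqueDiffOn ℝ (closedHalfSpace V) :=
  uniqueDiffOn_univ.prod (uniqueDiffOn_Ici 0)

theorem collar_mem_nhdsWithin {S : Set V} (hS : IsOpen S) {ε : ℝ} {q : V × ℝ}
    (hq : q ∈ S ×ˢ Ico 0 ε) : S ×ˢ Ico 0 ε ∈ 𝓝[closedHalfSpace V] q := by
  have h : S ×ˢ Iio ε ∈ 𝓝 q := (hS.prod isOpen_Iio).mem_nhds ⟨hq.1, hq.2.2⟩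
  refine mem_of_superset (inter_mem self_mem_nhdsWithin (mem_nhdsWithin_of_mem_nhds h)) ?_
  rintro ⟨y, x⟩ ⟨h1, h2⟩
  exact ⟨h2.1, h1.2, h2.2⟩

theorem collar_subset_closedHalfSpace {S : Set V} {ε : ℝ} :
    S ×ˢ Ico 0 ε ⊆ closedHalfSpace V := fun _ hq => ⟨mem_univ _, hq.2.1⟩

/-- Differentiating within the whole half space makes `halfDeriv` independent of `S` and `ε`. At a
point of the collar the two sets have the same neighbourhood filter, since `S` is open. -/
theorem fderivWithin_closedHalfSpace {S : Set V} (hS : IsOpen S) {ε : ℝ} {q : V × ℝ}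
    (hq : q ∈ S ×ˢ Ico 0 ε) (f : V × ℝ → ℝ) :
    fderivWithin ℝ f (closedHalfSpace V) q = fderivWithin ℝ f (S ×ˢ Ico 0 ε) q := by
  apply fderivWithin_congr_set
  exact (nhdsWithin_eq_iff_eventuallyEq.1 (le_antisymm
    (nhdsWithin_le_of_mem (collar_mem_nhdsWithin hS hq))
    (nhdsWithin_mono _ collar_subset_closedHalfSpace)))

theorem uniqueDiffOn_collar {S : Set V} (hS : IsOpen S) {ε : ℝ} :
    UniqueDiffOn ℝ (S ×ˢ Ico 0 ε) :=
  hS.uniqueDiffOn.prod (uniqueDiffOn_Ico 0 ε)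

namespace SmoothUpTo

variable {S : Set V} {ε : ℝ} {f g : V × ℝ → ℝ}

theorem halfDeriv (hf : SmoothUpTo S ε f) (hS : IsOpen S) (w : V × ℝ) :
    SmoothUpTo S ε (halfDeriv w f) := by
  have h := (hf.fderivWithin (m := ∞) (uniqueDiffOn_collar hS) (by simp)).clm_apply
    (contDiffOn_const (c := w))
  exact h.congr fun q hq => by
    simp only [_root_.halfDeriv]; rw [fderivWithin_closedHalfSpace hS hq]

theorem contDiffWithinAt (hf : SmoothUpTo S ε f) (hS : IsOpen S) {q : V × ℝ}
    (hq : q ∈ S ×ˢ Ico 0 ε) : ContDiffWithinAt ℝ ∞ f (closedHalfSpace V) q :=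
  (hf q hq).mono_of_mem_nhdsWithin (collar_mem_nhdsWithin hS hq)

theorem differentiableWithinAt (hf : SmoothUpTo S ε f) (hS : IsOpen S) {q : V × ℝ}
    (hq : q ∈ S ×ˢ Ico 0 ε) : DifferentiableWithinAt ℝ f (closedHalfSpace V) q :=
  (hf.contDiffWithinAt hS hq).differentiableWithinAt (by simp)

theorem contDiffAt (hf : SmoothUpTo S ε f) (hS : IsOpen S) {q : V × ℝ}
    (hq : q ∈ S ×ˢ Ioo 0 ε) : ContDiffAt ℝ ∞ f q :=
  ContDiffOn.contDiffAt hf (mem_of_superset ((hS.prod isOpen_Ioo).mem_nhds hq)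
    (prod_mono subset_rfl Ioo_subset_Ico_self))

theorem mono {S' : Set V} {ε' : ℝ} (hf : SmoothUpTo S ε f) (hS : S' ⊆ S) (hε : ε' ≤ ε) :
    SmoothUpTo S' ε' f :=
  ContDiffOn.mono hf (prod_mono hS (Ico_subset_Ico_right hε))

theorem congr (hf : SmoothUpTo S ε f) (h : ∀ q ∈ S ×ˢ Ico 0 ε, g q = f q) : SmoothUpTo S ε g :=
  ContDiffOn.congr hf h

theorem add (hf : SmoothUpTo S ε f) (hg : SmoothUpTo S ε g) : SmoothUpTo S ε (f + g) :=
  ContDiffOn.add hf hg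

theorem sub (hf : SmoothUpTo S ε f) (hg : SmoothUpTo S ε g) : SmoothUpTo S ε (f - g) :=
  ContDiffOn.sub hf hg

theorem neg (hf : SmoothUpTo S ε f) : SmoothUpTo S ε (-f) :=
  ContDiffOn.neg hf

theorem mul (hf : SmoothUpTo S ε f) (hg : SmoothUpTo S ε g) : SmoothUpTo S ε (f * g) :=
  ContDiffOn.mul hf hg

theorem const (c : ℝ) : SmoothUpTo S ε (fun _ => c) := contDiffOn_const

theorem sum {ι : Type*} {s : Finset ι} {F : ι → V × ℝ → ℝ}
    (h : ∀ i ∈ s, SmoothUpTo S ε (F i)) : SmoothUpTo S ε (∑ i ∈ s, F i) := by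
  have := ContDiffOn.sum h
  exact this.congr fun q _ => by simp

theorem of_fst {c : V → ℝ} (hc : ContDiffOn ℝ ∞ c S) : SmoothUpTo S ε (fun q => c q.1) :=
  hc.comp contDiff_fst.contDiffOn fun _ hq => hq.1

theorem snd_pow (m : ℕ) : SmoothUpTo S ε (fun q => q.2 ^ m) :=
  (contDiff_snd.pow m).contDiffOn

end SmoothUpTo

variable {S : Set V} {ε : ℝ} {f g : V × ℝ → ℝ} {q : V × ℝ} {y : V}

theorem halfDeriv_eq_fderiv (w : V × ℝ) (f : V × ℝ → ℝ) (hq : 0 < q.2) :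
    halfDeriv w f q = fderiv ℝ f q w := by
  have : closedHalfSpace V ∈ 𝓝 q := prod_mem_nhds univ_mem (Ici_mem_nhds hq)
  rw [halfDeriv, fderivWithin_of_mem_nhds this]

theorem halfDeriv_congr (hS : IsOpen S) (hq : q ∈ S ×ˢ Ico 0 ε) (w : V × ℝ)
    (h : ∀ q ∈ S ×ˢ Ico 0 ε, f q = g q) : halfDeriv w f q = halfDeriv w g q := by
  simp only [halfDeriv]
  rw [fderivWithin_closedHalfSpace hS hq, fderivWithin_closedHalfSpace hS hq,
    fderivWithin_congr h (h q hq)]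

theorem halfDeriv_add (hS : IsOpen S) (hf : SmoothUpTo S ε f) (hg : SmoothUpTo S ε g)
    (hq : q ∈ S ×ˢ Ico 0 ε) (w : V × ℝ) :
    halfDeriv w (f + g) q = halfDeriv w f q + halfDeriv w g q := by
  simp only [halfDeriv]
  rw [fderivWithin_add (uniqueDiffOn_closedHalfSpace q (collar_subset_closedHalfSpace hq))
    (hf.differentiableWithinAt hS hq) (hg.differentiableWithinAt hS hq)]
  rfl

theorem halfDeriv_mul (hS : IsOpen S) (hf : SmoothUpTo S ε f) (hg : SmoothUpTo S ε g)
    (hq : q ∈ S ×ˢ Ico 0 ε) (w : V × ℝ) :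
    halfDeriv w (f * g) q = halfDeriv w f q * g q + f q * halfDeriv w g q := by
  simp only [halfDeriv]
  rw [fderivWithin_mul (uniqueDiffOn_closedHalfSpace q (collar_subset_closedHalfSpace hq))
    (hf.differentiableWithinAt hS hq) (hg.differentiableWithinAt hS hq)]
  simp; ring

theorem halfDeriv_const (c : ℝ) (w : V × ℝ) : halfDeriv w (fun _ => c) q = 0 := by
  simp [halfDeriv]

/-- Second derivatives stay symmetric at the boundary, because every point of the half space lies in
the closure of its interior. -/
theorem halfDeriv_comm (hS : IsOpen S) (hf : SmoothUpTo S ε f)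
    (hq : q ∈ S ×ˢ Ico 0 ε) (v w : V × ℝ) :
    halfDeriv v (halfDeriv w f) q = halfDeriv w (halfDeriv v f) q := by
  have hu : UniqueDiffOn ℝ (closedHalfSpace V) := uniqueDiffOn_closedHalfSpace
  have hqH := collar_subset_closedHalfSpace hq
  have hsymm : IsSymmSndFDerivWithinAt ℝ f (closedHalfSpace V) q := by
    refine (hf.contDiffWithinAt hS hq).isSymmSndFDerivWithinAt (n := ∞) ?_ hu ?_ hqH
    · rw [minSmoothness_of_isRCLikeNormedField]
      exact WithTop.coe_le_coe.2 (le_top (a := (2 : ℕ∞)))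
    · have hc : Convex ℝ (closedHalfSpace V) := convex_univ.prod (convex_Ici 0)
      have : interior (closedHalfSpace V) = univ ×ˢ Ioi 0 := by
        simp [closedHalfSpace, interior_prod_eq]
      rw [this, closure_prod_eq, closure_Ioi]
      exact ⟨by simp, hqH.2⟩
  have hd : DifferentiableWithinAt ℝ (fderivWithin ℝ f (closedHalfSpace V)) (closedHalfSpace V) q :=
    ((hf.contDiffWithinAt hS hq).fderivWithin_right (m := ∞) hu (by simp) hqH).differentiableWithinAt
      (by simp)
  have key : ∀ a b : V × ℝ, halfDeriv a (halfDeriv b f) q =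
      fderivWithin ℝ (fderivWithin ℝ f (closedHalfSpace V)) (closedHalfSpace V) q a b := by
    intro a b
    unfold halfDeriv
    rw [fderivWithin_clm_apply (hu q hqH) hd (by fun_prop)]
    simp
  rw [key, key]
  exact hsymm v w

/-- The normal derivative, one-sided at the boundary. -/
noncomputable def normalDeriv (f : V × ℝ → ℝ) : V × ℝ → ℝ := halfDeriv ((0, 1) : V × ℝ) f

theorem SmoothUpTo.normalDeriv (hf : SmoothUpTo S ε f) (hS : IsOpen S) :
    SmoothUpTo S ε (normalDeriv f) := hf.halfDeriv hS _

theorem SmoothUpTo.iterate_normalDeriv (hf : SmoothUpTo S ε f) (hS : IsOpen S) (m : ℕ) :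
    SmoothUpTo S ε (_root_.normalDeriv^[m] f) := by
  induction m generalizing f with
  | zero => exact hf
  | succ m ih => exact ih (hf.normalDeriv hS)

theorem iterate_normalDeriv_congr (hS : IsOpen S) (m : ℕ)
    (h : ∀ q ∈ S ×ˢ Ico 0 ε, f q = g q) :
    ∀ q ∈ S ×ˢ Ico 0 ε, normalDeriv^[m] f q = normalDeriv^[m] g q := by
  induction m generalizing f g with
  | zero => exact h
  | succ m ih => exact ih fun q hq => halfDeriv_congr hS hq _ h

theorem iterate_normalDeriv_halfDeriv (hS : IsOpen S) (hf : SmoothUpTo S ε f) (w : V × ℝ) (m : ℕ) :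
    ∀ q ∈ S ×ˢ Ico 0 ε, normalDeriv^[m] (halfDeriv w f) q = halfDeriv w (normalDeriv^[m] f) q := by
  induction m generalizing f with
  | zero => intro q _; rfl
  | succ m ih =>
    intro q hq
    simp only [Function.iterate_succ, Function.comp]
    rw [← ih (hf.normalDeriv hS) q hq]
    exact iterate_normalDeriv_congr hS m (fun q hq => halfDeriv_comm hS hf hq _ _) q hq

/-- The Taylor series of `f` in the normal variable at the boundary point `y`. -/
noncomputable def bdrySeries (f : V × ℝ → ℝ) (y : V) : PowerSeries ℝ :=
  PowerSeries.mk fun m => (normalDeriv^[m] f) (y, 0) / (m.factorial : ℝ)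

theorem coeff_bdrySeries (f : V × ℝ → ℝ) (y : V) (m : ℕ) :
    PowerSeries.coeff m (bdrySeries f y) = (normalDeriv^[m] f) (y, 0) / (m.factorial : ℝ) := by
  simp [bdrySeries]

@[simp] theorem coeff_zero_bdrySeries (f : V × ℝ → ℝ) (y : V) :
    PowerSeries.coeff 0 (bdrySeries f y) = f (y, 0) := by
  simp [coeff_bdrySeries]

theorem zero_mem_collar (hε : 0 < ε) (hy : y ∈ S) : ((y, 0) : V × ℝ) ∈ S ×ˢ Ico 0 ε :=
  ⟨hy, le_rfl, hε⟩

theorem bdrySeries_congr (hS : IsOpen S) (hε : 0 < ε) (hy : y ∈ S)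
    (h : ∀ q ∈ S ×ˢ Ico 0 ε, f q = g q) : bdrySeries f y = bdrySeries g y := by
  ext m
  rw [coeff_bdrySeries, coeff_bdrySeries,
    iterate_normalDeriv_congr hS m h _ (zero_mem_collar hε hy)]

theorem coeff_bdrySeries_normalDeriv (f : V × ℝ → ℝ) (y : V) (m : ℕ) :
    PowerSeries.coeff m (bdrySeries (normalDeriv f) y) =
      (m + 1) * PowerSeries.coeff (m + 1) (bdrySeries f y) := by
  rw [coeff_bdrySeries, coeff_bdrySeries, Nat.factorial_succ]
  have : (m.factorial : ℝ) ≠ 0 := by positivity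
  have h2 : ((m : ℝ) + 1) ≠ 0 := by positivity
  push_cast
  field_simp
  simp

theorem bdrySeries_normalDeriv (f : V × ℝ → ℝ) (y : V) :
    bdrySeries (normalDeriv f) y = PowerSeries.derivative ℝ (bdrySeries f y) := by
  ext m
  rw [coeff_bdrySeries_normalDeriv, PowerSeries.coeff_derivative, mul_comm]

theorem bdrySeries_add (hS : IsOpen S) (hε : 0 < ε) (hf : SmoothUpTo S ε f)
    (hg : SmoothUpTo S ε g) (hy : y ∈ S) :
    bdrySeries (f + g) y = bdrySeries f y + bdrySeries g y := by
  ext m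
  induction m generalizing f g with
  | zero => rw [map_add]; simp only [coeff_zero_bdrySeries, Pi.add_apply]
  | succ m ih =>
    have h := ih (hf.normalDeriv hS) (hg.normalDeriv hS)
    rw [← bdrySeries_congr (f := normalDeriv (f + g)) (g := normalDeriv f + normalDeriv g) hS hε hy
      (fun q hq => halfDeriv_add hS hf hg hq _)] at h
    have h' := coeff_bdrySeries_normalDeriv (f + g) y m
    rw [h', map_add, coeff_bdrySeries_normalDeriv, coeff_bdrySeries_normalDeriv, ← mul_add] at h
    rw [map_add]
    exact mul_left_cancel₀ (by positivity) h

theorem bdrySeries_const (hS : IsOpen S) (hε : 0 < ε) (hy : y ∈ S) (c : ℝ) :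
    bdrySeries (fun _ : V × ℝ => c) y = PowerSeries.C c := by
  have key : ∀ m, normalDeriv^[m + 1] (fun _ : V × ℝ => c) = fun _ => 0 := by
    intro m
    induction m with
    | zero => funext q; simp [normalDeriv, halfDeriv_const]
    | succ m ih =>
      rw [Function.iterate_succ', Function.comp, ih]
      funext q; simp [normalDeriv, halfDeriv_const]
  ext m
  cases m with
  | zero => simp
  | succ m => rw [coeff_bdrySeries, key]; simp

/-- A power series is determined by its constant term and its derivative. The Leibniz rule for
`normalDeriv` matches the one for formal derivatives, so induction on the order applies to both
factors at once. -/
theorem bdrySeries_mul (hS : IsOpen S) (hε : 0 < ε) (hf : SmoothUpTo S ε f)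
    (hg : SmoothUpTo S ε g) (hy : y ∈ S) :
    bdrySeries (f * g) y = bdrySeries f y * bdrySeries g y := by
  ext m
  induction m generalizing f g with
  | zero =>
    rw [PowerSeries.coeff_mul, Finset.Nat.antidiagonal_zero]
    simp only [Finset.sum_singleton, coeff_zero_bdrySeries, Pi.mul_apply]
  | succ m ih =>
    have h1 := ih (hf.normalDeriv hS) hg
    have h2 := ih hf (hg.normalDeriv hS)
    have h3 := bdrySeries_add hS hε ((hf.normalDeriv hS).mul hg) (hf.mul (hg.normalDeriv hS)) hy
    rw [← bdrySeries_congr (f := normalDeriv (f * g))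
      (g := normalDeriv f * g + f * normalDeriv g) hS hε hy (fun q hq => halfDeriv_mul hS hf hg hq _)] at h3
    have h4 : PowerSeries.coeff m (bdrySeries (normalDeriv (f * g)) y) =
        PowerSeries.coeff m (PowerSeries.derivative ℝ (bdrySeries f y * bdrySeries g y)) := by
      rw [h3, map_add, h1, h2, bdrySeries_normalDeriv, bdrySeries_normalDeriv, ← map_add]
      congr 1
      rw [Derivation.leibniz]
      simp only [smul_eq_mul]
      ring
    rw [coeff_bdrySeries_normalDeriv, PowerSeries.coeff_derivative, mul_comm] at h4
    exact mul_right_cancel₀ (by positivity) h4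

theorem bdrySeries_neg (hS : IsOpen S) (hε : 0 < ε) (hf : SmoothUpTo S ε f) (hy : y ∈ S) :
    bdrySeries (-f) y = - bdrySeries f y := by
  have h := bdrySeries_mul hS hε (SmoothUpTo.const (-1)) hf hy
  rw [bdrySeries_const hS hε hy] at h
  have e : (fun _ : V × ℝ => (-1 : ℝ)) * f = -f := by funext q; simp
  rw [e] at h
  rw [h]; simp

theorem bdrySeries_sub (hS : IsOpen S) (hε : 0 < ε) (hf : SmoothUpTo S ε f)
    (hg : SmoothUpTo S ε g) (hy : y ∈ S) :
    bdrySeries (f - g) y = bdrySeries f y - bdrySeries g y := by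
  rw [sub_eq_add_neg, bdrySeries_add hS hε hf hg.neg hy, bdrySeries_neg hS hε hg hy,
    sub_eq_add_neg]

theorem bdrySeries_sum (hS : IsOpen S) (hε : 0 < ε) {ι : Type*} {s : Finset ι}
    {F : ι → V × ℝ → ℝ} (h : ∀ i ∈ s, SmoothUpTo S ε (F i)) (hy : y ∈ S) :
    bdrySeries (∑ i ∈ s, F i) y = ∑ i ∈ s, bdrySeries (F i) y := by
  classical
  induction s using Finset.induction_on with
  | empty =>
    have := bdrySeries_const hS hε hy (0 : ℝ)
    rw [map_zero] at this
    exact this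
  | insert a s ha ih =>
    rw [Finset.sum_insert ha, Finset.sum_insert ha, bdrySeries_add hS hε
      (h a (by simp)) (SmoothUpTo.sum fun i hi => h i (by simp [hi])) hy,
      ih fun i hi => h i (by simp [hi])]

theorem bdrySeries_snd (hS : IsOpen S) (hε : 0 < ε) (hy : y ∈ S) :
    bdrySeries (fun q : V × ℝ => q.2) y = PowerSeries.X := by
  have h1 : ∀ q ∈ S ×ˢ Ico 0 ε, normalDeriv (fun q : V × ℝ => q.2) q = 1 := by
    intro q hq
    have : HasFDerivWithinAt (fun q : V × ℝ => q.2) (ContinuousLinearMap.snd ℝ V ℝ)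
      (closedHalfSpace V) q := hasFDerivWithinAt_snd
    rw [normalDeriv, halfDeriv, this.fderivWithin
      (uniqueDiffOn_closedHalfSpace q (collar_subset_closedHalfSpace hq))]
    simp
  have h2 := bdrySeries_congr hS hε hy h1
  rw [bdrySeries_const hS hε hy] at h2
  ext m
  cases m with
  | zero => simp
  | succ m =>
    have h3 := coeff_bdrySeries_normalDeriv (fun q : V × ℝ => q.2) y m
    rw [h2] at h3
    have h4 : ((m : ℝ) + 1) ≠ 0 := by positivity
    rw [PowerSeries.coeff_X]
    rw [PowerSeries.coeff_C] at h3
    rcases Nat.eq_zero_or_pos m with rfl | hm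
    · simpa using h3.symm
    · rw [if_neg hm.ne'] at h3
      rw [if_neg (by omega)]
      exact (mul_eq_zero.1 h3.symm).resolve_left h4

theorem bdrySeries_snd_pow (hS : IsOpen S) (hε : 0 < ε) (hy : y ∈ S) (m : ℕ) :
    bdrySeries (fun q : V × ℝ => q.2 ^ m) y = PowerSeries.X ^ m := by
  induction m with
  | zero => simpa using bdrySeries_const hS hε hy 1
  | succ m ih =>
    have h := bdrySeries_mul hS hε (SmoothUpTo.snd_pow (ε := ε) m)
      (by simpa using SmoothUpTo.snd_pow (S := S) (ε := ε) 1) hy (g := fun q => q.2)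
    rw [ih, bdrySeries_snd hS hε hy, ← pow_succ] at h
    rw [← h]
    congr 1

theorem bdrySeries_fst (hS : IsOpen S) (hε : 0 < ε) (hy : y ∈ S) {c : V → ℝ}
    (hc : ContDiffOn ℝ ∞ c S) :
    bdrySeries (fun q : V × ℝ => c q.1) y = PowerSeries.C (c y) := by
  have h1 : ∀ q ∈ S ×ˢ Ico 0 ε, normalDeriv (fun q : V × ℝ => c q.1) q = 0 := by
    intro q hq
    have hcd : HasFDerivAt c (fderiv ℝ c q.1) q.1 :=
      ((hc.contDiffAt (hS.mem_nhds hq.1)).differentiableAt (by simp)).hasFDerivAt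
    have := (hcd.comp q (hasFDerivAt_fst (𝕜 := ℝ))).hasFDerivWithinAt (s := closedHalfSpace V)
    have h := this.fderivWithin
      (uniqueDiffOn_closedHalfSpace q (collar_subset_closedHalfSpace hq))
    rw [normalDeriv, halfDeriv]
    change fderivWithin ℝ (c ∘ Prod.fst) _ _ _ = _
    rw [h]
    simp
  have h2 := bdrySeries_congr hS hε hy h1
  rw [bdrySeries_const hS hε hy] at h2
  ext m
  cases m with
  | zero => simp
  | succ m =>
    have h3 := coeff_bdrySeries_normalDeriv (fun q : V × ℝ => c q.1) y m
    rw [h2] at h3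
    have h4 : ((m : ℝ) + 1) ≠ 0 := by positivity
    rw [PowerSeries.coeff_C, if_neg (by omega)]
    simp only [map_zero] at h3
    exact (mul_eq_zero.1 h3.symm).resolve_left h4

theorem halfDeriv_tangential_zero (hS : IsOpen S) (hε : 0 < ε) (hf : SmoothUpTo S ε f)
    (hy : y ∈ S) (v : V) :
    halfDeriv ((v, 0) : V × ℝ) f (y, 0) = fderiv ℝ (fun z => f (z, 0)) y v := by
  have h := (hf.differentiableWithinAt hS (zero_mem_collar hε hy)).hasFDerivWithinAt
  have h2 : HasFDerivWithinAt (fun z : V => ((z, 0) : V × ℝ)) (ContinuousLinearMap.inl ℝ V ℝ)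
      univ y := by
    have := (ContinuousLinearMap.inl ℝ V ℝ).hasFDerivAt (x := y)
    exact this.hasFDerivWithinAt
  have h3 := (h.comp y h2 (t := closedHalfSpace V) (fun z _ => ⟨mem_univ _, self_mem_Ici⟩)).hasFDerivAt
    univ_mem
  have h4 := h3.fderiv
  change fderiv ℝ (fun z => f (z, 0)) y = _ at h4
  rw [h4]; simp [halfDeriv]

/-- Tangential derivatives commute with normal ones and with restriction to the boundary. This is
how differential operators along the slices act on Taylor coefficients. -/
theorem coeff_bdrySeries_tangential (hS : IsOpen S) (hε : 0 < ε) (hf : SmoothUpTo S ε f)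
    (hy : y ∈ S) (v : V) (m : ℕ) :
    PowerSeries.coeff m (bdrySeries (halfDeriv ((v, 0) : V × ℝ) f) y) =
      fderiv ℝ (fun z => PowerSeries.coeff m (bdrySeries f z)) y v := by
  simp only [coeff_bdrySeries]
  rw [iterate_normalDeriv_halfDeriv hS hf _ m _ (zero_mem_collar hε hy),
    halfDeriv_tangential_zero hS hε (hf.iterate_normalDeriv hS m) hy]
  simp only [div_eq_mul_inv]
  by_cases hd : DifferentiableAt ℝ (fun z => normalDeriv^[m] f (z, 0)) y
  · rw [fderiv_mul_const hd]; simp [mul_comm]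
  · exfalso
    apply hd
    have : ContDiffOn ℝ ∞ (fun z => normalDeriv^[m] f (z, 0)) S :=
      ContDiffOn.comp (hf.iterate_normalDeriv hS m) (f := fun z : V => ((z, 0) : V × ℝ))
        (by fun_prop) (fun z hz => zero_mem_collar hε hz)
    exact (this.contDiffAt (hS.mem_nhds hy)).differentiableAt (by simp)

theorem hasDerivWithinAt_normalDeriv (hS : IsOpen S) (hf : SmoothUpTo S ε f) (hy : y ∈ S) {x : ℝ}
    (hx : x ∈ Ico 0 ε) :
    HasDerivWithinAt (fun t => f (y, t)) (normalDeriv f (y, x)) (Ici 0) x := by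
  have h := (hf.differentiableWithinAt hS (show (y, x) ∈ S ×ˢ Ico 0 ε from ⟨hy, hx⟩)).hasFDerivWithinAt
  have h2 : HasDerivWithinAt (fun t : ℝ => ((y, t) : V × ℝ)) ((0, 1) : V × ℝ) (Ici 0) x :=
    (hasDerivWithinAt_const x _ y).prodMk (hasDerivWithinAt_id x _)
  exact h.comp_hasDerivWithinAt x h2 (fun t ht => ⟨mem_univ _, ht⟩)

/-- Taylor's bound, uniform on compact sets: the mean value inequality from the boundary turns a
bound `C xᵐ` on the normal derivative into a bound `C xᵐ⁺¹` on the function. Taking `δ < ε` keeps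
the region compact inside the collar. -/
theorem exists_bound_of_coeff_eq_zero (hS : IsOpen S) (hε : 0 < ε) {m : ℕ} (hf : SmoothUpTo S ε f)
    {K : Set V} (hKS : K ⊆ S) (hK : IsCompact K) {δ : ℝ} (hδ : δ < ε)
    (h : ∀ j < m, ∀ y ∈ K, PowerSeries.coeff j (bdrySeries f y) = 0) :
    ∃ C, 0 ≤ C ∧ ∀ y ∈ K, ∀ x ∈ Icc 0 δ, |f (y, x)| ≤ C * x ^ m := by
  induction m generalizing f with
  | zero =>
    have hsub : K ×ˢ Icc 0 δ ⊆ S ×ˢ Ico 0 ε :=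
      prod_mono hKS fun x hx => ⟨hx.1, hx.2.trans_lt hδ⟩
    obtain ⟨C, hC⟩ := (hK.prod isCompact_Icc).exists_bound_of_continuousOn
      (ContDiffOn.continuousOn hf |>.mono hsub)
    refine ⟨max C 0, le_max_right _ _, fun y hy x hx => ?_⟩
    simpa using Or.inl (hC (y, x) ⟨hy, hx⟩)
  | succ m ih =>
    obtain ⟨C, hC0, hC⟩ := ih (hf.normalDeriv hS) (by
      intro j hj y hy
      rw [coeff_bdrySeries_normalDeriv, h (j + 1) (by omega) y hy, mul_zero])
    refine ⟨C, hC0, fun y hy x hx => ?_⟩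
    have hder : ∀ t ∈ Icc 0 x, HasDerivWithinAt (fun t => f (y, t)) (normalDeriv f (y, t))
        (Icc 0 x) t := fun t ht =>
      (hasDerivWithinAt_normalDeriv hS hf (hKS hy)
        ⟨ht.1, (ht.2.trans hx.2).trans_lt hδ⟩).mono Icc_subset_Ici_self
    have hb : ∀ t ∈ Icc 0 x, ‖normalDeriv f (y, t)‖ ≤ C * x ^ m := fun t ht =>
      (hC y hy t ⟨ht.1, ht.2.trans hx.2⟩).trans
        (mul_le_mul_of_nonneg_left (pow_le_pow_left₀ ht.1 ht.2 m) hC0)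
    have h0 : f (y, 0) = 0 := by simpa using h 0 (by omega) y hy
    have := (convex_Icc 0 x).norm_image_sub_le_of_norm_hasDerivWithin_le hder hb
      (left_mem_Icc.2 hx.1) (right_mem_Icc.2 hx.1)
    simp only [h0, sub_zero, Real.norm_eq_abs, abs_of_nonneg hx.1] at this
    rwa [pow_succ, ← mul_assoc]

/-- After subtraction of its term of order `m` the function is `O(xᵐ⁺¹)`, so that term is itself
`o(xᵐ)`. -/
theorem coeff_eq_zero_of_isLittleO (hS : IsOpen S) (hε : 0 < ε) {m : ℕ} (hf : SmoothUpTo S ε f)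
    (hy : y ∈ S) (h : ∀ j < m, PowerSeries.coeff j (bdrySeries f y) = 0)
    (ho : (fun x : ℝ => f (y, x)) =o[𝓝[>] 0] fun x => x ^ m) :
    PowerSeries.coeff m (bdrySeries f y) = 0 := by
  set c := PowerSeries.coeff m (bdrySeries f y) with hc
  have hsm : SmoothUpTo S ε (f - fun q => c * q.2 ^ m) :=
    hf.sub ((SmoothUpTo.const c).mul (SmoothUpTo.snd_pow m))
  have hser : bdrySeries (f - fun q => c * q.2 ^ m) y =
      bdrySeries f y - PowerSeries.C c * PowerSeries.X ^ m := by
    refine (bdrySeries_sub hS hε hf ((SmoothUpTo.const c).mul (SmoothUpTo.snd_pow m)) hy).trans ?_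
    congr 1
    have := bdrySeries_mul hS hε (SmoothUpTo.const (S := S) (ε := ε) c) (SmoothUpTo.snd_pow m) hy
    rw [bdrySeries_const hS hε hy, bdrySeries_snd_pow hS hε hy] at this
    exact this
  obtain ⟨C, hC0, hC⟩ := exists_bound_of_coeff_eq_zero hS hε (m := m + 1) hsm
    (singleton_subset_iff.2 hy) isCompact_singleton (half_lt_self hε) (by
      intro j hj z hz
      rw [mem_singleton_iff.1 hz, hser, map_sub, PowerSeries.coeff_C_mul, PowerSeries.coeff_X_pow]
      rcases Nat.lt_succ_iff_lt_or_eq.1 hj with hj | rfl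
      · rw [h j hj, if_neg hj.ne]; simp
      · simp [hc])
  have h1 : (fun x : ℝ => f (y, x) - c * x ^ m) =o[𝓝[>] 0] fun x => x ^ m := by
    have hO : (fun x : ℝ => f (y, x) - c * x ^ m) =O[𝓝[>] 0] fun x => x ^ (m + 1) := by
      refine Asymptotics.IsBigO.of_bound C ?_
      have hmem : Ioo 0 (ε / 2) ∈ 𝓝[>] (0 : ℝ) := Ioo_mem_nhdsGT (half_pos hε)
      filter_upwards [hmem] with x hx
      have := hC y rfl x ⟨hx.1.le, hx.2.le⟩
      simpa [abs_of_pos hx.1] using this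
    refine hO.trans_isLittleO ?_
    exact (Asymptotics.isLittleO_pow_pow (𝕜 := ℝ) (Nat.lt_succ_self m)).mono nhdsWithin_le_nhds
  have h2 : (fun x : ℝ => c * x ^ m) =o[𝓝[>] 0] fun x => x ^ m := by
    have := ho.sub h1
    simpa using this
  by_contra hne
  have h3 : (fun x : ℝ => x ^ m) =o[𝓝[>] 0] fun x : ℝ => x ^ m :=
    (Asymptotics.isLittleO_const_mul_left_iff hne).1 h2
  have h4 : ∃ᶠ x : ℝ in 𝓝[>] (0:ℝ), x ^ m ≠ 0 := by
    apply Eventually.frequently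
    filter_upwards [self_mem_nhdsWithin] with x hx
    exact pow_ne_zero _ (ne_of_gt hx)
  exact Asymptotics.isLittleO_irrefl h4 h3

end BoundaryCalculus

/-! ### Smoothness and derivatives of the inverse matrix. -/

section MatrixFunctions

variable {V : Type*} [NormedAddCommGroup V] [NormedSpace ℝ V] {ι : Type*} [Fintype ι]
  [DecidableEq ι]

theorem ContDiffOn.matrix_det {s : Set V} {m : ℕ∞ω} {A : V → Matrix ι ι ℝ}
    (h : ∀ i j, ContDiffOn ℝ m (fun q => A q i j) s) : ContDiffOn ℝ m (fun q => (A q).det) s := by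
  simp only [Matrix.det_apply']
  exact ContDiffOn.sum fun σ _ => contDiffOn_const.mul (contDiffOn_prod fun i _ => h _ _)

/-- By Cramer's rule the entries of the inverse are quotients of polynomials in the entries. -/
theorem ContDiffOn.matrix_inv {s : Set V} {m : ℕ∞ω} {A : V → Matrix ι ι ℝ}
    (h : ∀ i j, ContDiffOn ℝ m (fun q => A q i j) s) (hA : ∀ q ∈ s, (A q).det ≠ 0) (i j : ι) :
    ContDiffOn ℝ m (fun q => (A q)⁻¹ i j) s := by
  have e : ∀ q, (A q)⁻¹ i j = ((A q).det)⁻¹ * ((A q).updateRow j (Pi.single i 1)).det := by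
    intro q
    rw [Matrix.inv_def, Ring.inverse_eq_inv', Matrix.smul_apply, Matrix.adjugate_apply, smul_eq_mul]
  simp only [e]
  refine ((ContDiffOn.matrix_det h).inv hA).mul (ContDiffOn.matrix_det fun a b => ?_)
  by_cases ha : a = j
  · subst ha; simpa using contDiffOn_const
  · simpa [Matrix.updateRow_ne ha] using h a b

/-- If `I` is inverse to `A` and `I' A + I A' = 0`, then `I' = -I A' I`. -/
theorem Matrix.inv_deriv_apply {A A' I I' : Matrix ι ι ℝ} (hI : A * I = 1)
    (h : I' * A + I * A' = 0) (i j : ι) : I' i j = - ∑ k, ∑ l, I i k * A' k l * I l j := by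
  have h1 : I' = -(I * A' * I) := by
    calc I' = I' * A * I := by rw [Matrix.mul_assoc, hI, Matrix.mul_one]
      _ = -(I * A') * I := by rw [eq_neg_of_add_eq_zero_left h]
      _ = _ := by rw [Matrix.neg_mul]
  rw [h1, Matrix.neg_apply, Matrix.mul_apply]
  simp only [Matrix.mul_apply, Finset.sum_mul]
  rw [Finset.sum_comm]

theorem fderiv_matrix_inv_apply {s : Set V} (hs : IsOpen s) {A : V → Matrix ι ι ℝ}
    (h : ∀ i j, ContDiffOn ℝ ∞ (fun q => A q i j) s) (hA : ∀ q ∈ s, (A q).det ≠ 0) {y : V}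
    (hy : y ∈ s) (w : V) (i j : ι) :
    fderiv ℝ (fun q => (A q)⁻¹ i j) y w =
      - ∑ k, ∑ l, (A y)⁻¹ i k * fderiv ℝ (fun q => A q k l) y w * (A y)⁻¹ l j := by
  have hd : ∀ i j, DifferentiableAt ℝ (fun q => A q i j) y := fun i j =>
    ((h i j).contDiffAt (hs.mem_nhds hy)).differentiableAt (by simp)
  have hdi : ∀ i j, DifferentiableAt ℝ (fun q => (A q)⁻¹ i j) y := fun i j =>
    ((ContDiffOn.matrix_inv h hA i j).contDiffAt (hs.mem_nhds hy)).differentiableAt (by simp)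
  refine Matrix.inv_deriv_apply (A := A y) (I := (A y)⁻¹)
    (A' := Matrix.of fun k l => fderiv ℝ (fun q => A q k l) y w)
    (I' := Matrix.of fun k l => fderiv ℝ (fun q => (A q)⁻¹ k l) y w)
    (Matrix.mul_nonsing_inv _ (isUnit_iff_ne_zero.2 (hA y hy))) ?_ i j
  ext a b
  have h0 : (fun q => ∑ c, (A q)⁻¹ a c * A q c b) =ᶠ[𝓝 y] fun _ => (1 : Matrix ι ι ℝ) a b := by
    filter_upwards [hs.mem_nhds hy] with q hq
    rw [← Matrix.mul_apply, Matrix.nonsing_inv_mul _ (isUnit_iff_ne_zero.2 (hA q hq))]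
  have h1 := congrArg (fun L : V →L[ℝ] ℝ => L w) (h0.fderiv_eq (𝕜 := ℝ))
  simp only [fderiv_const_apply, zero_apply] at h1
  have h2 : fderiv ℝ (fun q => ∑ c, (A q)⁻¹ a c * A q c b) y =
      ∑ c, fderiv ℝ (fun q => (A q)⁻¹ a c * A q c b) y :=
    fderiv_fun_sum (fun c _ => (hdi a c).fun_mul (hd c b))
  rw [h2, sum_apply] at h1
  rw [Matrix.zero_apply, ← h1, Matrix.add_apply, Matrix.mul_apply, Matrix.mul_apply,
    ← Finset.sum_add_distrib]
  refine Finset.sum_congr rfl fun c _ => ?_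
  rw [fderiv_fun_mul (hdi a c) (hd c b)]
  simp [mul_comm]
  ring

theorem halfDeriv_sum {S : Set V} {ε : ℝ} (hS : IsOpen S) {s : Finset ι} {F : ι → V × ℝ → ℝ}
    (h : ∀ i ∈ s, SmoothUpTo S ε (F i)) {q : V × ℝ} (hq : q ∈ S ×ˢ Ico 0 ε) (w : V × ℝ) :
    halfDeriv w (∑ i ∈ s, F i) q = ∑ i ∈ s, halfDeriv w (F i) q := by
  induction s using Finset.induction_on with
  | empty => exact halfDeriv_const 0 w
  | insert a s ha ih =>
    rw [Finset.sum_insert ha, Finset.sum_insert ha, halfDeriv_add hS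
      (h a (by simp)) (SmoothUpTo.sum fun i hi => h i (by simp [hi])) hq,
      ih fun i hi => h i (by simp [hi])]

theorem halfDeriv_matrix_inv_apply {S : Set V} {ε : ℝ} (hS : IsOpen S) {A : V × ℝ → Matrix ι ι ℝ}
    (h : ∀ i j, SmoothUpTo S ε (fun q => A q i j)) (hA : ∀ q ∈ S ×ˢ Ico 0 ε, (A q).det ≠ 0)
    {q : V × ℝ} (hq : q ∈ S ×ˢ Ico 0 ε) (w : V × ℝ) (i j : ι) :
    halfDeriv w (fun q => (A q)⁻¹ i j) q =
      - ∑ k, ∑ l, (A q)⁻¹ i k * halfDeriv w (fun q => A q k l) q * (A q)⁻¹ l j := by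
  have hdi : ∀ i j, SmoothUpTo S ε (fun q => (A q)⁻¹ i j) := fun i j =>
    ContDiffOn.matrix_inv h hA i j
  refine Matrix.inv_deriv_apply (A := A q) (I := (A q)⁻¹)
    (A' := Matrix.of fun k l => halfDeriv w (fun q => A q k l) q)
    (I' := Matrix.of fun k l => halfDeriv w (fun q => (A q)⁻¹ k l) q)
    (Matrix.mul_nonsing_inv _ (isUnit_iff_ne_zero.2 (hA q hq))) ?_ i j
  ext a b
  have h0 : ∀ q ∈ S ×ˢ Ico 0 ε, (∑ c, (fun q => (A q)⁻¹ a c) * (fun q => A q c b)) q =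
      (1 : Matrix ι ι ℝ) a b := by
    intro q hq
    rw [Finset.sum_apply, ← Matrix.nonsing_inv_mul _ (isUnit_iff_ne_zero.2 (hA q hq)),
      Matrix.mul_apply]
    rfl
  have h1 := halfDeriv_congr (g := fun _ => (1 : Matrix ι ι ℝ) a b) hS hq w h0
  rw [halfDeriv_const, halfDeriv_sum hS (fun c _ => (hdi a c).mul (h c b)) hq] at h1
  rw [Matrix.zero_apply, ← h1, Matrix.add_apply, Matrix.mul_apply, Matrix.mul_apply,
    ← Finset.sum_add_distrib]
  refine Finset.sum_congr rfl fun c _ => ?_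
  rw [halfDeriv_mul hS (hdi a c) (h c b) hq]
  simp

end MatrixFunctions

/-! ### Polynomials in the jet of a metric. -/

section Jets

variable {n : ℕ}

/-- The values at `y` of the jet variables of a matrix valued function. -/
noncomputable def matrixJet (A : EuclideanSpace ℝ (Fin n) → Matrix (Fin n) (Fin n) ℝ)
    (y : EuclideanSpace ℝ (Fin n)) : JetVar n → ℝ
  | Sum.inl (i, j) => (A y)⁻¹ i j
  | Sum.inr (l, i, j) => l.foldr (partialDeriv (stdBasis n)) (fun z => A z i j) y

/-- The total derivative in the direction of the `i`-th coordinate. -/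
noncomputable def totalDeriv (i : Fin n) :
    Derivation ℝ (MvPolynomial (JetVar n) ℝ) (MvPolynomial (JetVar n) ℝ) :=
  MvPolynomial.mkDerivation ℝ fun v => match v with
    | Sum.inl (a, b) => - ∑ c, ∑ d, MvPolynomial.X (Sum.inl (a, c)) *
        MvPolynomial.X (Sum.inr ([i], c, d)) * MvPolynomial.X (Sum.inl (d, b))
    | Sum.inr (l, a, b) => MvPolynomial.X (Sum.inr (i :: l, a, b))

theorem ContDiffOn.partialDeriv {V : Type*} [NormedAddCommGroup V] [NormedSpace ℝ V] {ι : Type*}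
    {s : Set V} (hs : IsOpen s) {f : V → ℝ} (hf : ContDiffOn ℝ ∞ f s) (b : Module.Basis ι ℝ V)
    (i : ι) : ContDiffOn ℝ ∞ (partialDeriv b i f) s :=
  (hf.fderiv_of_isOpen (m := ∞) hs (by simp)).clm_apply contDiffOn_const

variable {S : Set (EuclideanSpace ℝ (Fin n))}
  {A : EuclideanSpace ℝ (Fin n) → Matrix (Fin n) (Fin n) ℝ}

theorem contDiffOn_matrixJet (hS : IsOpen S) (hA : ∀ i j, ContDiffOn ℝ ∞ (fun q => A q i j) S)
    (hdet : ∀ q ∈ S, (A q).det ≠ 0) (v : JetVar n) :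
    ContDiffOn ℝ ∞ (fun y => matrixJet A y v) S := by
  rcases v with ⟨i, j⟩ | ⟨l, i, j⟩
  · exact ContDiffOn.matrix_inv hA hdet i j
  · change ContDiffOn ℝ ∞ (l.foldr (_root_.partialDeriv (stdBasis n)) (fun z => A z i j)) S
    induction l with
    | nil => exact hA i j
    | cons a l ih => exact ContDiffOn.partialDeriv hS ih _ _

theorem contDiffOn_eval_matrixJet (hS : IsOpen S)
    (hA : ∀ i j, ContDiffOn ℝ ∞ (fun q => A q i j) S)
    (hdet : ∀ q ∈ S, (A q).det ≠ 0) (P : MvPolynomial (JetVar n) ℝ) :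
    ContDiffOn ℝ ∞ (fun y => MvPolynomial.eval (matrixJet A y) P) S := by
  induction P using MvPolynomial.induction_on with
  | C a => simpa using contDiffOn_const
  | add p q hp hq => simpa using hp.add hq
  | mul_X p v hp => simpa using hp.mul (contDiffOn_matrixJet hS hA hdet v)

/-- Both sides obey the Leibniz rule, so it suffices to compare them on the variables. The variables
for the inverse metric use `∂(A⁻¹) = -A⁻¹ (∂A) A⁻¹`, which is how `totalDeriv` acts on them. -/
theorem partialDeriv_eval_matrixJet (hS : IsOpen S)
    (hA : ∀ i j, ContDiffOn ℝ ∞ (fun q => A q i j) S)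
    (hdet : ∀ q ∈ S, (A q).det ≠ 0) (P : MvPolynomial (JetVar n) ℝ) (i : Fin n)
    {y : EuclideanSpace ℝ (Fin n)} (hy : y ∈ S) :
    partialDeriv (stdBasis n) i (fun y => MvPolynomial.eval (matrixJet A y) P) y =
      MvPolynomial.eval (matrixJet A y) (totalDeriv i P) := by
  have hd : ∀ P, DifferentiableAt ℝ (fun y => MvPolynomial.eval (matrixJet A y) P) y := fun P =>
    ((contDiffOn_eval_matrixJet hS hA hdet P).contDiffAt (hS.mem_nhds hy)).differentiableAt
      (by simp)
  have hv : ∀ v, DifferentiableAt ℝ (fun y => matrixJet A y v) y := fun v =>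
    ((contDiffOn_matrixJet hS hA hdet v).contDiffAt (hS.mem_nhds hy)).differentiableAt (by simp)
  induction P using MvPolynomial.induction_on with
  | C a => simp [partialDeriv, totalDeriv]
  | add p q hp hq =>
    simp only [map_add, ← hp, ← hq, partialDeriv]
    rw [fderiv_fun_add (hd p) (hd q)]
    rfl
  | mul_X p v hp =>
    simp only [map_mul, MvPolynomial.eval_X, Derivation.leibniz, map_add, smul_eq_mul, ← hp]
    simp only [partialDeriv]
    rw [fderiv_fun_mul (hd p) (hv v)]
    simp only [add_apply, smul_apply, smul_eq_mul]
    congr 2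
    rcases v with ⟨a, b⟩ | ⟨l, a, b⟩
    · change fderiv ℝ (fun y => (A y)⁻¹ a b) y _ = _
      rw [fderiv_matrix_inv_apply hS hA hdet hy]
      simp [totalDeriv, MvPolynomial.mkDerivation_X, matrixJet, partialDeriv]
    · simp [totalDeriv, MvPolynomial.mkDerivation_X, matrixJet, partialDeriv]

end Jets

/-! ### Slice geometry and the Einstein defect of the collar metric. -/

section CollarQuantities

variable {n : ℕ}

/-- The one-sided derivative in the direction of the `i`-th coordinate of `ℝⁿ`. -/
noncomputable def tangDeriv (i : Fin n) (f : EuclideanSpace ℝ (Fin n) × ℝ → ℝ) :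
    EuclideanSpace ℝ (Fin n) × ℝ → ℝ :=
  halfDeriv ((stdBasis n i, 0) : EuclideanSpace ℝ (Fin n) × ℝ) f

variable (K : EuclideanSpace ℝ (Fin n) × ℝ → Matrix (Fin n) (Fin n) ℝ)

/-- The Christoffel symbols of the slices `K (·, x)`. -/
noncomputable def sliceChristoffel (k i j : Fin n) : EuclideanSpace ℝ (Fin n) × ℝ → ℝ :=
  fun q => (1 / 2 : ℝ) * ∑ l, (K q)⁻¹ k l *
    (tangDeriv i (fun z => K z j l) q + tangDeriv j (fun z => K z i l) q
      - tangDeriv l (fun z => K z i j) q)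

/-- The Ricci tensor of the slices `K (·, x)`. -/
noncomputable def sliceRicci (i j : Fin n) : EuclideanSpace ℝ (Fin n) × ℝ → ℝ :=
  fun q => (∑ k, (tangDeriv k (sliceChristoffel K k i j) q
      - tangDeriv j (sliceChristoffel K k i k) q))
    + ∑ k, ∑ l, (sliceChristoffel K k k l q * sliceChristoffel K l i j q
        - sliceChristoffel K k j l q * sliceChristoffel K l i k q)

/-- `tr (K⁻¹ K')`. -/
noncomputable def traceDeriv : EuclideanSpace ℝ (Fin n) × ℝ → ℝ :=
  fun q => ∑ k, ∑ l, (K q)⁻¹ k l * normalDeriv (fun z => K z k l) q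

/-- `x` times the tangential components of `Ric(g) + n g`, for `g = x⁻² (K + dx²)`. -/
noncomputable def tangentialDefect (i j : Fin n) : EuclideanSpace ℝ (Fin n) × ℝ → ℝ :=
  fun q => q.2 * sliceRicci K i j q
    + (-(1 / 2 : ℝ)) * (q.2 * normalDeriv (normalDeriv fun z => K z i j) q)
    + (((n : ℝ) - 1) / 2) * normalDeriv (fun z => K z i j) q
    + (1 / 2 : ℝ) * (K q i j * traceDeriv K q)
    + (-(1 / 4 : ℝ)) * (q.2 * (traceDeriv K q * normalDeriv (fun z => K z i j) q))
    + (1 / 2 : ℝ) * (q.2 * ∑ k, ∑ l,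
        normalDeriv (fun z => K z i k) q * ((K q)⁻¹ k l * normalDeriv (fun z => K z j l) q))

/-- `x` times the normal component of `Ric(g) + n g`, for `g = x⁻² (K + dx²)`. -/
noncomputable def normalDefect : EuclideanSpace ℝ (Fin n) × ℝ → ℝ :=
  fun q => (-(1 / 2 : ℝ)) * (q.2 * normalDeriv (traceDeriv K) q) + (1 / 2 : ℝ) * traceDeriv K q
    + (-(1 / 4 : ℝ)) * (q.2 * ∑ i, ∑ j, ∑ k, ∑ l,
        ((K q)⁻¹ i j * normalDeriv (fun z => K z j k) q) *
          ((K q)⁻¹ k l * normalDeriv (fun z => K z l i) q))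

/-- `x⁻¹` times the trace of `Ric(g) + n g`, for `g = x⁻² (K + dx²)`. -/
noncomputable def traceDefect : EuclideanSpace ℝ (Fin n) × ℝ → ℝ :=
  fun q => (∑ i, ∑ j, (K q)⁻¹ i j * tangentialDefect K i j q) + normalDefect K q

end CollarQuantities

/-- A Poincaré metric `x⁻² (K + dx²)` in coordinates, on `S × [0, ε)`; the asymptotic Einstein
condition is imposed on the Taylor coefficients at the boundary. -/
structure PoincareData (n : ℕ) where
  S : Set (EuclideanSpace ℝ (Fin n))
  ε : ℝ
  K : EuclideanSpace ℝ (Fin n) × ℝ → Matrix (Fin n) (Fin n) ℝ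
  isOpen : IsOpen S
  ε_pos : 0 < ε
  smooth : ∀ i j, SmoothUpTo S ε (fun q => K q i j)
  posDef : ∀ q ∈ S ×ˢ Ico 0 ε, (K q).PosDef
  tangential : ∀ i j, ∀ y ∈ S, ∀ m, m + 1 < n →
    PowerSeries.coeff m (bdrySeries (tangentialDefect K i j) y) = 0
  trace : ∀ y ∈ S, ∀ m < n, PowerSeries.coeff m (bdrySeries (traceDefect K) y) = 0

namespace PoincareData

variable {n : ℕ} (d : PoincareData n)

theorem det_ne_zero {q : EuclideanSpace ℝ (Fin n) × ℝ} (hq : q ∈ d.S ×ˢ Ico 0 d.ε) :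
    (d.K q).det ≠ 0 := (d.posDef q hq).det_pos.ne'

theorem symm {q : EuclideanSpace ℝ (Fin n) × ℝ} (hq : q ∈ d.S ×ˢ Ico 0 d.ε) (i j : Fin n) :
    d.K q i j = d.K q j i := by
  simpa using congrFun (congrFun (d.posDef q hq).isHermitian j) i

theorem smooth_inv (i j : Fin n) : SmoothUpTo d.S d.ε (fun q => (d.K q)⁻¹ i j) :=
  ContDiffOn.matrix_inv d.smooth (fun _ hq => d.det_ne_zero hq) i j

/-- The values at `y` of the jet variables of the boundary metric. -/
noncomputable def jet (y : EuclideanSpace ℝ (Fin n)) : JetVar n → ℝ :=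
  matrixJet (fun z => d.K (z, 0)) y

theorem contDiffOn_bdry (i j : Fin n) : ContDiffOn ℝ ∞ (fun y => d.K (y, 0) i j) d.S :=
  ContDiffOn.comp (d.smooth i j) (f := fun z => (z, 0)) (by fun_prop)
    (fun z hz => zero_mem_collar d.ε_pos hz)

theorem contDiffOn_eval_jet (P : MvPolynomial (JetVar n) ℝ) :
    ContDiffOn ℝ ∞ (fun y => MvPolynomial.eval (d.jet y) P) d.S :=
  contDiffOn_eval_matrixJet d.isOpen d.contDiffOn_bdry
    (fun _ hy => d.det_ne_zero (zero_mem_collar d.ε_pos hy)) P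

theorem partialDeriv_eval_jet (P : MvPolynomial (JetVar n) ℝ) (i : Fin n)
    {y : EuclideanSpace ℝ (Fin n)} (hy : y ∈ d.S) :
    partialDeriv (stdBasis n) i (fun y => MvPolynomial.eval (d.jet y) P) y =
      MvPolynomial.eval (d.jet y) (totalDeriv i P) :=
  partialDeriv_eval_matrixJet d.isOpen d.contDiffOn_bdry
    (fun _ hy => d.det_ne_zero (zero_mem_collar d.ε_pos hy)) P i hy

end PoincareData

/-! ### Taylor coefficients given by universal polynomials. -/

section Universal

variable {n : ℕ}

/-- The functions `c d` on the boundary are given by a universal polynomial in the jet of the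
boundary metric. -/
def IsUniversal (c : PoincareData n → EuclideanSpace ℝ (Fin n) → ℝ) : Prop :=
  ∃ P : MvPolynomial (JetVar n) ℝ, ∀ d : PoincareData n, ∀ y ∈ d.S,
    c d y = MvPolynomial.eval (d.jet y) P

namespace IsUniversal

variable {c c' : PoincareData n → EuclideanSpace ℝ (Fin n) → ℝ}

theorem congr (h : IsUniversal c) (e : ∀ d : PoincareData n, ∀ y ∈ d.S, c' d y = c d y) :
    IsUniversal c' := by
  obtain ⟨P, hP⟩ := h
  exact ⟨P, fun d y hy => (e d y hy).trans (hP d y hy)⟩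

theorem add (h : IsUniversal c) (h' : IsUniversal c') :
    IsUniversal (fun d y => c d y + c' d y) := by
  obtain ⟨P, hP⟩ := h
  obtain ⟨P', hP'⟩ := h'
  exact ⟨P + P', fun d y hy => by simp only [map_add, hP d y hy, hP' d y hy]⟩

theorem mul (h : IsUniversal c) (h' : IsUniversal c') :
    IsUniversal (fun d y => c d y * c' d y) := by
  obtain ⟨P, hP⟩ := h
  obtain ⟨P', hP'⟩ := h'
  exact ⟨P * P', fun d y hy => by simp only [map_mul, hP d y hy, hP' d y hy]⟩

theorem const (a : ℝ) : IsUniversal (fun (_ : PoincareData n) _ => a) :=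
  ⟨MvPolynomial.C a, fun d y _ => by simp⟩

theorem neg (h : IsUniversal c) : IsUniversal (fun d y => - c d y) :=
  ((const (-1)).mul h).congr fun d y _ => by ring

theorem sub (h : IsUniversal c) (h' : IsUniversal c') :
    IsUniversal (fun d y => c d y - c' d y) :=
  (h.add h'.neg).congr fun d y _ => by ring

theorem sum {ι : Type*} {s : Finset ι} {F : ι → PoincareData n → EuclideanSpace ℝ (Fin n) → ℝ}
    (h : ∀ i ∈ s, IsUniversal (F i)) : IsUniversal (fun d y => ∑ i ∈ s, F i d y) := by
  classical
  induction s using Finset.induction_on with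
  | empty => simpa using const 0
  | insert a s ha ih =>
    simp only [Finset.sum_insert ha]
    exact (h a (by simp)).add (ih fun i hi => h i (by simp [hi]))

theorem of_const_mul {a : ℝ} (ha : a ≠ 0) (h : IsUniversal (fun d y => a * c d y)) :
    IsUniversal c :=
  ((const a⁻¹).mul h).congr fun d y _ => by field_simp

/-- The polynomial identity holds on an open set, so it can be differentiated, and `totalDeriv`
keeps the result polynomial. -/
theorem fderiv_basis (h : IsUniversal c) (i : Fin n) :
    IsUniversal (fun d y => fderiv ℝ (c d) y (stdBasis n i)) := by
  obtain ⟨P, hP⟩ := h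
  refine ⟨totalDeriv i P, fun d y hy => ?_⟩
  rw [← d.partialDeriv_eval_jet P i hy, partialDeriv]
  change fderiv ℝ (c d) y _ = _
  congr 1
  apply Filter.EventuallyEq.fderiv_eq
  filter_upwards [d.isOpen.mem_nhds hy] with z hz using hP d z hz

theorem inv_bdry (i j : Fin n) :
    IsUniversal (fun (d : PoincareData n) y => (d.K (y, 0))⁻¹ i j) :=
  ⟨MvPolynomial.X (Sum.inl (i, j)), fun d y _ => by simp [PoincareData.jet, matrixJet]⟩

theorem bdry (i j : Fin n) :
    IsUniversal (fun (d : PoincareData n) y => d.K (y, 0) i j) :=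
  ⟨MvPolynomial.X (Sum.inr ([], i, j)), fun d y _ => by simp [PoincareData.jet, matrixJet]⟩

end IsUniversal

/-- The Taylor coefficients at the boundary of order less than `m` of the smooth functions `f d`
are given by universal polynomials in the jet of the boundary metric. -/
structure UniversalTo (m : ℕ) (f : PoincareData n → EuclideanSpace ℝ (Fin n) × ℝ → ℝ) : Prop where
  smooth : ∀ d : PoincareData n, SmoothUpTo d.S d.ε (f d)
  coeff : ∀ j < m, IsUniversal (fun d y => PowerSeries.coeff j (bdrySeries (f d) y))

namespace UniversalTo

variable {m : ℕ} {f g : PoincareData n → EuclideanSpace ℝ (Fin n) × ℝ → ℝ}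

theorem congr (h : UniversalTo m f)
    (e : ∀ d : PoincareData n, ∀ q ∈ d.S ×ˢ Ico 0 d.ε, g d q = f d q) : UniversalTo m g :=
  ⟨fun d => (h.smooth d).congr (e d), fun j hj => (h.coeff j hj).congr fun d y hy => by
    rw [bdrySeries_congr d.isOpen d.ε_pos hy (e d)]⟩

theorem mono {m' : ℕ} (h : UniversalTo m f) (hm : m' ≤ m) : UniversalTo m' f :=
  ⟨h.smooth, fun j hj => h.coeff j (hj.trans_le hm)⟩

theorem add (hf : UniversalTo m f) (hg : UniversalTo m g) :
    UniversalTo m (fun d q => f d q + g d q) :=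
  ⟨fun d => (hf.smooth d).add (hg.smooth d), fun j hj =>
    ((hf.coeff j hj).add (hg.coeff j hj)).congr fun d y hy => by
      rw [← map_add, ← bdrySeries_add d.isOpen d.ε_pos (hf.smooth d) (hg.smooth d) hy]; rfl⟩

theorem mul (hf : UniversalTo m f) (hg : UniversalTo m g) :
    UniversalTo m (fun d q => f d q * g d q) :=
  ⟨fun d => (hf.smooth d).mul (hg.smooth d), fun j hj => by
    have h : IsUniversal (fun d y => ∑ p ∈ Finset.HasAntidiagonal.antidiagonal j,
        PowerSeries.coeff p.1 (bdrySeries (f d) y) * PowerSeries.coeff p.2 (bdrySeries (g d) y)) :=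
      IsUniversal.sum fun p hp => by
        have := Finset.HasAntidiagonal.mem_antidiagonal.1 hp
        exact (hf.coeff _ (by omega)).mul (hg.coeff _ (by omega))
    refine h.congr fun d y hy => ?_
    rw [← PowerSeries.coeff_mul,
      ← bdrySeries_mul d.isOpen d.ε_pos (hf.smooth d) (hg.smooth d) hy]; rfl⟩

theorem of_fst {c : PoincareData n → EuclideanSpace ℝ (Fin n) → ℝ} (hc : IsUniversal c)
    (m : ℕ) : UniversalTo m (fun d q => c d q.1) := by
  obtain ⟨P, hP⟩ := hc
  have hs : ∀ d : PoincareData n, ContDiffOn ℝ ∞ (c d) d.S := fun d =>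
    (d.contDiffOn_eval_jet P).congr (hP d)
  refine ⟨fun d => SmoothUpTo.of_fst (hs d), fun j _ => ?_⟩
  have h : IsUniversal (fun d y => if j = 0 then c d y else 0) := by
    split_ifs
    · exact ⟨P, hP⟩
    · exact IsUniversal.const 0
  refine h.congr fun d y hy => ?_
  rw [bdrySeries_fst d.isOpen d.ε_pos hy (hs d), PowerSeries.coeff_C]

theorem const (a : ℝ) (m : ℕ) : UniversalTo m (fun (_ : PoincareData n) _ => a) :=
  of_fst (IsUniversal.const a) m

theorem const_mul (a : ℝ) (h : UniversalTo m f) : UniversalTo m (fun d q => a * f d q) :=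
  (const a m).mul h

theorem neg (hf : UniversalTo m f) : UniversalTo m (fun d q => - f d q) :=
  (hf.const_mul (-1)).congr fun d q _ => by ring

theorem sub (hf : UniversalTo m f) (hg : UniversalTo m g) :
    UniversalTo m (fun d q => f d q - g d q) :=
  (hf.add hg.neg).congr fun d q _ => by ring

theorem sum {ι : Type*} {s : Finset ι}
    {F : ι → PoincareData n → EuclideanSpace ℝ (Fin n) × ℝ → ℝ}
    (h : ∀ i ∈ s, UniversalTo m (F i)) : UniversalTo m (fun d q => ∑ i ∈ s, F i d q) := by
  classical
  induction s using Finset.induction_on with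
  | empty => simpa using const 0 m
  | insert a s ha ih =>
    simp only [Finset.sum_insert ha]
    exact (h a (by simp)).add (ih fun i hi => h i (by simp [hi]))

theorem tangDeriv (hf : UniversalTo m f) (i : Fin n) :
    UniversalTo m (fun d => tangDeriv i (f d)) :=
  ⟨fun d => (hf.smooth d).halfDeriv d.isOpen _, fun j hj =>
    ((hf.coeff j hj).fderiv_basis i).congr fun d y hy =>
      coeff_bdrySeries_tangential d.isOpen d.ε_pos (hf.smooth d) hy _ _⟩

theorem normalDeriv (hf : UniversalTo (m + 1) f) : UniversalTo m (fun d => normalDeriv (f d)) :=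
  ⟨fun d => (hf.smooth d).normalDeriv d.isOpen, fun j hj =>
    ((IsUniversal.const ((j : ℝ) + 1)).mul (hf.coeff (j + 1) (by omega))).congr fun d y hy =>
      coeff_bdrySeries_normalDeriv _ _ _⟩

/-- Meant for inductions in which the derivative is expressed through the function itself, as in
`universalTo_inv`: only the boundary value has to be supplied. -/
theorem of_normalDeriv (hs : ∀ d : PoincareData n, SmoothUpTo d.S d.ε (f d))
    (h0 : IsUniversal (fun d y => f d (y, 0)))
    (h : UniversalTo m (fun d => _root_.normalDeriv (f d))) : UniversalTo (m + 1) f := by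
  refine ⟨hs, fun j hj => ?_⟩
  cases j with
  | zero => simpa only [coeff_zero_bdrySeries] using h0
  | succ j =>
    have h1 := h.coeff j (by omega)
    simp only [coeff_bdrySeries_normalDeriv] at h1
    exact h1.of_const_mul (by positivity)

theorem zero_order (hs : ∀ d : PoincareData n, SmoothUpTo d.S d.ε (f d)) : UniversalTo 0 f :=
  ⟨hs, fun j hj => absurd hj (by omega)⟩

end UniversalTo

theorem smoothUpTo_snd {S : Set (EuclideanSpace ℝ (Fin n))} {ε : ℝ} :
    SmoothUpTo S ε (fun q => q.2) := contDiff_snd.contDiffOn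

theorem bdrySeries_snd_mul (d : PoincareData n) {f : EuclideanSpace ℝ (Fin n) × ℝ → ℝ}
    (hf : SmoothUpTo d.S d.ε f) {y : EuclideanSpace ℝ (Fin n)} (hy : y ∈ d.S) :
    bdrySeries (fun q => q.2 * f q) y = PowerSeries.X * bdrySeries f y := by
  rw [← bdrySeries_snd d.isOpen d.ε_pos hy, ← bdrySeries_mul d.isOpen d.ε_pos smoothUpTo_snd hf hy]
  rfl

/-- A factor `x` shifts the coefficients and gains one order. This gain decides which terms of the
equations count as lower order. -/
theorem UniversalTo.snd_mul {m : ℕ} {f : PoincareData n → EuclideanSpace ℝ (Fin n) × ℝ → ℝ}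
    (hf : UniversalTo m f) : UniversalTo (m + 1) (fun d q => q.2 * f d q) := by
  refine ⟨fun d => smoothUpTo_snd.mul (hf.smooth d), fun j hj => ?_⟩
  cases j with
  | zero => simpa using IsUniversal.const 0
  | succ j =>
    refine (hf.coeff j (by omega)).congr fun d y hy => ?_
    rw [bdrySeries_snd_mul d (hf.smooth d) hy, PowerSeries.coeff_succ_X_mul]

/-- The coefficients of `f` of order less than `m` are universal, and so is the coefficient of order
`m` up to the term `L`. -/
structure LeadingTerm (m : ℕ) (f : PoincareData n → EuclideanSpace ℝ (Fin n) × ℝ → ℝ)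
    (L : PoincareData n → EuclideanSpace ℝ (Fin n) → ℝ) : Prop where
  lower : UniversalTo m f
  leading : IsUniversal (fun d y => PowerSeries.coeff m (bdrySeries (f d) y) - L d y)

namespace LeadingTerm

variable {m : ℕ} {f g : PoincareData n → EuclideanSpace ℝ (Fin n) × ℝ → ℝ}
  {L L' : PoincareData n → EuclideanSpace ℝ (Fin n) → ℝ}

theorem of_universalTo (h : UniversalTo (m + 1) f) : LeadingTerm m f (fun _ _ => 0) :=
  ⟨h.mono (Nat.le_succ m), (h.coeff m (Nat.lt_succ_self m)).congr fun d y _ => by ring⟩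

theorem self (h : UniversalTo m f) :
    LeadingTerm m f (fun d y => PowerSeries.coeff m (bdrySeries (f d) y)) :=
  ⟨h, (IsUniversal.const 0).congr fun d y _ => by ring⟩

theorem universalTo (h : LeadingTerm m f L) (hL : IsUniversal L) : UniversalTo (m + 1) f := by
  refine ⟨h.lower.smooth, fun j hj => ?_⟩
  rcases Nat.lt_succ_iff_lt_or_eq.1 hj with hj | rfl
  · exact h.lower.coeff j hj
  · exact (h.leading.add hL).congr fun d y _ => by ring

theorem congr_right (h : LeadingTerm m f L) (e : ∀ d : PoincareData n, ∀ y ∈ d.S, L' d y = L d y) :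
    LeadingTerm m f L' :=
  ⟨h.lower, h.leading.congr fun d y hy => by rw [e d y hy]⟩

theorem add (hf : LeadingTerm m f L) (hg : LeadingTerm m g L') :
    LeadingTerm m (fun d q => f d q + g d q) (fun d y => L d y + L' d y) := by
  refine ⟨hf.lower.add hg.lower, (hf.leading.add hg.leading).congr fun d y hy => ?_⟩
  have h := congrArg (PowerSeries.coeff m)
    (bdrySeries_add d.isOpen d.ε_pos (hf.lower.smooth d) (hg.lower.smooth d) hy)
  rw [map_add] at h
  change PowerSeries.coeff m (bdrySeries (f d + g d) y) - _ = _
  rw [h]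
  ring

/-- In the Cauchy product only the pair `(0, m)` involves the coefficient of order `m` of the second
factor. -/
theorem mul_left (hf : UniversalTo (m + 1) f) (hg : LeadingTerm m g L) :
    LeadingTerm m (fun d q => f d q * g d q) (fun d y => f d (y, 0) * L d y) := by
  refine ⟨(hf.mono (Nat.le_succ m)).mul hg.lower, ?_⟩
  have h : IsUniversal (fun d y => ∑ p ∈ (Finset.HasAntidiagonal.antidiagonal m).erase (0, m),
        PowerSeries.coeff p.1 (bdrySeries (f d) y) * PowerSeries.coeff p.2 (bdrySeries (g d) y)) :=
      IsUniversal.sum fun p hp => by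
        obtain ⟨h1, h2⟩ := Finset.mem_erase.1 hp
        have h3 := Finset.HasAntidiagonal.mem_antidiagonal.1 h2
        have h4 : p.2 ≠ m := fun h4 => h1 (Prod.ext (by simp; omega) h4)
        exact (hf.coeff _ (by omega)).mul (hg.lower.coeff _ (by omega))
  refine (h.add ((hf.coeff 0 (by omega)).mul hg.leading)).congr fun d y hy => ?_
  have e := congrArg (PowerSeries.coeff m)
    (bdrySeries_mul d.isOpen d.ε_pos (hf.smooth d) (hg.lower.smooth d) hy)
  rw [PowerSeries.coeff_mul, ← Finset.sum_erase_add _ _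
    (show ((0, m) : ℕ × ℕ) ∈ Finset.HasAntidiagonal.antidiagonal m by simp)] at e
  change PowerSeries.coeff m (bdrySeries (f d * g d) y) - _ = _
  rw [e, coeff_zero_bdrySeries]
  ring

theorem const_mul (a : ℝ) (hg : LeadingTerm m g L) :
    LeadingTerm m (fun d q => a * g d q) (fun d y => a * L d y) :=
  mul_left (UniversalTo.const a (m + 1)) hg

theorem sum {ι : Type*} {s : Finset ι}
    {F : ι → PoincareData n → EuclideanSpace ℝ (Fin n) × ℝ → ℝ}
    {L : ι → PoincareData n → EuclideanSpace ℝ (Fin n) → ℝ}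
    (h : ∀ i ∈ s, LeadingTerm m (F i) (L i)) :
    LeadingTerm m (fun d q => ∑ i ∈ s, F i d q) (fun d y => ∑ i ∈ s, L i d y) := by
  classical
  induction s using Finset.induction_on with
  | empty => simpa using of_universalTo (UniversalTo.const 0 (m + 1))
  | insert a s ha ih =>
    simp only [Finset.sum_insert ha]
    exact (h a (by simp)).add (ih fun i hi => h i (by simp [hi]))

theorem normalDeriv (h : LeadingTerm (m + 1) f L) :
    LeadingTerm m (fun d => normalDeriv (f d)) (fun d y => ((m : ℝ) + 1) * L d y) := by
  refine ⟨h.lower.normalDeriv, ((IsUniversal.const ((m : ℝ) + 1)).mul h.leading).congr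
    fun d y hy => ?_⟩
  rw [coeff_bdrySeries_normalDeriv]
  ring

/-- The Euler operator `x ∂ₓ` multiplies the coefficient of order `m` by `m`. Unlike `∂ₓ` it loses
no order, so the terms of a Fuchsian equation can be compared at a common order. -/
theorem snd_mul_normalDeriv (h : LeadingTerm m f L) :
    LeadingTerm m (fun d q => q.2 * _root_.normalDeriv (f d) q) (fun d y => (m : ℝ) * L d y) := by
  cases m with
  | zero =>
    have : UniversalTo 1 (fun d q => q.2 * _root_.normalDeriv (f d) q) :=
      (UniversalTo.zero_order fun d => (h.lower.smooth d).normalDeriv d.isOpen).snd_mul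
    simpa using of_universalTo this
  | succ m =>
    refine ⟨h.lower.normalDeriv.snd_mul, (h.normalDeriv.leading).congr fun d y hy => ?_⟩
    rw [bdrySeries_snd_mul d ((h.lower.smooth d).normalDeriv d.isOpen) hy,
      PowerSeries.coeff_succ_X_mul]
    push_cast
    ring

end LeadingTerm

end Universal

/-! ### The Einstein recursion for the coefficients of the metric. -/

section EinsteinRecursion

variable {n m : ℕ}

/-- The identity `(K⁻¹)' = -K⁻¹ K' K⁻¹` yields each coefficient of `K⁻¹` from earlier ones and from
coefficients of `K`; the boundary value is itself a jet variable. -/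
theorem universalTo_inv (h : ∀ i j, UniversalTo m (fun (d : PoincareData n) q => d.K q i j))
    (i j : Fin n) : UniversalTo m (fun (d : PoincareData n) q => (d.K q)⁻¹ i j) := by
  induction m generalizing i j with
  | zero => exact UniversalTo.zero_order fun d => d.smooth_inv i j
  | succ m ih =>
    refine UniversalTo.of_normalDeriv (fun d => d.smooth_inv i j) (IsUniversal.inv_bdry i j) ?_
    have hi := ih fun i j => (h i j).mono (Nat.le_succ m)
    have h1 : UniversalTo m (fun (d : PoincareData n) q => - ∑ k, ∑ l,
        (d.K q)⁻¹ i k * normalDeriv (fun q => d.K q k l) q * (d.K q)⁻¹ l j) :=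
      (UniversalTo.sum fun k _ => UniversalTo.sum fun l _ =>
        ((hi i k).mul (h k l).normalDeriv).mul (hi l j)).neg
    exact h1.congr fun d q hq => halfDeriv_matrix_inv_apply d.isOpen d.smooth
      (fun q hq => d.det_ne_zero hq) hq _ i j

theorem universalTo_sliceChristoffel
    (h : ∀ i j, UniversalTo m (fun (d : PoincareData n) q => d.K q i j)) (k i j : Fin n) :
    UniversalTo m (fun (d : PoincareData n) => sliceChristoffel d.K k i j) :=
  (UniversalTo.sum fun l _ => (universalTo_inv h k l).mul
    ((((h j l).tangDeriv i).add ((h i l).tangDeriv j)).sub ((h i j).tangDeriv l))).const_mul (1 / 2)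

theorem universalTo_sliceRicci
    (h : ∀ i j, UniversalTo m (fun (d : PoincareData n) q => d.K q i j)) (i j : Fin n) :
    UniversalTo m (fun (d : PoincareData n) => sliceRicci d.K i j) := by
  have hc := universalTo_sliceChristoffel h
  exact (UniversalTo.sum fun k _ => ((hc k i j).tangDeriv k).sub ((hc k i k).tangDeriv j)).add
    (UniversalTo.sum fun k _ => UniversalTo.sum fun l _ =>
      ((hc k k l).mul (hc l i j)).sub ((hc k j l).mul (hc l i k)))

/-- The Taylor coefficient of order `m` of the metric at the boundary. -/
noncomputable def metricCoeff (m : ℕ) (i j : Fin n) (d : PoincareData n)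
    (y : EuclideanSpace ℝ (Fin n)) : ℝ :=
  PowerSeries.coeff m (bdrySeries (fun q => d.K q i j) y)

/-- The trace of the Taylor coefficient of order `m` of the metric at the boundary. -/
noncomputable def traceCoeff (m : ℕ) (d : PoincareData n) (y : EuclideanSpace ℝ (Fin n)) : ℝ :=
  ∑ i, ∑ j, (d.K (y, 0))⁻¹ i j * metricCoeff m i j d y

theorem sum_inv_mul_bdry (d : PoincareData n) {y : EuclideanSpace ℝ (Fin n)} (hy : y ∈ d.S) :
    ∑ i, ∑ j, (d.K (y, 0))⁻¹ i j * d.K (y, 0) i j = n := by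
  have hq := zero_mem_collar (y := y) d.ε_pos hy
  have h := congrArg Matrix.trace
    (Matrix.nonsing_inv_mul _ (isUnit_iff_ne_zero.2 (d.det_ne_zero hq)))
  rw [Matrix.trace_one, Fintype.card_fin] at h
  rw [← h, Matrix.trace]
  refine Finset.sum_congr rfl fun i _ => ?_
  rw [Matrix.diag_apply, Matrix.mul_apply]
  exact Finset.sum_congr rfl fun j _ => by rw [d.symm hq]

theorem leadingTerm_normalDeriv_metric
    (h : ∀ i j, UniversalTo (m + 1) (fun (d : PoincareData n) q => d.K q i j)) (i j : Fin n) :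
    LeadingTerm m (fun (d : PoincareData n) => normalDeriv (fun q => d.K q i j))
      (fun d y => ((m : ℝ) + 1) * metricCoeff (m + 1) i j d y) :=
  (LeadingTerm.self (h i j)).normalDeriv

theorem leadingTerm_traceDeriv
    (h : ∀ i j, UniversalTo (m + 1) (fun (d : PoincareData n) q => d.K q i j)) :
    LeadingTerm m (fun (d : PoincareData n) => traceDeriv d.K)
      (fun d y => ((m : ℝ) + 1) * traceCoeff (m + 1) d y) := by
  have h1 := LeadingTerm.sum (s := Finset.univ) fun k _ => LeadingTerm.sum (s := Finset.univ)
    fun l _ => LeadingTerm.mul_left (universalTo_inv h k l) (leadingTerm_normalDeriv_metric h k l)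
  refine LeadingTerm.congr_right (f := fun (d : PoincareData n) => traceDeriv d.K) h1
    fun d y hy => ?_
  rw [traceCoeff, Finset.mul_sum]
  refine Finset.sum_congr rfl fun k _ => ?_
  rw [Finset.mul_sum]
  exact Finset.sum_congr rfl fun l _ => by ring

/-- The coefficient of order `m+1` of `K` enters in three places: `-½xK''` contributes `-m(m+1)/2`
times it, `½(n-1)K'` contributes `(n-1)(m+1)/2` times it, and the trace term contributes its trace
times the boundary metric. The other terms carry a factor `x` and at most first normal derivatives.
-/
theorem leadingTerm_tangentialDefect
    (h : ∀ i j, UniversalTo (m + 1) (fun (d : PoincareData n) q => d.K q i j)) (i j : Fin n) :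
    LeadingTerm m (fun (d : PoincareData n) => tangentialDefect d.K i j)
      (fun d y => ((m : ℝ) + 1) / 2 * (((n : ℝ) - 1 - m) * metricCoeff (m + 1) i j d y +
        d.K (y, 0) i j * traceCoeff (m + 1) d y)) := by
  have hN := leadingTerm_normalDeriv_metric h
  have hT := leadingTerm_traceDeriv h
  have h1 : LeadingTerm m (fun (d : PoincareData n) q => q.2 * sliceRicci d.K i j q) _ :=
    LeadingTerm.of_universalTo ((universalTo_sliceRicci h i j).snd_mul.mono (by omega))
  have h2 := ((hN i j).snd_mul_normalDeriv).const_mul (-(1 / 2 : ℝ))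
  have h3 := (hN i j).const_mul (((n : ℝ) - 1) / 2)
  have h4 := (LeadingTerm.mul_left (h i j) hT).const_mul (1 / 2 : ℝ)
  have h5 := LeadingTerm.of_universalTo
    ((hT.lower.mul (hN i j).lower).snd_mul.const_mul (-(1 / 4 : ℝ)))
  have h6 := LeadingTerm.of_universalTo
    ((UniversalTo.sum (s := Finset.univ) fun k _ => UniversalTo.sum (s := Finset.univ) fun l _ =>
      (hN i k).lower.mul (((universalTo_inv h k l).mono (Nat.le_succ m)).mul
        (hN j l).lower)).snd_mul.const_mul (1 / 2 : ℝ))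
  have h7 := ((((h1.add h2).add h3).add h4).add h5).add h6
  refine LeadingTerm.congr_right (f := fun (d : PoincareData n) => tangentialDefect d.K i j) h7
    fun d y hy => ?_
  ring

/-- The equation of order `m` determines `(n-1-m)k + k₀ tr k` for `k = k_{m+1}`. Its trace is
`(2n-1-m) tr k`, which gives `tr k`; then `k` itself follows because `n-1-m > 0`. That factor
vanishes at `m = n-1`, which is why the recursion stops before order `n`. -/
theorem universalTo_metric (hm : m ≤ n) (i j : Fin n) :
    UniversalTo m (fun (d : PoincareData n) q => d.K q i j) := by
  induction m generalizing i j with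
  | zero => exact UniversalTo.zero_order fun d => d.smooth i j
  | succ m ih =>
    cases m with
    | zero =>
      refine ⟨fun d => d.smooth i j, fun k hk => ?_⟩
      obtain rfl : k = 0 := by omega
      simpa only [coeff_zero_bdrySeries] using IsUniversal.bdry i j
    | succ m =>
      have h := ih (by omega)
      have hL : ∀ i j, IsUniversal (fun (d : PoincareData n) y =>
          (((n : ℝ) - 1 - m) * metricCoeff (m + 1) i j d y +
            d.K (y, 0) i j * traceCoeff (m + 1) d y)) := by
        intro i j
        have h1 := (leadingTerm_tangentialDefect h i j).leading
        have hm2 : (-(((m : ℝ) + 1) / 2)) ≠ 0 := by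
          have : (0 : ℝ) < (m : ℝ) + 1 := by positivity
          linarith
        refine IsUniversal.of_const_mul hm2 (h1.congr fun d y hy => ?_)
        rw [d.tangential i j y hy m (by omega)]
        ring
      have hnm : (0 : ℝ) < (n : ℝ) - 1 - m := by
        have : ((m + 1 + 1 : ℕ) : ℝ) ≤ n := by exact_mod_cast hm
        push_cast at this
        linarith
      have hT : IsUniversal (fun (d : PoincareData n) y => traceCoeff (m + 1) d y) := by
        have h2 := IsUniversal.sum (s := Finset.univ) fun i _ =>
          IsUniversal.sum (s := Finset.univ) fun j _ => (IsUniversal.inv_bdry i j).mul (hL i j)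
        -- The extra `n` is the trace of the boundary metric with respect to itself.
        refine IsUniversal.of_const_mul (a := (n : ℝ) - 1 - m + n) (by positivity)
          (h2.congr fun d y hy => ?_)
        have e := sum_inv_mul_bdry d hy
        simp only [mul_add, Finset.sum_add_distrib]
        simp only [mul_left_comm _ ((n : ℝ) - 1 - m), ← mul_assoc, ← Finset.sum_mul]
        rw [e]
        simp only [mul_assoc, ← Finset.mul_sum]
        rw [traceCoeff]
        ring
      refine (LeadingTerm.self (h i j)).universalTo (IsUniversal.of_const_mul hnm.ne' ?_)
      exact ((hL i j).sub ((IsUniversal.bdry i j).mul hT)).congr fun d y hy => by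
        simp only [metricCoeff]; ring

/-- At order `n` the tensor `k_n` is out of reach, but the scalar equation still sees its trace. The
tangential part of `traceDefect` contributes `(n²/2) tr k_n` and the normal part `(n(2-n)/2) tr
k_n`, in total `n tr k_n`, which is a nonzero multiple. -/
theorem universalTo_traceDeriv (hn : 0 < n) :
    UniversalTo n (fun (d : PoincareData n) => traceDeriv d.K) := by
  obtain ⟨m, rfl⟩ : ∃ m, n = m + 1 := ⟨n - 1, by omega⟩
  have h := universalTo_metric (le_refl (m + 1))
  have hT := leadingTerm_traceDeriv h
  refine hT.universalTo ?_
  have h1 := LeadingTerm.sum (s := Finset.univ) fun i _ => LeadingTerm.sum (s := Finset.univ)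
    fun j _ => LeadingTerm.mul_left (universalTo_inv h i j) (leadingTerm_tangentialDefect h i j)
  have h2 := hT.snd_mul_normalDeriv.const_mul (-(1 / 2 : ℝ))
  have h3 := hT.const_mul (1 / 2 : ℝ)
  have hiN : ∀ i j k, UniversalTo m (fun (d : PoincareData (m + 1)) q =>
      (d.K q)⁻¹ i j * normalDeriv (fun z => d.K z j k) q) := fun i j k =>
    ((universalTo_inv h i j).mono (Nat.le_succ m)).mul (leadingTerm_normalDeriv_metric h j k).lower
  have h4 := LeadingTerm.of_universalTo ((UniversalTo.sum (s := Finset.univ) fun i _ =>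
    UniversalTo.sum (s := Finset.univ) fun j _ => UniversalTo.sum (s := Finset.univ) fun k _ =>
    UniversalTo.sum (s := Finset.univ) fun l _ =>
      (hiN i j k).mul (hiN k l i)).snd_mul.const_mul (-(1 / 4 : ℝ)))
  have h5 := (h1.add ((h2.add h3).add h4)).leading
  have h6 : IsUniversal (fun (d : PoincareData (m + 1)) y =>
      (-((m : ℝ) + 1)) * traceCoeff (m + 1) d y) := by
    refine h5.congr fun d y hy => ?_
    have e := sum_inv_mul_bdry d hy
    have e0 := d.trace y hy m (Nat.lt_succ_self m)
    change _ = PowerSeries.coeff m (bdrySeries (traceDefect d.K) y) - _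
    rw [e0]
    have e2 : ∀ i j, (d.K (y, 0))⁻¹ i j * (((m : ℝ) + 1) / 2 *
        ((((m + 1 : ℕ) : ℝ) - 1 - m) * metricCoeff (m + 1) i j d y
          + d.K (y, 0) i j * traceCoeff (m + 1) d y)) =
        (d.K (y, 0))⁻¹ i j * d.K (y, 0) i j * (((m : ℝ) + 1) / 2 * traceCoeff (m + 1) d y) := by
      intro i j
      push_cast
      ring
    simp only [e2, ← Finset.sum_mul, e]
    push_cast
    ring
  have h7 : (-((m : ℝ) + 1)) ≠ 0 := by
    have : (0 : ℝ) < (m : ℝ) + 1 := by positivity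
    linarith
  exact (IsUniversal.const ((m : ℝ) + 1)).mul (h6.of_const_mul h7)

end EinsteinRecursion

/-! ### Order by order solution of the equation. -/

section FormalSolution

variable {n : ℕ}

/-- The trace of the Hessian, for the slice metrics, of the function on the boundary given by the
polynomial `P` in the jet. -/
noncomputable def sliceLaplacianJet (P : MvPolynomial (JetVar n) ℝ) (d : PoincareData n) :
    EuclideanSpace ℝ (Fin n) × ℝ → ℝ :=
  fun q => ∑ i, ∑ j, (d.K q)⁻¹ i j *
    (MvPolynomial.eval (d.jet q.1) (totalDeriv i (totalDeriv j P))
      - ∑ k, sliceChristoffel d.K k i j q * MvPolynomial.eval (d.jet q.1) (totalDeriv k P))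

/-- The part of `-Δ_g (a x^j)` divisible by `x^(j+1)`, divided by `x^(j+1)`, where the function
`a` is given by the polynomial `P` in the jet. -/
noncomputable def higherTerm (P : MvPolynomial (JetVar n) ℝ) (j : ℕ) (d : PoincareData n) :
    EuclideanSpace ℝ (Fin n) × ℝ → ℝ :=
  fun q => (1 / 2 : ℝ) * (j * (traceDeriv d.K q * MvPolynomial.eval (d.jet q.1) P))
    + q.2 * sliceLaplacianJet P d q

/-- `-Δ_g (a x^j)`, where the function `a` is given by the polynomial `P` in the jet. -/
noncomputable def powerTerm (P : MvPolynomial (JetVar n) ℝ) (j : ℕ) (d : PoincareData n) :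
    EuclideanSpace ℝ (Fin n) × ℝ → ℝ :=
  fun q => q.2 ^ j * (j * ((j : ℝ) - n) * MvPolynomial.eval (d.jet q.1) P
    + q.2 * higherTerm P j d q)

/-- `n - Δ_g (log x + ∑ j < m, a_j x^j)`, where `a_j` is given by the polynomial `P j` in the
jet. -/
noncomputable def equationResidual (P : ℕ → MvPolynomial (JetVar n) ℝ) (m : ℕ) (d : PoincareData n) :
    EuclideanSpace ℝ (Fin n) × ℝ → ℝ :=
  fun q => q.2 * ((1 / 2 : ℝ) * traceDeriv d.K q) + ∑ j ∈ Finset.range m, powerTerm (P j) j d q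

theorem universalTo_eval_jet (P : MvPolynomial (JetVar n) ℝ) (m : ℕ) :
    UniversalTo m (fun (d : PoincareData n) q => MvPolynomial.eval (d.jet q.1) P) :=
  UniversalTo.of_fst (c := fun d y => MvPolynomial.eval (d.jet y) P) ⟨P, fun _ _ _ => rfl⟩ m

theorem universalTo_sliceLaplacianJet (P : MvPolynomial (JetVar n) ℝ) :
    UniversalTo n (sliceLaplacianJet P) := by
  have h := universalTo_metric (le_refl n)
  exact UniversalTo.sum fun i _ => UniversalTo.sum fun j _ => (universalTo_inv h i j).mul
    ((universalTo_eval_jet _ n).sub (UniversalTo.sum fun k _ =>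
      (universalTo_sliceChristoffel h k i j).mul (universalTo_eval_jet _ n)))

theorem universalTo_higherTerm (hn : 0 < n) (P : MvPolynomial (JetVar n) ℝ) (j : ℕ) :
    UniversalTo n (higherTerm P j) :=
  ((((universalTo_traceDeriv hn).mul (universalTo_eval_jet P n)).const_mul (j : ℝ)).const_mul
    (1 / 2 : ℝ)).add ((universalTo_sliceLaplacianJet P).snd_mul.mono (Nat.le_succ n))

theorem UniversalTo.snd_pow (j m : ℕ) :
    UniversalTo m (fun (d : PoincareData n) (q : EuclideanSpace ℝ (Fin n) × ℝ) => q.2 ^ j) := by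
  induction j generalizing m with
  | zero => simpa using UniversalTo.const 1 m
  | succ j ih => exact ((ih m).snd_mul.mono (Nat.le_succ m)).congr fun d q _ => by ring

theorem universalTo_powerTerm (hn : 0 < n) (P : MvPolynomial (JetVar n) ℝ) (j : ℕ) :
    UniversalTo (n + 1) (powerTerm P j) :=
  (UniversalTo.snd_pow j (n + 1)).mul (((universalTo_eval_jet P (n + 1)).const_mul
    (j * ((j : ℝ) - n))).add (universalTo_higherTerm hn P j).snd_mul)

/-- The residual is needed up to order `n` inclusive. Every occurrence of `traceDeriv`, which is
controlled only below order `n`, carries a factor `x`, and the slice Laplacian carries `x²`. -/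
theorem universalTo_equationResidual (hn : 0 < n) (P : ℕ → MvPolynomial (JetVar n) ℝ) (m : ℕ) :
    UniversalTo (n + 1) (equationResidual P m) :=
  ((universalTo_traceDeriv hn).const_mul (1 / 2 : ℝ)).snd_mul.add
    (UniversalTo.sum fun j _ => universalTo_powerTerm hn (P j) j)

theorem bdrySeries_snd_pow_mul (d : PoincareData n) {f : EuclideanSpace ℝ (Fin n) × ℝ → ℝ}
    (hf : SmoothUpTo d.S d.ε f) {y : EuclideanSpace ℝ (Fin n)} (hy : y ∈ d.S) (m : ℕ) :
    bdrySeries (fun q => q.2 ^ m * f q) y = PowerSeries.X ^ m * bdrySeries f y := by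
  rw [← bdrySeries_snd_pow d.isOpen d.ε_pos hy m,
    ← bdrySeries_mul d.isOpen d.ε_pos (SmoothUpTo.snd_pow m) hf hy]
  rfl

theorem coeff_powerTerm (hn : 0 < n) (P : MvPolynomial (JetVar n) ℝ) {j i : ℕ} (hi : i ≤ j)
    (d : PoincareData n) {y : EuclideanSpace ℝ (Fin n)} (hy : y ∈ d.S) :
    PowerSeries.coeff i (bdrySeries (powerTerm P j d) y) =
      if i = j then j * ((j : ℝ) - n) * MvPolynomial.eval (d.jet y) P else 0 := by
  have hs := (((universalTo_eval_jet P (n + 1)).const_mul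
    (j * ((j : ℝ) - n))).add (universalTo_higherTerm hn P j).snd_mul).smooth d
  have h := bdrySeries_snd_pow_mul d hs hy j
  change bdrySeries (powerTerm P j d) y = _ at h
  rw [h, PowerSeries.coeff_X_pow_mul']
  rcases hi.lt_or_eq with hi | rfl
  · rw [if_neg (by omega), if_neg (by omega)]
  · rw [if_pos le_rfl, if_pos rfl, Nat.sub_self, coeff_zero_bdrySeries]
    ring

/-- Adding `a xᵐ` leaves the residual unchanged below order `m` and changes it at order `m` by
`m(m-n)a`. The factor is nonzero for `1 ≤ m < n`, so `a` can be chosen to cancel the coefficient `c`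
found there. -/
theorem exists_equationResidual_coeff_eq_zero (hn : 0 < n) {m : ℕ} (hm : 1 ≤ m) (hmn : m ≤ n) :
    ∃ P : ℕ → MvPolynomial (JetVar n) ℝ, P 0 = 0 ∧ ∀ d : PoincareData n, ∀ y ∈ d.S, ∀ i < m,
      PowerSeries.coeff i (bdrySeries (equationResidual P m d) y) = 0 := by
  induction m, hm using Nat.le_induction with
  | base =>
    refine ⟨fun _ => 0, rfl, fun d y hy i hi => ?_⟩
    obtain rfl : i = 0 := by omega
    rw [coeff_zero_bdrySeries]
    simp [equationResidual, powerTerm, higherTerm]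
  | succ m hm ih =>
    obtain ⟨P, hP0, hP⟩ := ih (by omega)
    obtain ⟨c, hc⟩ := (universalTo_equationResidual hn P m).coeff m (by omega)
    beta_reduce at hc
    have hne : (m : ℝ) * ((m : ℝ) - n) ≠ 0 := by
      have h1 : (0 : ℝ) < m := by exact_mod_cast hm
      have h2 : (m : ℝ) < n := by exact_mod_cast hmn
      exact mul_ne_zero h1.ne' (by linarith)
    set a : MvPolynomial (JetVar n) ℝ := MvPolynomial.C (-((m : ℝ) * ((m : ℝ) - n))⁻¹) * c with ha
    refine ⟨Function.update P m a, ?_, fun d y hy i hi => ?_⟩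
    · rw [Function.update_of_ne (by omega), hP0]
    · have e : equationResidual (Function.update P m a) (m + 1) d =
          equationResidual P m d + powerTerm a m d := by
        funext q
        simp only [equationResidual, Pi.add_apply, Finset.sum_range_succ, Function.update_self]
        rw [Finset.sum_congr rfl fun j hj => by
          rw [Function.update_of_ne (Finset.mem_range.1 hj).ne]]
        ring
      rw [e, bdrySeries_add d.isOpen d.ε_pos ((universalTo_equationResidual hn P m).smooth d)
        ((universalTo_powerTerm hn a m).smooth d) hy, map_add,
        coeff_powerTerm hn a (by omega) d hy]
      rcases Nat.lt_succ_iff_lt_or_eq.1 hi with hi | rfl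
      · rw [hP d y hy i hi, if_neg hi.ne, add_zero]
      · rw [if_pos rfl, hc d y hy, ha, map_mul, MvPolynomial.eval_C, neg_mul, mul_neg,
          mul_inv_cancel_left₀ hne, add_neg_cancel]

/-- The formal solution, modulo `O(x^(n+1) log x)`, of `Δ_g U = n`. -/
theorem exists_formal_solution (hn : 0 < n) :
    ∃ (P : ℕ → MvPolynomial (JetVar n) ℝ) (Q : MvPolynomial (JetVar n) ℝ), P 0 = 0 ∧
      ∀ d : PoincareData n,
        SmoothUpTo d.S d.ε (fun q => equationResidual P n d q
          + q.2 ^ n * (n * MvPolynomial.eval (d.jet q.1) Q)) ∧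
        ∀ y ∈ d.S, ∀ i < n + 1, PowerSeries.coeff i (bdrySeries (fun q => equationResidual P n d q
          + q.2 ^ n * (n * MvPolynomial.eval (d.jet q.1) Q)) y) = 0 := by
  obtain ⟨P, hP0, hP⟩ := exists_equationResidual_coeff_eq_zero hn (m := n) hn le_rfl
  obtain ⟨c, hc⟩ := (universalTo_equationResidual hn P n).coeff n (by omega)
  beta_reduce at hc
  have hn' : (n : ℝ) ≠ 0 := by exact_mod_cast hn.ne'
  -- At order `n` no power of `x` helps, since `j(j-n) = 0`. The logarithmic term contributes `n Q
  -- xⁿ`, so cancelling the residual `c` requires `Q = -c/n`.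
  refine ⟨P, MvPolynomial.C (-(n : ℝ)⁻¹) * c, hP0, fun d => ?_⟩
  have h0 := (universalTo_equationResidual hn P n).smooth d
  have h1 := ((universalTo_eval_jet (MvPolynomial.C (-(n : ℝ)⁻¹) * c) (n + 1)).const_mul
    (n : ℝ)).smooth d
  have h2 : SmoothUpTo d.S d.ε (fun q => q.2 ^ n *
      (n * MvPolynomial.eval (d.jet q.1) (MvPolynomial.C (-(n : ℝ)⁻¹) * c))) :=
    (SmoothUpTo.snd_pow n).mul h1
  refine ⟨h0.add h2, fun y hy i hi => ?_⟩
  have e := bdrySeries_add d.isOpen d.ε_pos h0 h2 hy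
  rw [bdrySeries_snd_pow_mul d h1 hy] at e
  refine (congrArg (PowerSeries.coeff i) e).trans ?_
  rw [map_add, PowerSeries.coeff_X_pow_mul']
  rcases Nat.lt_succ_iff_lt_or_eq.1 hi with hi | rfl
  · rw [hP d y hy i hi, if_neg (by omega), add_zero]
  · rw [if_pos le_rfl, Nat.sub_self, coeff_zero_bdrySeries, hc d y hy, map_mul,
      MvPolynomial.eval_C]
    field_simp
    ring

end FormalSolution

/-! ### Locality of the coordinate formulas. -/

section CoordCongr

variable {V : Type*} [NormedAddCommGroup V] [NormedSpace ℝ V] {ι : Type*} (b : Module.Basis ι ℝ V)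

theorem Filter.EventuallyEq.partialDeriv_eq {f g : V → ℝ} {y : V} (h : f =ᶠ[𝓝 y] g) (i : ι) :
    partialDeriv b i f y = partialDeriv b i g y := by
  rw [partialDeriv, partialDeriv, h.fderiv_eq]

theorem Filter.EventuallyEq.partialDeriv {f g : V → ℝ} {y : V} (h : f =ᶠ[𝓝 y] g) (i : ι) :
    partialDeriv b i f =ᶠ[𝓝 y] partialDeriv b i g :=
  h.eventuallyEq_nhds.mono fun _ hz => hz.partialDeriv_eq b i

variable [Fintype ι] [DecidableEq ι] {G G' : V → Matrix ι ι ℝ} {y : V}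

theorem Filter.EventuallyEq.christoffel_eq (h : G =ᶠ[𝓝 y] G') (k i j : ι) :
    christoffel b G k i j y = christoffel b G' k i j y := by
  have he : ∀ i j, (fun z => G z i j) =ᶠ[𝓝 y] fun z => G' z i j := fun i j =>
    h.mono fun z hz => by simp only [hz]
  simp only [christoffel, h.eq_of_nhds, (he _ _).partialDeriv_eq b]

theorem Filter.EventuallyEq.christoffel (h : G =ᶠ[𝓝 y] G') (k i j : ι) :
    christoffel b G k i j =ᶠ[𝓝 y] christoffel b G' k i j :=
  h.eventuallyEq_nhds.mono fun _ hz => hz.christoffel_eq b k i j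

theorem Filter.EventuallyEq.ricciCoord_eq (h : G =ᶠ[𝓝 y] G') (i j : ι) :
    ricciCoord b G i j y = ricciCoord b G' i j y := by
  simp only [ricciCoord, h.christoffel_eq b, (h.christoffel b _ _ _).partialDeriv_eq b]

theorem Filter.EventuallyEq.laplacianCoord_eq (h : G =ᶠ[𝓝 y] G') {f f' : V → ℝ}
    (hf : f =ᶠ[𝓝 y] f') : laplacianCoord b G f y = laplacianCoord b G' f' y := by
  simp only [laplacianCoord, h.christoffel_eq b, hf.partialDeriv_eq b,
    (hf.partialDeriv b _).partialDeriv_eq b, h.eq_of_nhds]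

end CoordCongr

/-- `K` is a smooth family of metrics on `S × [0, ε)`, up to the boundary. -/
structure IsMetricFamily {n : ℕ} (S : Set (EuclideanSpace ℝ (Fin n))) (ε : ℝ)
    (K : EuclideanSpace ℝ (Fin n) × ℝ → Matrix (Fin n) (Fin n) ℝ) : Prop where
  isOpen : IsOpen S
  smooth : ∀ i j, SmoothUpTo S ε (fun q => K q i j)
  posDef : ∀ q ∈ S ×ˢ Ico 0 ε, (K q).PosDef

/-- The matrix of `x⁻² (K + dx²)`. -/
noncomputable def collarMatrix {n : ℕ}
    (K : EuclideanSpace ℝ (Fin n) × ℝ → Matrix (Fin n) (Fin n) ℝ) :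
    EuclideanSpace ℝ (Fin n) × ℝ → Matrix (Fin n ⊕ Unit) (Fin n ⊕ Unit) ℝ :=
  fun q => (q.2 ^ 2)⁻¹ • Matrix.fromBlocks (K q) 0 0 1

/-! ### Christoffel symbols, Ricci tensor and Laplacian of the collar metric. -/

section CollarBasis

variable {n : ℕ} {q : EuclideanSpace ℝ (Fin n) × ℝ} {f : EuclideanSpace ℝ (Fin n) × ℝ → ℝ}

theorem partialDeriv_collar_inl (hq : 0 < q.2) (i : Fin n) :
    partialDeriv (collarBasis n) (Sum.inl i) f q = tangDeriv i f q := by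
  rw [tangDeriv, halfDeriv_eq_fderiv _ _ hq, partialDeriv, Module.Basis.prod_apply]
  rfl

theorem partialDeriv_collar_inr (hq : 0 < q.2) (u : Unit) :
    partialDeriv (collarBasis n) (Sum.inr u) f q = normalDeriv f q := by
  rw [normalDeriv, halfDeriv_eq_fderiv _ _ hq, partialDeriv, Module.Basis.prod_apply]
  simp

end CollarBasis

namespace IsMetricFamily

variable {n : ℕ} {S : Set (EuclideanSpace ℝ (Fin n))} {ε : ℝ}
  {K : EuclideanSpace ℝ (Fin n) × ℝ → Matrix (Fin n) (Fin n) ℝ}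
  {q : EuclideanSpace ℝ (Fin n) × ℝ}

theorem det_ne_zero (h : IsMetricFamily S ε K) (hq : q ∈ S ×ˢ Ico 0 ε) : (K q).det ≠ 0 :=
  (h.posDef q hq).det_pos.ne'

theorem symm (h : IsMetricFamily S ε K) (hq : q ∈ S ×ˢ Ico 0 ε) (i j : Fin n) :
    K q i j = K q j i := by
  simpa using congrFun (congrFun (h.posDef q hq).isHermitian j) i

theorem inv_symm (h : IsMetricFamily S ε K) (hq : q ∈ S ×ˢ Ico 0 ε) (i j : Fin n) :
    (K q)⁻¹ i j = (K q)⁻¹ j i := by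
  simpa using congrFun (congrFun (h.posDef q hq).isHermitian.inv j) i

theorem smooth_inv (h : IsMetricFamily S ε K) (i j : Fin n) :
    SmoothUpTo S ε (fun q => (K q)⁻¹ i j) :=
  ContDiffOn.matrix_inv h.smooth (fun _ hq => h.det_ne_zero hq) i j

theorem normalDeriv_symm (h : IsMetricFamily S ε K) (hq : q ∈ S ×ˢ Ico 0 ε) (i j : Fin n) :
    normalDeriv (fun z => K z i j) q = normalDeriv (fun z => K z j i) q :=
  halfDeriv_congr h.isOpen hq _ fun q hq => h.symm hq i j

theorem sum_mul_inv (h : IsMetricFamily S ε K) (hq : q ∈ S ×ˢ Ico 0 ε) (i j : Fin n) :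
    ∑ k, K q i k * (K q)⁻¹ k j = if i = j then 1 else 0 := by
  rw [← Matrix.mul_apply, Matrix.mul_nonsing_inv _ (isUnit_iff_ne_zero.2 (h.det_ne_zero hq)),
    Matrix.one_apply]

theorem inv_collarMatrix (h : IsMetricFamily S ε K) (hq : q ∈ S ×ˢ Ioo 0 ε) :
    (collarMatrix K q)⁻¹ = q.2 ^ 2 • Matrix.fromBlocks (K q)⁻¹ 0 0 1 := by
  have h0 : q.2 ≠ 0 := hq.2.1.ne'
  apply Matrix.inv_eq_right_inv
  rw [collarMatrix, Matrix.smul_mul, Matrix.mul_smul, smul_smul, Matrix.fromBlocks_multiply,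
    inv_mul_cancel₀ (pow_ne_zero 2 h0), one_smul,
    Matrix.mul_nonsing_inv _ (isUnit_iff_ne_zero.2 (h.det_ne_zero
      ⟨hq.1, Ioo_subset_Ico_self hq.2⟩))]
  simp

theorem halfDeriv_inv_sq_mul {f : EuclideanSpace ℝ (Fin n) × ℝ → ℝ} (hS : IsOpen S)
    (hf : SmoothUpTo S ε f) (hq : q ∈ S ×ˢ Ioo 0 ε) (w : EuclideanSpace ℝ (Fin n) × ℝ) :
    halfDeriv w (fun z => (z.2 ^ 2)⁻¹ * f z) q =
      (q.2 ^ 2)⁻¹ * halfDeriv w f q - 2 * w.2 * (q.2 ^ 3)⁻¹ * f q := by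
  have h0 : q.2 ≠ 0 := hq.2.1.ne'
  rw [halfDeriv_eq_fderiv _ _ hq.2.1, halfDeriv_eq_fderiv _ _ hq.2.1]
  have hd : HasFDerivAt f (fderiv ℝ f q) q :=
    ((hf.contDiffAt hS hq).differentiableAt (by simp)).hasFDerivAt
  have h1 : HasDerivAt (fun x : ℝ => (x ^ 2)⁻¹) (-(2 * q.2) / (q.2 ^ 2) ^ 2) q.2 := by
    simpa using (hasDerivAt_pow 2 q.2).fun_inv (pow_ne_zero 2 h0)
  have h2 : HasFDerivAt (fun z : EuclideanSpace ℝ (Fin n) × ℝ => (z.2 ^ 2)⁻¹) _ q :=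
    h1.comp_hasFDerivAt q (hasFDerivAt_snd (𝕜 := ℝ))
  rw [(h2.fun_mul hd).fderiv]
  simp
  field_simp
  ring

theorem partialDeriv_collarMatrix_inl (h : IsMetricFamily S ε K) (hq : q ∈ S ×ˢ Ioo 0 ε)
    (m i j : Fin n) :
    partialDeriv (collarBasis n) (Sum.inl m) (fun z => collarMatrix K z (Sum.inl i) (Sum.inl j)) q
      = (q.2 ^ 2)⁻¹ * tangDeriv m (fun z => K z i j) q := by
  rw [partialDeriv_collar_inl hq.2.1]
  refine (halfDeriv_inv_sq_mul h.isOpen (h.smooth i j) hq _).trans ?_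
  simp [tangDeriv]

theorem partialDeriv_collarMatrix_inr (h : IsMetricFamily S ε K) (hq : q ∈ S ×ˢ Ioo 0 ε)
    (u : Unit) (i j : Fin n) :
    partialDeriv (collarBasis n) (Sum.inr u) (fun z => collarMatrix K z (Sum.inl i) (Sum.inl j)) q
      = (q.2 ^ 2)⁻¹ * normalDeriv (fun z => K z i j) q - 2 * (q.2 ^ 3)⁻¹ * K q i j := by
  rw [partialDeriv_collar_inr hq.2.1]
  refine (halfDeriv_inv_sq_mul h.isOpen (h.smooth i j) hq _).trans ?_
  simp [normalDeriv]

theorem partialDeriv_collarMatrix_inl_inr (m : Fin n ⊕ Unit) (i : Fin n) (u : Unit) :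
    partialDeriv (collarBasis n) m (fun z => collarMatrix K z (Sum.inl i) (Sum.inr u)) q = 0 := by
  simp [collarMatrix, partialDeriv]

theorem partialDeriv_collarMatrix_inr_inl (m : Fin n ⊕ Unit) (i : Fin n) (u : Unit) :
    partialDeriv (collarBasis n) m (fun z => collarMatrix K z (Sum.inr u) (Sum.inl i)) q = 0 := by
  simp [collarMatrix, partialDeriv]

theorem partialDeriv_collarMatrix_inl_inr_inr (h : IsMetricFamily S ε K) (hq : q ∈ S ×ˢ Ioo 0 ε)
    (m : Fin n) (u v : Unit) :
    partialDeriv (collarBasis n) (Sum.inl m) (fun z => collarMatrix K z (Sum.inr u) (Sum.inr v)) q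
      = 0 := by
  rw [partialDeriv_collar_inl hq.2.1]
  refine (halfDeriv_inv_sq_mul h.isOpen (SmoothUpTo.const 1) hq _).trans ?_
  simp [halfDeriv_const]

theorem partialDeriv_collarMatrix_inr_inr_inr (h : IsMetricFamily S ε K) (hq : q ∈ S ×ˢ Ioo 0 ε)
    (u v w : Unit) :
    partialDeriv (collarBasis n) (Sum.inr w) (fun z => collarMatrix K z (Sum.inr u) (Sum.inr v)) q
      = - 2 * (q.2 ^ 3)⁻¹ := by
  rw [partialDeriv_collar_inr hq.2.1]
  refine (halfDeriv_inv_sq_mul h.isOpen (SmoothUpTo.const 1) hq _).trans ?_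
  simp [halfDeriv_const]

/-- The endomorphism `K⁻¹ K'`. -/
noncomputable def _root_.shapeCoeff (K : EuclideanSpace ℝ (Fin n) × ℝ → Matrix (Fin n) (Fin n) ℝ)
    (k i : Fin n) (q : EuclideanSpace ℝ (Fin n) × ℝ) : ℝ :=
  ∑ l, (K q)⁻¹ k l * normalDeriv (fun z => K z i l) q

theorem sum_shapeCoeff (h : IsMetricFamily S ε K) (hq : q ∈ S ×ˢ Ico 0 ε) :
    ∑ k, shapeCoeff K k k q = traceDeriv K q := rfl

section Christoffel

theorem christoffel_inl_inl_inl (h : IsMetricFamily S ε K) (hq : q ∈ S ×ˢ Ioo 0 ε)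
    (k i j : Fin n) :
    christoffel (collarBasis n) (collarMatrix K) (Sum.inl k) (Sum.inl i) (Sum.inl j) q =
      sliceChristoffel K k i j q := by
  have h0 : q.2 ≠ 0 := hq.2.1.ne'
  rw [christoffel, sliceChristoffel, h.inv_collarMatrix hq, Fintype.sum_sum_type]
  simp only [h.partialDeriv_collarMatrix_inl hq]
  simp
  refine Finset.sum_congr rfl fun l _ => ?_
  field_simp

theorem christoffel_inr_inl_inl (h : IsMetricFamily S ε K) (hq : q ∈ S ×ˢ Ioo 0 ε)
    (u : Unit) (i j : Fin n) :
    christoffel (collarBasis n) (collarMatrix K) (Sum.inr u) (Sum.inl i) (Sum.inl j) q =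
      q.2⁻¹ * K q i j - 1 / 2 * normalDeriv (fun z => K z i j) q := by
  have h0 : q.2 ≠ 0 := hq.2.1.ne'
  rw [christoffel, h.inv_collarMatrix hq, Fintype.sum_sum_type]
  simp only [h.partialDeriv_collarMatrix_inr hq, partialDeriv_collarMatrix_inl_inr]
  simp
  field_simp

theorem christoffel_inl_inl_inr (h : IsMetricFamily S ε K) (hq : q ∈ S ×ˢ Ioo 0 ε)
    (k i : Fin n) (u : Unit) :
    christoffel (collarBasis n) (collarMatrix K) (Sum.inl k) (Sum.inl i) (Sum.inr u) q =
      1 / 2 * shapeCoeff K k i q - q.2⁻¹ * if i = k then 1 else 0 := by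
  have h0 : q.2 ≠ 0 := hq.2.1.ne'
  have hq' : q ∈ S ×ˢ Ico 0 ε := ⟨hq.1, Ioo_subset_Ico_self hq.2⟩
  -- The Kronecker delta is expanded as `K K⁻¹`, so that both sides are sums over the same index and
  -- can be compared term by term.
  rw [christoffel, h.inv_collarMatrix hq, Fintype.sum_sum_type, ← h.sum_mul_inv hq', shapeCoeff]
  simp only [h.partialDeriv_collarMatrix_inr hq, partialDeriv_collarMatrix_inl_inr,
    partialDeriv_collarMatrix_inr_inl]
  simp [Finset.mul_sum, ← Finset.sum_sub_distrib]
  refine Finset.sum_congr rfl fun l _ => ?_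
  rw [h.inv_symm hq' l k]
  field_simp

theorem christoffel_inl_inr_inl (h : IsMetricFamily S ε K) (hq : q ∈ S ×ˢ Ioo 0 ε)
    (k i : Fin n) (u : Unit) :
    christoffel (collarBasis n) (collarMatrix K) (Sum.inl k) (Sum.inr u) (Sum.inl i) q =
      1 / 2 * shapeCoeff K k i q - q.2⁻¹ * if i = k then 1 else 0 := by
  rw [← h.christoffel_inl_inl_inr hq k i u, christoffel, christoffel]
  simp only [partialDeriv_collarMatrix_inl_inr, partialDeriv_collarMatrix_inr_inl]
  congr 1
  refine Finset.sum_congr rfl fun l _ => ?_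
  rw [add_comm (partialDeriv _ _ _ _)]

theorem christoffel_inr_inl_inr (h : IsMetricFamily S ε K) (hq : q ∈ S ×ˢ Ioo 0 ε)
    (i : Fin n) (u v : Unit) :
    christoffel (collarBasis n) (collarMatrix K) (Sum.inr u) (Sum.inl i) (Sum.inr v) q = 0 := by
  rw [christoffel, h.inv_collarMatrix hq, Fintype.sum_sum_type]
  simp only [partialDeriv_collarMatrix_inl_inr, h.partialDeriv_collarMatrix_inl_inr_inr hq]
  simp

theorem christoffel_inr_inr_inl (h : IsMetricFamily S ε K) (hq : q ∈ S ×ˢ Ioo 0 ε)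
    (i : Fin n) (u v : Unit) :
    christoffel (collarBasis n) (collarMatrix K) (Sum.inr u) (Sum.inr v) (Sum.inl i) q = 0 := by
  rw [christoffel, h.inv_collarMatrix hq, Fintype.sum_sum_type]
  simp only [partialDeriv_collarMatrix_inl_inr, partialDeriv_collarMatrix_inr_inl,
    h.partialDeriv_collarMatrix_inl_inr_inr hq]
  simp

theorem christoffel_inl_inr_inr (h : IsMetricFamily S ε K) (hq : q ∈ S ×ˢ Ioo 0 ε)
    (k : Fin n) (u v : Unit) :
    christoffel (collarBasis n) (collarMatrix K) (Sum.inl k) (Sum.inr u) (Sum.inr v) q = 0 := by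
  rw [christoffel, h.inv_collarMatrix hq, Fintype.sum_sum_type]
  simp only [partialDeriv_collarMatrix_inr_inl, h.partialDeriv_collarMatrix_inl_inr_inr hq]
  simp

theorem christoffel_inr_inr_inr (h : IsMetricFamily S ε K) (hq : q ∈ S ×ˢ Ioo 0 ε)
    (u v w : Unit) :
    christoffel (collarBasis n) (collarMatrix K) (Sum.inr w) (Sum.inr u) (Sum.inr v) q =
      - q.2⁻¹ := by
  have h0 : q.2 ≠ 0 := hq.2.1.ne'
  rw [christoffel, h.inv_collarMatrix hq, Fintype.sum_sum_type]
  simp only [partialDeriv_collarMatrix_inr_inl, h.partialDeriv_collarMatrix_inr_inr_inr hq]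
  simp
  field_simp

end Christoffel

end IsMetricFamily

namespace IsMetricFamily

variable {n : ℕ} {S : Set (EuclideanSpace ℝ (Fin n))} {ε : ℝ}
  {K : EuclideanSpace ℝ (Fin n) × ℝ → Matrix (Fin n) (Fin n) ℝ}
  {q : EuclideanSpace ℝ (Fin n) × ℝ}

theorem eventually_mem (h : IsMetricFamily S ε K) (hq : q ∈ S ×ˢ Ioo 0 ε) :
    ∀ᶠ z in 𝓝 q, z ∈ S ×ˢ Ioo 0 ε := (h.isOpen.prod isOpen_Ioo).mem_nhds hq

theorem _root_.halfDeriv_inv_mul {f : EuclideanSpace ℝ (Fin n) × ℝ → ℝ} (hS : IsOpen S)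
    (hf : SmoothUpTo S ε f) (hq : q ∈ S ×ˢ Ioo 0 ε) (w : EuclideanSpace ℝ (Fin n) × ℝ) :
    halfDeriv w (fun z => z.2⁻¹ * f z) q =
      q.2⁻¹ * halfDeriv w f q - w.2 * (q.2 ^ 2)⁻¹ * f q := by
  have h0 : q.2 ≠ 0 := hq.2.1.ne'
  rw [halfDeriv_eq_fderiv _ _ hq.2.1, halfDeriv_eq_fderiv _ _ hq.2.1]
  have hd : HasFDerivAt f (fderiv ℝ f q) q :=
    ((hf.contDiffAt hS hq).differentiableAt (by simp)).hasFDerivAt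
  have h2 : HasFDerivAt (fun z : EuclideanSpace ℝ (Fin n) × ℝ => z.2⁻¹) _ q :=
    (hasDerivAt_inv h0).comp_hasFDerivAt q (hasFDerivAt_snd (𝕜 := ℝ))
  rw [(h2.fun_mul hd).fderiv]
  simp
  field_simp
  ring

theorem partialDeriv_christoffel_inr_inl_inl (h : IsMetricFamily S ε K) (hq : q ∈ S ×ˢ Ioo 0 ε)
    (u v : Unit) (i j : Fin n) :
    partialDeriv (collarBasis n) (Sum.inr u)
        (christoffel (collarBasis n) (collarMatrix K) (Sum.inr v) (Sum.inl i) (Sum.inl j)) q =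
      q.2⁻¹ * normalDeriv (fun z => K z i j) q - (q.2 ^ 2)⁻¹ * K q i j
        - 1 / 2 * normalDeriv (normalDeriv fun z => K z i j) q := by
  have hq' : q ∈ S ×ˢ Ico 0 ε := ⟨hq.1, Ioo_subset_Ico_self hq.2⟩
  have hN := (h.smooth i j).normalDeriv h.isOpen
  have e : christoffel (collarBasis n) (collarMatrix K) (Sum.inr v) (Sum.inl i) (Sum.inl j)
      =ᶠ[𝓝 q] fun z => z.2⁻¹ * K z i j + -(1 / 2) * normalDeriv (fun z => K z i j) z :=
    (h.eventually_mem hq).mono fun z hz => by rw [h.christoffel_inr_inl_inl hz]; ring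
  rw [e.partialDeriv_eq, partialDeriv_collar_inr hq.2.1, normalDeriv]
  have h1 : DifferentiableAt ℝ (fun z : EuclideanSpace ℝ (Fin n) × ℝ => z.2⁻¹ * K z i j) q :=
    ((contDiffAt_snd.inv hq.2.1.ne').mul ((h.smooth i j).contDiffAt h.isOpen hq)).differentiableAt
      (by simp)
  have h2 : DifferentiableAt ℝ (fun z => -(1 / 2) * normalDeriv (fun z => K z i j) z) q :=
    ((contDiffAt_const.mul (hN.contDiffAt h.isOpen hq))).differentiableAt (by simp)
  have h3 := halfDeriv_mul h.isOpen (SmoothUpTo.const (-(1 / 2))) hN hq' (0, 1)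
  have h4 := halfDeriv_inv_mul h.isOpen (h.smooth i j) hq (0, 1)
  rw [halfDeriv_const] at h3
  rw [halfDeriv_eq_fderiv _ _ hq.2.1] at h3 h4 ⊢
  rw [fderiv_fun_add h1 h2, add_apply, h4]
  refine (congrArg _ h3).trans ?_
  simp only [normalDeriv]
  ring

theorem smooth_shapeCoeff (h : IsMetricFamily S ε K) (k i : Fin n) :
    SmoothUpTo S ε (shapeCoeff K k i) :=
  (SmoothUpTo.sum (s := Finset.univ) fun l _ => (h.smooth_inv k l).mul ((h.smooth i l).normalDeriv h.isOpen)).congr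
    fun q _ => by simp [shapeCoeff]

theorem smooth_traceDeriv (h : IsMetricFamily S ε K) : SmoothUpTo S ε (traceDeriv K) :=
  (SmoothUpTo.sum (s := Finset.univ) fun k _ => h.smooth_shapeCoeff k k).congr fun q hq => by
    simp [← h.sum_shapeCoeff hq]

theorem partialDeriv_christoffel_inl_inr_inl (h : IsMetricFamily S ε K) (hq : q ∈ S ×ˢ Ioo 0 ε)
    (u v : Unit) (k : Fin n) :
    partialDeriv (collarBasis n) (Sum.inr u)
        (christoffel (collarBasis n) (collarMatrix K) (Sum.inl k) (Sum.inr v) (Sum.inl k)) q =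
      1 / 2 * normalDeriv (shapeCoeff K k k) q + (q.2 ^ 2)⁻¹ := by
  have hq' : q ∈ S ×ˢ Ico 0 ε := ⟨hq.1, Ioo_subset_Ico_self hq.2⟩
  have hA := h.smooth_shapeCoeff k k
  have e : christoffel (collarBasis n) (collarMatrix K) (Sum.inl k) (Sum.inr v) (Sum.inl k)
      =ᶠ[𝓝 q] fun z => z.2⁻¹ * (-1) + (1 / 2) * shapeCoeff K k k z :=
    (h.eventually_mem hq).mono fun z hz => by
      rw [h.christoffel_inl_inr_inl hz, if_pos rfl]; ring
  rw [e.partialDeriv_eq, partialDeriv_collar_inr hq.2.1, normalDeriv]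
  have h1 : DifferentiableAt ℝ (fun z : EuclideanSpace ℝ (Fin n) × ℝ => z.2⁻¹ * (-1 : ℝ)) q :=
    ((contDiffAt_snd.inv hq.2.1.ne').mul contDiffAt_const).differentiableAt (n := ∞) (by simp)
  have h2 : DifferentiableAt ℝ (fun z => (1 / 2) * shapeCoeff K k k z) q :=
    ((contDiffAt_const.mul (hA.contDiffAt h.isOpen hq))).differentiableAt (by simp)
  have h3 := halfDeriv_mul h.isOpen (SmoothUpTo.const (1 / 2)) hA hq' (0, 1)
  have h4 := halfDeriv_inv_mul h.isOpen (SmoothUpTo.const (-1)) hq (0, 1)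
  rw [halfDeriv_const] at h3 h4
  rw [halfDeriv_eq_fderiv _ _ hq.2.1] at h3 h4 ⊢
  rw [fderiv_fun_add h1 h2, add_apply, h4]
  refine (congrArg _ h3).trans ?_
  simp only [normalDeriv]
  ring

/-- With `a = x⁻¹` the two factors are the mixed symbols with one normal index, `Γᵏⱼₓ` and `Γˣᵢₖ`.
Their contraction occurs twice in the tangential Ricci tensor, once with `i` and `j` exchanged. -/
theorem sum_shapeCoeff_mul (h : IsMetricFamily S ε K) (hq : q ∈ S ×ˢ Ico 0 ε) (i j : Fin n) (a : ℝ) :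
    ∑ k, (1 / 2 * shapeCoeff K k j q - a * if j = k then 1 else 0) *
        (a * K q i k - 1 / 2 * normalDeriv (fun z => K z i k) q) =
      a * normalDeriv (fun z => K z i j) q - a ^ 2 * K q i j
        - 1 / 4 * ∑ k, ∑ l, normalDeriv (fun z => K z i k) q *
          ((K q)⁻¹ k l * normalDeriv (fun z => K z j l) q) := by
  have h1 : ∑ k, K q i k * shapeCoeff K k j q = normalDeriv (fun z => K z i j) q := by
    simp only [shapeCoeff, Finset.mul_sum]
    rw [Finset.sum_comm]
    simp only [← mul_assoc, ← Finset.sum_mul, h.sum_mul_inv hq]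
    simp [h.normalDeriv_symm hq i j]
  have h2 : ∀ k, (1 / 2 * shapeCoeff K k j q - a * if j = k then 1 else 0) *
        (a * K q i k - 1 / 2 * normalDeriv (fun z => K z i k) q) =
      a / 2 * (K q i k * shapeCoeff K k j q)
        - 1 / 4 * (normalDeriv (fun z => K z i k) q * shapeCoeff K k j q)
        - (if j = k then a ^ 2 * K q i k - a / 2 * normalDeriv (fun z => K z i k) q else 0) := by
    intro k
    split_ifs <;> ring
  simp only [h2, Finset.sum_sub_distrib, ← Finset.mul_sum, h1, Finset.sum_ite_eq, Finset.mem_univ,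
    if_true]
  simp only [shapeCoeff, Finset.mul_sum]
  ring

/-- The singular terms of order `x⁻²` in the Ricci tensor cancel against `n g`, and what is left has
at most a simple pole. The factor `x` removes it, so that the Einstein condition becomes one on
Taylor coefficients of a function smooth up to the boundary. -/
theorem ricciCoord_tangential (h : IsMetricFamily S ε K) (hq : q ∈ S ×ˢ Ioo 0 ε) (i j : Fin n) :
    q.2 * (ricciCoord (collarBasis n) (collarMatrix K) (Sum.inl i) (Sum.inl j) q
      + n * collarMatrix K q (Sum.inl i) (Sum.inl j)) = tangentialDefect K i j q := by
  have h0 : q.2 ≠ 0 := hq.2.1.ne'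
  have hq' : q ∈ S ×ˢ Ico 0 ε := ⟨hq.1, Ioo_subset_Ico_self hq.2⟩
  have e1 : ∀ m k i j, partialDeriv (collarBasis n) (Sum.inl m)
      (christoffel (collarBasis n) (collarMatrix K) (Sum.inl k) (Sum.inl i) (Sum.inl j)) q =
      tangDeriv m (sliceChristoffel K k i j) q := fun m k i j => by
    rw [← partialDeriv_collar_inl hq.2.1]
    exact EventuallyEq.partialDeriv_eq _
      ((h.eventually_mem hq).mono fun z hz => h.christoffel_inl_inl_inl hz k i j) _
  have e2 : ∀ m (u v : Unit), partialDeriv (collarBasis n) (Sum.inl m)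
      (christoffel (collarBasis n) (collarMatrix K) (Sum.inr u) (Sum.inl i) (Sum.inr v)) q = 0 :=
    fun m u v => by
      rw [EventuallyEq.partialDeriv_eq (g := fun _ => 0) _
        ((h.eventually_mem hq).mono fun z hz => h.christoffel_inr_inl_inr hz i u v)]
      simp [partialDeriv]
  have hT := h.sum_shapeCoeff_mul hq' i j q.2⁻¹
  have hT' := h.sum_shapeCoeff_mul hq' j i q.2⁻¹
  have hQ : ∑ k, ∑ l, normalDeriv (fun z => K z j k) q *
          ((K q)⁻¹ k l * normalDeriv (fun z => K z i l) q) =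
      ∑ k, ∑ l, normalDeriv (fun z => K z i k) q *
          ((K q)⁻¹ k l * normalDeriv (fun z => K z j l) q) := by
    rw [Finset.sum_comm]
    refine Finset.sum_congr rfl fun k _ => Finset.sum_congr rfl fun l _ => ?_
    rw [h.inv_symm hq' l k]
    ring
  have htr : ∑ k, (1 / 2 * shapeCoeff K k k q - q.2⁻¹) = 1 / 2 * traceDeriv K q - n * q.2⁻¹ := by
    rw [Finset.sum_sub_distrib, ← Finset.mul_sum, h.sum_shapeCoeff hq']
    simp
  rw [ricciCoord]
  simp only [Fintype.sum_sum_type, Finset.univ_unique, Finset.sum_singleton, e1, e2,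
    h.christoffel_inl_inl_inl hq, h.christoffel_inr_inl_inl hq, h.christoffel_inl_inl_inr hq,
    h.christoffel_inr_inl_inr hq, h.christoffel_inr_inr_inl hq, h.christoffel_inr_inr_inr hq,
    h.partialDeriv_christoffel_inr_inl_inl hq, if_true, mul_one]
  simp only [Finset.sum_add_distrib, Finset.sum_sub_distrib, ← Finset.sum_mul, zero_mul, mul_zero,
    sub_zero, Finset.sum_const_zero]
  have hT2 : ∑ l, (q.2⁻¹ * K q j l - 1 / 2 * normalDeriv (fun z => K z j l) q) *
      (1 / 2 * shapeCoeff K l i q - q.2⁻¹ * if i = l then 1 else 0) = _ :=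
    (Finset.sum_congr rfl fun l _ => mul_comm _ _).trans hT'
  rw [hQ] at hT2
  have htr2 := htr
  rw [Finset.sum_sub_distrib] at htr2
  simp only [hT2, hT, htr2, tangentialDefect, sliceRicci,
    collarMatrix, Matrix.smul_apply, Matrix.fromBlocks_apply₁₁, smul_eq_mul,
    Finset.sum_sub_distrib]
  rw [h.normalDeriv_symm hq' j i, h.symm hq' j i]
  field_simp
  ring

theorem sum_shapeCoeff_mul_shapeCoeff (h : IsMetricFamily S ε K) (hq : q ∈ S ×ˢ Ico 0 ε) :
    ∑ i, ∑ j, ∑ k, ∑ l, ((K q)⁻¹ i j * normalDeriv (fun z => K z j k) q) *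
          ((K q)⁻¹ k l * normalDeriv (fun z => K z l i) q) =
      ∑ k, ∑ l, shapeCoeff K k l q * shapeCoeff K l k q := by
  refine Finset.sum_congr rfl fun i _ => ?_
  rw [Finset.sum_comm]
  refine Finset.sum_congr rfl fun k _ => ?_
  rw [shapeCoeff, shapeCoeff, Finset.sum_mul_sum]
  refine Finset.sum_congr rfl fun j _ => Finset.sum_congr rfl fun l _ => ?_
  rw [h.normalDeriv_symm hq j k, h.normalDeriv_symm hq l i]

theorem ricciCoord_normal (h : IsMetricFamily S ε K) (hq : q ∈ S ×ˢ Ioo 0 ε) (u v : Unit) :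
    q.2 * (ricciCoord (collarBasis n) (collarMatrix K) (Sum.inr u) (Sum.inr v) q
      + n * collarMatrix K q (Sum.inr u) (Sum.inr v)) = normalDefect K q := by
  have h0 : q.2 ≠ 0 := hq.2.1.ne'
  have hq' : q ∈ S ×ˢ Ico 0 ε := ⟨hq.1, Ioo_subset_Ico_self hq.2⟩
  obtain rfl : u = () := rfl
  obtain rfl : v = () := rfl
  have e2 : ∀ m, partialDeriv (collarBasis n) (Sum.inl m)
      (christoffel (collarBasis n) (collarMatrix K) (Sum.inl m) (Sum.inr ()) (Sum.inr ())) q = 0 :=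
    fun m => by
      rw [EventuallyEq.partialDeriv_eq (g := fun _ => 0) _
        ((h.eventually_mem hq).mono fun z hz => h.christoffel_inl_inr_inr hz m () ())]
      simp [partialDeriv]
  have hN : ∑ k, normalDeriv (shapeCoeff K k k) q = normalDeriv (traceDeriv K) q := by
    have := halfDeriv_sum h.isOpen (s := Finset.univ) (F := fun k => shapeCoeff K k k)
      (fun k _ => h.smooth_shapeCoeff k k) hq' (0, 1)
    rw [normalDeriv, ← halfDeriv_congr h.isOpen hq' _ (f := ∑ k, shapeCoeff K k k)]
    · exact this.symm
    · intro q hq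
      rw [← h.sum_shapeCoeff hq, Finset.sum_apply]
  have hT : ∑ k, ∑ l, (1 / 2 * shapeCoeff K k l q - q.2⁻¹ * if l = k then 1 else 0) *
        (1 / 2 * shapeCoeff K l k q - q.2⁻¹ * if k = l then 1 else 0) =
      1 / 4 * ∑ k, ∑ l, shapeCoeff K k l q * shapeCoeff K l k q - q.2⁻¹ * traceDeriv K q
        + n * q.2⁻¹ ^ 2 := by
    have h2 : ∀ k l, (1 / 2 * shapeCoeff K k l q - q.2⁻¹ * if l = k then 1 else 0) *
        (1 / 2 * shapeCoeff K l k q - q.2⁻¹ * if k = l then 1 else 0) =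
        1 / 4 * (shapeCoeff K k l q * shapeCoeff K l k q) -
          if k = l then q.2⁻¹ * shapeCoeff K k l q - q.2⁻¹ ^ 2 else 0 := by
      intro k l
      by_cases hkl : k = l
      · subst hkl; simp; ring
      · simp [hkl, Ne.symm hkl]; ring
    simp only [h2, Finset.sum_sub_distrib, ← Finset.mul_sum, Finset.sum_ite_eq, Finset.mem_univ,
      if_true, h.sum_shapeCoeff hq']
    simp
    ring
  have htr : ∑ k, (1 / 2 * shapeCoeff K k k q - q.2⁻¹) = 1 / 2 * traceDeriv K q - n * q.2⁻¹ := by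
    rw [Finset.sum_sub_distrib, ← Finset.mul_sum, h.sum_shapeCoeff hq']
    simp
  rw [ricciCoord]
  simp only [Fintype.sum_sum_type, Finset.univ_unique, Finset.sum_singleton, PUnit.default_eq_unit,
    e2, h.christoffel_inl_inr_inl hq, h.christoffel_inl_inl_inr hq, h.christoffel_inl_inr_inr hq,
    h.christoffel_inr_inr_inl hq, h.christoffel_inr_inr_inr hq,
    h.partialDeriv_christoffel_inl_inr_inl hq, if_true, mul_one]
  rw [normalDefect, h.sum_shapeCoeff_mul_shapeCoeff hq']
  simp only [mul_zero, sub_zero, zero_sub, sub_self, add_zero, Finset.sum_const_zero,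
    Finset.sum_add_distrib, Finset.sum_neg_distrib, hT, ← Finset.sum_mul, ← Finset.mul_sum, htr, hN]
  simp [collarMatrix]
  field_simp
  ring

/-- In the coefficient `1 - n`, the `1` comes from `Γˣₓₓ = -x⁻¹` and the `-n` from contracting the
part `x⁻¹ K` of `Γˣᵢⱼ` with `K⁻¹`. The remaining part `-½K'` of `Γˣᵢⱼ` produces the trace term. -/
theorem laplacianCoord_collarMatrix (h : IsMetricFamily S ε K) (hq : q ∈ S ×ˢ Ioo 0 ε)
    (f : EuclideanSpace ℝ (Fin n) × ℝ → ℝ) :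
    laplacianCoord (collarBasis n) (collarMatrix K) f q =
      -(q.2 ^ 2 * partialDeriv (collarBasis n) (Sum.inr ())
            (partialDeriv (collarBasis n) (Sum.inr ()) f) q
        + (1 - n) * (q.2 * partialDeriv (collarBasis n) (Sum.inr ()) f q)
        + 1 / 2 * (q.2 ^ 2 * (traceDeriv K q * partialDeriv (collarBasis n) (Sum.inr ()) f q))
        + q.2 ^ 2 * ∑ i, ∑ j, (K q)⁻¹ i j * (partialDeriv (collarBasis n) (Sum.inl i)
            (partialDeriv (collarBasis n) (Sum.inl j) f) q
          - ∑ k, sliceChristoffel K k i j q * partialDeriv (collarBasis n) (Sum.inl k) f q)) := by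
  have h0 : q.2 ≠ 0 := hq.2.1.ne'
  have hq' : q ∈ S ×ˢ Ico 0 ε := ⟨hq.1, Ioo_subset_Ico_self hq.2⟩
  have hn : ∑ i, ∑ j, (K q)⁻¹ i j * K q i j = n := by
    have e : ∀ i, ∑ j, (K q)⁻¹ i j * K q i j = 1 := fun i => by
      have := h.sum_mul_inv hq' i i
      rw [if_pos rfl] at this
      rw [← this]
      exact Finset.sum_congr rfl fun j _ => by rw [h.inv_symm hq' i j, mul_comm]
    simp [e]
  rw [laplacianCoord, h.inv_collarMatrix hq]
  simp only [Fintype.sum_sum_type, Finset.univ_unique, Finset.sum_singleton, PUnit.default_eq_unit,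
    h.christoffel_inl_inl_inl hq, h.christoffel_inr_inl_inl hq,
    h.christoffel_inl_inr_inr hq, h.christoffel_inr_inr_inr hq, Matrix.smul_apply,
    Matrix.fromBlocks_apply₁₁, Matrix.fromBlocks_apply₁₂, Matrix.fromBlocks_apply₂₁,
    Matrix.fromBlocks_apply₂₂, Matrix.zero_apply, Matrix.one_apply_eq, smul_eq_mul]
  set X := partialDeriv (collarBasis n) (Sum.inr ()) f q
  set XX := partialDeriv (collarBasis n) (Sum.inr ()) (partialDeriv (collarBasis n) (Sum.inr ()) f) q
  have e : ∀ i j, q.2 ^ 2 * (K q)⁻¹ i j * (partialDeriv (collarBasis n) (Sum.inl i)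
            (partialDeriv (collarBasis n) (Sum.inl j) f) q
          - (∑ k, sliceChristoffel K k i j q * partialDeriv (collarBasis n) (Sum.inl k) f q
            + (q.2⁻¹ * K q i j - 1 / 2 * normalDeriv (fun z => K z i j) q) * X)) =
      q.2 ^ 2 * ((K q)⁻¹ i j * (partialDeriv (collarBasis n) (Sum.inl i)
            (partialDeriv (collarBasis n) (Sum.inl j) f) q
          - ∑ k, sliceChristoffel K k i j q * partialDeriv (collarBasis n) (Sum.inl k) f q))
        - q.2 * X * ((K q)⁻¹ i j * K q i j)
        + 1 / 2 * q.2 ^ 2 * X * ((K q)⁻¹ i j * normalDeriv (fun z => K z i j) q) := by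
    intro i j
    field_simp
    ring
  simp only [e, Finset.sum_add_distrib, Finset.sum_sub_distrib, ← Finset.mul_sum, hn, traceDeriv]
  simp
  field_simp
  ring

end IsMetricFamily

/-! ### Invariance of the Laplacian under changes of coordinates. -/

section ChangeOfCoordinates

theorem sum_comm_four {ι : Type*} [Fintype ι] (F : ι → ι → ι → ι → ℝ) :
    ∑ i, ∑ j, ∑ a, ∑ c, F i j a c = ∑ c, ∑ a, ∑ j, ∑ i, F i j a c := by
  calc ∑ i, ∑ j, ∑ a, ∑ c, F i j a c = ∑ i, ∑ j, ∑ c, ∑ a, F i j a c :=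
        Finset.sum_congr rfl fun i _ => Finset.sum_congr rfl fun j _ => Finset.sum_comm
    _ = ∑ i, ∑ c, ∑ j, ∑ a, F i j a c := Finset.sum_congr rfl fun i _ => Finset.sum_comm
    _ = ∑ c, ∑ i, ∑ j, ∑ a, F i j a c := Finset.sum_comm
    _ = ∑ c, ∑ i, ∑ a, ∑ j, F i j a c :=
        Finset.sum_congr rfl fun c _ => Finset.sum_congr rfl fun i _ => Finset.sum_comm
    _ = ∑ c, ∑ a, ∑ i, ∑ j, F i j a c := Finset.sum_congr rfl fun c _ => Finset.sum_comm
    _ = ∑ c, ∑ a, ∑ j, ∑ i, F i j a c :=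
        Finset.sum_congr rfl fun c _ => Finset.sum_congr rfl fun a _ => Finset.sum_comm

variable {V : Type*} [NormedAddCommGroup V] [NormedSpace ℝ V] [FiniteDimensional ℝ V] {ι : Type*}
  [Fintype ι] [DecidableEq ι] (b : Module.Basis ι ℝ V)

/-- The bilinear form with matrix `A` in the basis `b`. -/
noncomputable def formOfMatrix (A : Matrix ι ι ℝ) : V →L[ℝ] V →L[ℝ] ℝ :=
  ∑ i, ∑ j, A i j • ContinuousLinearMap.smulRight
    (LinearMap.toContinuousLinearMap (b.coord i)) (LinearMap.toContinuousLinearMap (b.coord j))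

theorem formOfMatrix_apply (A : Matrix ι ι ℝ) (v w : V) :
    formOfMatrix b A v w = ∑ i, ∑ j, A i j * (b.repr v i * b.repr w j) := by
  simp [formOfMatrix]

@[simp] theorem formOfMatrix_basis (A : Matrix ι ι ℝ) (i j : ι) :
    formOfMatrix b A (b i) (b j) = A i j := by
  rw [formOfMatrix_apply]
  simp only [Module.Basis.repr_self, Finsupp.single_apply]
  simp [Finset.sum_ite_eq]

theorem formOfMatrix_of (B : V →L[ℝ] V →L[ℝ] ℝ) (v w : V) :
    formOfMatrix b (Matrix.of fun i j => B (b i) (b j)) v w = B v w := by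
  rw [formOfMatrix_apply]
  conv_rhs => rw [← b.sum_repr v, ← b.sum_repr w]
  simp only [map_sum, map_smul, sum_apply, smul_apply, smul_eq_mul, Matrix.of_apply,
    Finset.mul_sum]
  rw [Finset.sum_comm]
  refine Finset.sum_congr rfl fun i _ => Finset.sum_congr rfl fun j _ => ?_
  ring

theorem formOfMatrix_comm {A : Matrix ι ι ℝ} (hA : A.IsSymm) (v w : V) :
    formOfMatrix b A v w = formOfMatrix b A w v := by
  rw [formOfMatrix_apply, formOfMatrix_apply, Finset.sum_comm]
  refine Finset.sum_congr rfl fun i _ => Finset.sum_congr rfl fun j _ => ?_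
  rw [hA.apply]
  ring

/-- The Christoffel symbols of the first kind of a field of bilinear forms. -/
noncomputable def christoffelFirst (g : V → V →L[ℝ] V →L[ℝ] ℝ) (y u v w : V) : ℝ :=
  (1 / 2 : ℝ) * (fderiv ℝ (fun z => g z v w) y u + fderiv ℝ (fun z => g z u w) y v
    - fderiv ℝ (fun z => g z u v) y w)

/-- The gradient of a function with differential `l` with respect to the matrix `A`. -/
noncomputable def metricGradient (A : Matrix ι ι ℝ) (l : V →L[ℝ] ℝ) : V :=
  ∑ j, (∑ i, A⁻¹ i j * l (b i)) • b j

theorem formOfMatrix_metricGradient {A : Matrix ι ι ℝ} (hA : A.det ≠ 0) (l : V →L[ℝ] ℝ) (v : V) :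
    formOfMatrix b A (metricGradient b A l) v = l v := by
  have h : ∀ m, formOfMatrix b A (metricGradient b A l) (b m) = l (b m) := by
    intro m
    simp only [metricGradient, map_sum, map_smul, sum_apply, smul_apply, formOfMatrix_basis,
      smul_eq_mul, Finset.sum_mul]
    rw [Finset.sum_comm]
    have : ∀ i j, A⁻¹ i j * l (b i) * A j m = l (b i) * (A⁻¹ i j * A j m) := fun i j => by ring
    simp only [this, ← Finset.mul_sum, ← Matrix.mul_apply,
      Matrix.nonsing_inv_mul _ (isUnit_iff_ne_zero.2 hA), Matrix.one_apply]
    simp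
  conv_rhs => rw [← b.sum_repr v]
  conv_lhs => rw [← b.sum_repr v]
  simp only [map_sum, map_smul, h]

theorem eq_of_formOfMatrix {A : Matrix ι ι ℝ} (hA : A.det ≠ 0) {v w : V}
    (h : ∀ u, formOfMatrix b A v u = formOfMatrix b A w u) : v = w := by
  apply b.repr.injective
  ext m
  have key : ∀ v : V, b.repr v m =
      ∑ j, formOfMatrix b A v (b j) * A⁻¹ j m := by
    intro v
    have e : ∀ j, formOfMatrix b A v (b j) = ∑ i, b.repr v i * A i j := by
      intro j
      rw [formOfMatrix_apply]
      refine Finset.sum_congr rfl fun i _ => ?_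
      simp [Finsupp.single_apply, mul_comm]
    simp only [e, Finset.sum_mul, mul_assoc]
    rw [Finset.sum_comm]
    simp only [← Finset.mul_sum, ← Matrix.mul_apply,
      Matrix.mul_nonsing_inv _ (isUnit_iff_ne_zero.2 hA), Matrix.one_apply]
    simp
  rw [key, key]
  simp only [h]

/-- Contraction with the gradient replaces the usual symbols by those of the first kind, whose
behaviour under pullback involves no inverse matrix. -/
theorem christoffelFirst_metricGradient {G : V → Matrix ι ι ℝ} {y : V}
    (hG : ∀ i j, DifferentiableAt ℝ (fun z => G z i j) y) (i j : ι) (l : V →L[ℝ] ℝ) :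
    christoffelFirst (fun z => formOfMatrix b (G z)) y (b i) (b j) (metricGradient b (G y) l) =
      ∑ k, christoffel b G k i j y * l (b k) := by
  have h2 : ∀ i (c : ι → ℝ) w, fderiv ℝ (fun z => ∑ k, c k * G z i k) y w =
      ∑ k, c k * fderiv ℝ (fun z => G z i k) y w := by
    intro i c w
    rw [fderiv_fun_sum fun k _ => (hG i k).const_mul (c k), sum_apply]
    refine Finset.sum_congr rfl fun k _ => ?_
    rw [fderiv_const_mul (hG i k)]
    rfl
  simp only [christoffelFirst, metricGradient, h2, formOfMatrix_basis, map_sum, map_smul,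
    smul_eq_mul, christoffel, partialDeriv]
  rw [← Finset.sum_add_distrib, ← Finset.sum_sub_distrib, Finset.mul_sum]
  have hR : ∀ k, (1 / 2 * ∑ m, (G y)⁻¹ k m * (fderiv ℝ (fun z => G z j m) y (b i)
      + fderiv ℝ (fun z => G z i m) y (b j) - fderiv ℝ (fun z => G z i j) y (b m))) * l (b k) =
      ∑ m, 1 / 2 * ((G y)⁻¹ k m * l (b k) * (fderiv ℝ (fun z => G z j m) y (b i)
      + fderiv ℝ (fun z => G z i m) y (b j) - fderiv ℝ (fun z => G z i j) y (b m))) := by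
    intro k
    rw [Finset.mul_sum, Finset.sum_mul]
    exact Finset.sum_congr rfl fun m _ => by ring
  rw [Finset.sum_congr rfl fun k _ => hR k, Finset.sum_comm]
  refine Finset.sum_congr rfl fun m _ => ?_
  rw [← Finset.mul_sum, Finset.sum_mul, Finset.sum_mul, Finset.sum_mul, ← Finset.sum_add_distrib,
    ← Finset.sum_sub_distrib]
  congr 1
  exact Finset.sum_congr rfl fun k _ => by ring

theorem fderiv_fderiv_apply {f : V → ℝ} {y : V} (hf : ContDiffAt ℝ ∞ f y) (u v : V) :
    fderiv ℝ (fderiv ℝ f) y u v = fderiv ℝ (fun z => fderiv ℝ f z v) y u := by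
  have hd : DifferentiableAt ℝ (fderiv ℝ f) y :=
    (hf.fderiv_right (m := ∞) (by simp)).differentiableAt (by simp)
  rw [fderiv_clm_apply hd (by fun_prop)]
  simp

theorem fderiv_fderiv_comp {f : V → ℝ} {Φ : V → V} {y : V} (hΦ : ContDiffAt ℝ ∞ Φ y)
    (hf : ContDiffAt ℝ ∞ f (Φ y)) (u v : V) :
    fderiv ℝ (fderiv ℝ (f ∘ Φ)) y u v =
      fderiv ℝ (fderiv ℝ f) (Φ y) (fderiv ℝ Φ y u) (fderiv ℝ Φ y v)
        + fderiv ℝ f (Φ y) (fderiv ℝ (fderiv ℝ Φ) y u v) := by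
  have hd1 : HasFDerivAt Φ (fderiv ℝ Φ y) y := (hΦ.differentiableAt (by simp)).hasFDerivAt
  have hd : HasFDerivAt (fderiv ℝ Φ) (fderiv ℝ (fderiv ℝ Φ) y) y :=
    ((hΦ.fderiv_right (m := ∞) (by simp)).differentiableAt (by simp)).hasFDerivAt
  have hddf : HasFDerivAt (fderiv ℝ f) (fderiv ℝ (fderiv ℝ f) (Φ y)) (Φ y) :=
    ((hf.fderiv_right (m := ∞) (by simp)).differentiableAt (by simp)).hasFDerivAt
  have e : (fun z => fderiv ℝ (f ∘ Φ) z v) =ᶠ[𝓝 y]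
      fun z => fderiv ℝ f (Φ z) (fderiv ℝ Φ z v) := by
    have h1 : ∀ᶠ z in 𝓝 y, DifferentiableAt ℝ Φ z :=
      ((hΦ.of_le (m := 1) (by simp)).eventually (by simp)).mono
        fun z hz => hz.differentiableAt (by simp)
    have h2 : ∀ᶠ z in 𝓝 (Φ y), DifferentiableAt ℝ f z :=
      ((hf.of_le (m := 1) (by simp)).eventually (by simp)).mono
        fun z hz => hz.differentiableAt (by simp)
    filter_upwards [h1, hΦ.continuousAt.eventually h2] with z h1 h2
    rw [fderiv_comp z h2 h1]
    rfl
  have a1 : HasFDerivAt (fun z => fderiv ℝ f (Φ z))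
      ((fderiv ℝ (fderiv ℝ f) (Φ y)).comp (fderiv ℝ Φ y)) y := hddf.comp y hd1
  have a2 := hd.clm_apply (hasFDerivAt_const v y)
  rw [fderiv_fderiv_apply (hf.comp y hΦ), e.fderiv_eq, (a1.clm_apply a2).fderiv]
  simp [add_comm]

theorem laplacianCoord_eq_hessian {G : V → Matrix ι ι ℝ} {y : V} {f : V → ℝ}
    (hG : ∀ i j, DifferentiableAt ℝ (fun z => G z i j) y) (hf : ContDiffAt ℝ ∞ f y) :
    laplacianCoord b G f y = - ∑ i, ∑ j, (G y)⁻¹ i j * (fderiv ℝ (fderiv ℝ f) y (b i) (b j)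
      - christoffelFirst (fun z => formOfMatrix b (G z)) y (b i) (b j)
          (metricGradient b (G y) (fderiv ℝ f y))) := by
  simp only [christoffelFirst_metricGradient b hG]
  rw [laplacianCoord]
  congr 1
  refine Finset.sum_congr rfl fun i _ => Finset.sum_congr rfl fun j _ => ?_
  congr 2
  exact (fderiv_fderiv_apply hf _ _).symm

variable {Φ : V → V} {y : V}

/-- The derivative along `u` of a field of bilinear forms. -/
noncomputable def formDeriv (G : V → Matrix ι ι ℝ) (y u : V) : V →L[ℝ] V →L[ℝ] ℝ :=
  formOfMatrix b (Matrix.of fun i j => fderiv ℝ (fun z => G z i j) y u)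

theorem fderiv_formOfMatrix {A : V → Matrix ι ι ℝ} {ψ χ : V → V} {y : V}
    (hA : ∀ i j, DifferentiableAt ℝ (fun z => A z i j) y) (hψ : DifferentiableAt ℝ ψ y)
    (hχ : DifferentiableAt ℝ χ y) (u : V) :
    fderiv ℝ (fun z => formOfMatrix b (A z) (ψ z) (χ z)) y u =
      formDeriv b A y u (ψ y) (χ y) + formOfMatrix b (A y) (fderiv ℝ ψ y u) (χ y)
        + formOfMatrix b (A y) (ψ y) (fderiv ℝ χ y u) := by
  have hc : ∀ {ψ : V → V} (hψ : DifferentiableAt ℝ ψ y) (i : ι),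
      HasFDerivAt (fun z => b.repr (ψ z) i)
        ((LinearMap.toContinuousLinearMap (b.coord i)).comp (fderiv ℝ ψ y)) y := fun hψ i =>
    (LinearMap.toContinuousLinearMap (b.coord i)).hasFDerivAt.comp y hψ.hasFDerivAt
  simp only [formDeriv, formOfMatrix_apply]
  have h := HasFDerivAt.fun_sum (u := Finset.univ) fun i _ =>
    HasFDerivAt.fun_sum (u := Finset.univ) fun j _ =>
      (hA i j).hasFDerivAt.fun_mul ((hc hψ i).fun_mul (hc hχ j))
  rw [h.fderiv]
  simp only [sum_apply, ← Finset.sum_add_distrib]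
  refine Finset.sum_congr rfl fun i _ => Finset.sum_congr rfl fun j _ => ?_
  simp
  ring

theorem christoffelFirst_formOfMatrix {G : V → Matrix ι ι ℝ} {y : V}
    (hG : ∀ i j, DifferentiableAt ℝ (fun z => G z i j) y) (u v w : V) :
    christoffelFirst (fun z => formOfMatrix b (G z)) y u v w =
      (1 / 2 : ℝ) * (formDeriv b G y u v w + formDeriv b G y v u w - formDeriv b G y w u v) := by
  have hc : ∀ v w u : V, fderiv ℝ (fun z => formOfMatrix b (G z) v w) y u =
      formDeriv b G y u v w := by
    intro v w u
    rw [fderiv_formOfMatrix b hG (differentiableAt_const v) (differentiableAt_const w)]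
    simp
  simp only [christoffelFirst, hc]

theorem formDeriv_add (G : V → Matrix ι ι ℝ) (y u u' v w : V) :
    formDeriv b G y (u + u') v w = formDeriv b G y u v w + formDeriv b G y u' v w := by
  simp only [formDeriv, formOfMatrix_apply, map_add, Matrix.of_apply, add_mul,
    Finset.sum_add_distrib]

theorem formDeriv_smul (G : V → Matrix ι ι ℝ) (y u v w : V) (c : ℝ) :
    formDeriv b G y (c • u) v w = c * formDeriv b G y u v w := by
  simp only [formDeriv, formOfMatrix_apply, map_smul, Matrix.of_apply, smul_eq_mul,
    Finset.mul_sum, mul_assoc]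

/-- Each of the three derivatives of the pulled back form produces two terms containing `D²Φ`. By
symmetry of `D²Φ` and of the form, four of the six cancel and the other two coincide, which the
factor `½` turns into one. -/
theorem christoffelFirst_pullback {G G' : V → Matrix ι ι ℝ} (hΦ : ContDiffAt ℝ ∞ Φ y)
    (hG' : ∀ i j, DifferentiableAt ℝ (fun z => G' z i j) (Φ y)) (hsymm : (G' (Φ y)).IsSymm)
    (h : ∀ᶠ z in 𝓝 y, ∀ v w, formOfMatrix b (G z) v w =
      formOfMatrix b (G' (Φ z)) (fderiv ℝ Φ z v) (fderiv ℝ Φ z w)) (u v w : V) :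
    christoffelFirst (fun z => formOfMatrix b (G z)) y u v w =
      christoffelFirst (fun z => formOfMatrix b (G' z)) (Φ y)
          (fderiv ℝ Φ y u) (fderiv ℝ Φ y v) (fderiv ℝ Φ y w)
        + formOfMatrix b (G' (Φ y)) (fderiv ℝ (fderiv ℝ Φ) y u v) (fderiv ℝ Φ y w) := by
  have hd : HasFDerivAt (fderiv ℝ Φ) (fderiv ℝ (fderiv ℝ Φ) y) y :=
    ((hΦ.fderiv_right (m := ∞) (by simp)).differentiableAt (by simp)).hasFDerivAt
  have hd1 : HasFDerivAt Φ (fderiv ℝ Φ y) y := (hΦ.differentiableAt (by simp)).hasFDerivAt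
  have hs : ∀ u v, fderiv ℝ (fderiv ℝ Φ) y u v = fderiv ℝ (fderiv ℝ Φ) y v u := fun u v =>
    hΦ.isSymmSndFDerivAt (by
      rw [minSmoothness_of_isRCLikeNormedField]
      exact WithTop.coe_le_coe.2 (le_top (a := (2 : ℕ∞)))) u v
  have hv : ∀ v, HasFDerivAt (fun z => fderiv ℝ Φ z v) ((fderiv ℝ (fderiv ℝ Φ) y).flip v) y := by
    intro v
    have := hd.clm_apply (hasFDerivAt_const v y)
    simpa using this
  have hA : ∀ i j, HasFDerivAt (fun z => G' (Φ z) i j)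
      ((fderiv ℝ (fun z => G' z i j) (Φ y)).comp (fderiv ℝ Φ y)) y := fun i j =>
    (hG' i j).hasFDerivAt.comp y hd1
  have hp : ∀ v w u : V, fderiv ℝ (fun z => formOfMatrix b (G z) v w) y u =
      formDeriv b G' (Φ y) (fderiv ℝ Φ y u) (fderiv ℝ Φ y v) (fderiv ℝ Φ y w)
        + formOfMatrix b (G' (Φ y)) (fderiv ℝ (fderiv ℝ Φ) y u v) (fderiv ℝ Φ y w)
        + formOfMatrix b (G' (Φ y)) (fderiv ℝ Φ y v) (fderiv ℝ (fderiv ℝ Φ) y u w) := by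
    intro v w u
    have e : (fun z => formOfMatrix b (G z) v w) =ᶠ[𝓝 y]
        fun z => formOfMatrix b (G' (Φ z)) (fderiv ℝ Φ z v) (fderiv ℝ Φ z w) :=
      h.mono fun z hz => hz v w
    rw [e.fderiv_eq, fderiv_formOfMatrix b (A := fun z => G' (Φ z))
      (fun i j => (hA i j).differentiableAt) (hv v).differentiableAt (hv w).differentiableAt,
      (hv v).fderiv, (hv w).fderiv]
    simp only [formDeriv, (hA _ _).fderiv]
    rfl
  rw [christoffelFirst_formOfMatrix b hG']
  simp only [christoffelFirst, hp]
  rw [hs w u, hs w v, hs v u,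
    formOfMatrix_comm b hsymm (fderiv ℝ Φ y v) (fderiv ℝ (fderiv ℝ Φ) y u w)]
  ring

/-- The Hessian `D²f - Γ(·, ·, grad f)` is a tensor: the chain rule gives `df(D²Φ(u,v))` and the
pullback of the symbols gives `⟨D²Φ(u,v), grad f⟩`, which are equal. The trace is invariant because
the inverse metric transforms by `J G⁻¹ Jᵀ`. -/
theorem laplacianCoord_comp {G G' : V → Matrix ι ι ℝ} {f : V → ℝ} (hΦ : ContDiffAt ℝ ∞ Φ y)
    (hG' : ∀ i j, DifferentiableAt ℝ (fun z => G' z i j) (Φ y)) (hsymm : (G' (Φ y)).IsSymm)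
    (hdet' : (G' (Φ y)).det ≠ 0) (hdet : (G y).det ≠ 0)
    (hG : ∀ i j, DifferentiableAt ℝ (fun z => G z i j) y)
    (h : ∀ᶠ z in 𝓝 y, ∀ i j, G z i j =
      formOfMatrix b (G' (Φ z)) (fderiv ℝ Φ z (b i)) (fderiv ℝ Φ z (b j)))
    (hf : ContDiffAt ℝ ∞ f (Φ y)) :
    laplacianCoord b G (f ∘ Φ) y = laplacianCoord b G' f (Φ y) := by
  set L : V →L[ℝ] V := fderiv ℝ Φ y with hL
  set J : Matrix ι ι ℝ := LinearMap.toMatrix b b L with hJ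
  have hd1 : HasFDerivAt Φ L y := (hΦ.differentiableAt (by simp)).hasFDerivAt
  have hdf : HasFDerivAt f (fderiv ℝ f (Φ y)) (Φ y) :=
    (hf.differentiableAt (by simp)).hasFDerivAt
  have hfΦ : ContDiffAt ℝ ∞ (f ∘ Φ) y := hf.comp y hΦ
  have hform : ∀ᶠ z in 𝓝 y, ∀ v w, formOfMatrix b (G z) v w =
      formOfMatrix b (G' (Φ z)) (fderiv ℝ Φ z v) (fderiv ℝ Φ z w) := by
    filter_upwards [h] with z hz v w
    have e : G z = Matrix.of fun i j => ((formOfMatrix b (G' (Φ z))).bilinearComp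
        (fderiv ℝ Φ z) (fderiv ℝ Φ z)) (b i) (b j) := by
      ext i j
      rw [hz i j]
      rfl
    rw [e, formOfMatrix_of]
    rfl
  have hformy := hform.self_of_nhds
  have hmat : G y = J.transpose * G' (Φ y) * J := by
    ext i j
    rw [h.self_of_nhds i j, formOfMatrix_apply, Matrix.mul_apply]
    simp only [Matrix.mul_apply, Matrix.transpose_apply, hJ, LinearMap.toMatrix_apply,
      ContinuousLinearMap.coe_coe, Finset.sum_mul]
    rw [Finset.sum_comm]
    refine Finset.sum_congr rfl fun k _ => Finset.sum_congr rfl fun l _ => ?_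
    ring
  -- `Φ` is not assumed to be a local diffeomorphism; its differential is invertible because the
  -- pulled back form is nondegenerate.
  have hJdet : J.det ≠ 0 := by
    intro h0
    apply hdet
    rw [hmat, Matrix.det_mul, h0, mul_zero]
  have hJu : IsUnit J.det := isUnit_iff_ne_zero.2 hJdet
  have hinv : J * (G y)⁻¹ * J.transpose = (G' (Φ y))⁻¹ := by
    rw [hmat, Matrix.mul_inv_rev, Matrix.mul_inv_rev, ← Matrix.mul_assoc, ← Matrix.mul_assoc,
      Matrix.mul_nonsing_inv _ hJu, Matrix.one_mul, Matrix.mul_assoc, Matrix.nonsing_inv_mul,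
      Matrix.mul_one]
    rwa [Matrix.det_transpose]
  have hsurj : ∀ v, ∃ w, L w = v := by
    intro v
    refine ⟨LinearMap.toMatrix b b |>.symm J⁻¹ v, ?_⟩
    have e : (L : V →ₗ[ℝ] V) ∘ₗ (LinearMap.toMatrix b b).symm J⁻¹ = LinearMap.id := by
      apply (LinearMap.toMatrix b b).injective
      rw [LinearMap.toMatrix_comp b b b, LinearEquiv.apply_symm_apply, ← hJ,
        Matrix.mul_nonsing_inv _ hJu, LinearMap.toMatrix_id]
    exact LinearMap.congr_fun e v
  have hgrad : L (metricGradient b (G y) (fderiv ℝ (f ∘ Φ) y)) =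
      metricGradient b (G' (Φ y)) (fderiv ℝ f (Φ y)) := by
    apply eq_of_formOfMatrix b hdet'
    intro u
    obtain ⟨w, rfl⟩ := hsurj u
    rw [← hformy, formOfMatrix_metricGradient b hdet, formOfMatrix_metricGradient b hdet',
      (hdf.comp y hd1).fderiv]
    rfl
  have key : ∀ u v, fderiv ℝ (fderiv ℝ (f ∘ Φ)) y u v
      - christoffelFirst (fun z => formOfMatrix b (G z)) y u v
          (metricGradient b (G y) (fderiv ℝ (f ∘ Φ) y)) =
      fderiv ℝ (fderiv ℝ f) (Φ y) (L u) (L v)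
      - christoffelFirst (fun z => formOfMatrix b (G' z)) (Φ y) (L u) (L v)
          (metricGradient b (G' (Φ y)) (fderiv ℝ f (Φ y))) := by
    intro u v
    rw [fderiv_fderiv_comp hΦ hf, christoffelFirst_pullback b hΦ hG' hsymm hform, ← hL, hgrad,
      formOfMatrix_comm b hsymm, formOfMatrix_metricGradient b hdet']
    ring
  rw [laplacianCoord_eq_hessian b hG hfΦ, laplacianCoord_eq_hessian b hG' hf]
  simp only [key]
  congr 1
  set X := metricGradient b (G' (Φ y)) (fderiv ℝ f (Φ y))
  set D2 := fderiv ℝ (fderiv ℝ f) (Φ y)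
  -- The Hessian is packaged as a bilinear map in order to expand it in the columns of `J`.
  obtain ⟨B, hB⟩ : ∃ B : V →ₗ[ℝ] V →ₗ[ℝ] ℝ, ∀ u v, B u v = D2 u v -
      christoffelFirst (fun z => formOfMatrix b (G' z)) (Φ y) u v X := by
    refine ⟨LinearMap.mk₂ ℝ (fun u v => D2 u v -
      christoffelFirst (fun z => formOfMatrix b (G' z)) (Φ y) u v X) ?_ ?_ ?_ ?_, fun u v => rfl⟩
    all_goals
      intros
      simp only [christoffelFirst_formOfMatrix b hG', formDeriv_add, formDeriv_smul, map_add,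
        map_smul, add_apply, smul_apply, smul_eq_mul]
      ring
  simp only [← hB]
  have hLb : ∀ i, L (b i) = ∑ a, J a i • b a := by
    intro i
    conv_lhs => rw [← b.sum_repr (L (b i))]
    simp only [hJ, LinearMap.toMatrix_apply, ContinuousLinearMap.coe_coe]
  simp only [← hinv, Matrix.mul_apply, Matrix.transpose_apply, hLb, map_sum, map_smul,
    LinearMap.sum_apply, LinearMap.smul_apply, smul_eq_mul, Finset.sum_mul, Finset.mul_sum]
  rw [sum_comm_four]
  refine Finset.sum_congr rfl fun a _ => Finset.sum_congr rfl fun c _ =>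
    Finset.sum_congr rfl fun j _ => Finset.sum_congr rfl fun i _ => ?_
  ring

end ChangeOfCoordinates

/-! ### Linearity of the Laplacian and the maximum principle. -/

section CoordLaplacian

variable {V : Type*} [NormedAddCommGroup V] [NormedSpace ℝ V] {ι : Type*} (b : Module.Basis ι ℝ V)

theorem ContDiffAt.eventually_differentiableAt {f : V → ℝ} {y : V} (hf : ContDiffAt ℝ ∞ f y) :
    ∀ᶠ z in 𝓝 y, DifferentiableAt ℝ f z :=
  ((hf.of_le (m := 1) (by simp)).eventually (by simp)).mono
    fun z hz => hz.differentiableAt (by simp)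

theorem ContDiffAt.partialDeriv {f : V → ℝ} {y : V} (hf : ContDiffAt ℝ ∞ f y) (i : ι) :
    ContDiffAt ℝ ∞ (partialDeriv b i f) y :=
  (hf.fderiv_right (m := ∞) (by simp)).clm_apply contDiffAt_const

theorem partialDeriv_add {f g : V → ℝ} {y : V} (hf : DifferentiableAt ℝ f y)
    (hg : DifferentiableAt ℝ g y) (i : ι) :
    partialDeriv b i (fun z => f z + g z) y = partialDeriv b i f y + partialDeriv b i g y := by
  rw [partialDeriv, fderiv_fun_add hf hg]; rfl

theorem partialDeriv_const_mul {f : V → ℝ} {y : V} (c : ℝ) (hf : DifferentiableAt ℝ f y) (i : ι) :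
    partialDeriv b i (fun z => c * f z) y = c * partialDeriv b i f y := by
  rw [partialDeriv, fderiv_const_mul hf]; rfl

variable [Fintype ι] [DecidableEq ι]

theorem laplacianCoord_add (G : V → Matrix ι ι ℝ) {f g : V → ℝ} {y : V}
    (hf : ContDiffAt ℝ ∞ f y) (hg : ContDiffAt ℝ ∞ g y) :
    laplacianCoord b G (fun z => f z + g z) y =
      laplacianCoord b G f y + laplacianCoord b G g y := by
  have e : ∀ j, _root_.partialDeriv b j (fun z => f z + g z) =ᶠ[𝓝 y]
      fun z => _root_.partialDeriv b j f z + _root_.partialDeriv b j g z := fun j => by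
    filter_upwards [hf.eventually_differentiableAt, hg.eventually_differentiableAt] with z h1 h2
    exact partialDeriv_add b h1 h2 j
  have e2 : ∀ i j, _root_.partialDeriv b i (_root_.partialDeriv b j (fun z => f z + g z)) y =
      _root_.partialDeriv b i (_root_.partialDeriv b j f) y
        + _root_.partialDeriv b i (_root_.partialDeriv b j g) y := fun i j => by
    rw [(e j).partialDeriv_eq b i]
    exact partialDeriv_add b ((hf.partialDeriv b j).differentiableAt (by simp))
      ((hg.partialDeriv b j).differentiableAt (by simp)) i
  simp only [laplacianCoord, e2, (e _).eq_of_nhds]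
  rw [← neg_add, ← Finset.sum_add_distrib]
  congr 1
  refine Finset.sum_congr rfl fun i _ => ?_
  rw [← Finset.sum_add_distrib]
  refine Finset.sum_congr rfl fun j _ => ?_
  simp only [mul_add, Finset.sum_add_distrib]
  ring

theorem laplacianCoord_const_mul (G : V → Matrix ι ι ℝ) {f : V → ℝ} {y : V} (c : ℝ)
    (hf : ContDiffAt ℝ ∞ f y) :
    laplacianCoord b G (fun z => c * f z) y = c * laplacianCoord b G f y := by
  have e : ∀ j, _root_.partialDeriv b j (fun z => c * f z) =ᶠ[𝓝 y]
      fun z => c * _root_.partialDeriv b j f z := fun j => by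
    filter_upwards [hf.eventually_differentiableAt] with z h1
    exact partialDeriv_const_mul b c h1 j
  have e2 : ∀ i j, _root_.partialDeriv b i (_root_.partialDeriv b j (fun z => c * f z)) y =
      c * _root_.partialDeriv b i (_root_.partialDeriv b j f) y := fun i j => by
    rw [(e j).partialDeriv_eq b i]
    exact partialDeriv_const_mul b c ((hf.partialDeriv b j).differentiableAt (by simp)) i
  simp only [laplacianCoord, e2, (e _).eq_of_nhds]
  rw [mul_neg, Finset.mul_sum]
  congr 1
  refine Finset.sum_congr rfl fun i _ => ?_
  rw [Finset.mul_sum]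
  refine Finset.sum_congr rfl fun j _ => ?_
  simp only [mul_left_comm _ c, ← Finset.mul_sum]
  ring

theorem laplacianCoord_sub (G : V → Matrix ι ι ℝ) {f g : V → ℝ} {y : V}
    (hf : ContDiffAt ℝ ∞ f y) (hg : ContDiffAt ℝ ∞ g y) :
    laplacianCoord b G (fun z => f z - g z) y =
      laplacianCoord b G f y - laplacianCoord b G g y := by
  have h := laplacianCoord_add b G hf (contDiffAt_const.mul hg : ContDiffAt ℝ ∞
    (fun z => (-1) * g z) y)
  rw [laplacianCoord_const_mul b G (-1) hg] at h
  have e : (fun z => f z - g z) = fun z => f z + (-1) * g z := by funext z; ring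
  rw [e, h]; ring

theorem laplacianCoord_sum (G : V → Matrix ι ι ℝ) {κ : Type*} (s : Finset κ) {F : κ → V → ℝ}
    {y : V} (hF : ∀ k ∈ s, ContDiffAt ℝ ∞ (F k) y) :
    laplacianCoord b G (fun z => ∑ k ∈ s, F k z) y = ∑ k ∈ s, laplacianCoord b G (F k) y := by
  classical
  induction s using Finset.induction_on with
  | empty =>
    have e : ∀ j, _root_.partialDeriv b j (fun _ => (0 : ℝ)) = fun _ => 0 := fun j => by
      funext z; simp [_root_.partialDeriv]
    simp [laplacianCoord, e]
  | insert a s ha ih =>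
    simp only [Finset.sum_insert ha]
    rw [laplacianCoord_add b G (hF a (by simp)) (ContDiffAt.sum fun k hk => hF k (by simp [hk])),
      ih fun k hk => hF k (by simp [hk])]

/-- If the second derivative along a line were negative, the second derivative test would make the
minimum a maximum as well. The function would then be locally constant on the line, with vanishing
second derivative. -/
theorem IsLocalMin.fderiv_fderiv_nonneg {u : V → ℝ} {y : V} (hu : ContDiffAt ℝ ∞ u y)
    (hm : IsLocalMin u y) (v : V) : 0 ≤ fderiv ℝ (fderiv ℝ u) y v v := by
  by_contra! hneg
  have hd : HasFDerivAt (fderiv ℝ u) (fderiv ℝ (fderiv ℝ u) y) y :=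
    ((hu.fderiv_right (m := ∞) (by simp)).differentiableAt (by simp)).hasFDerivAt
  set γ : ℝ → V := fun t => y + t • v with hγ
  have hγd : ∀ t, HasDerivAt γ v t := fun t => by
    have := ((hasDerivAt_id t).smul_const v).const_add y
    rwa [one_smul] at this
  have hγ0 : γ 0 = y := by simp [hγ]
  have hγc : Tendsto γ (𝓝 0) (𝓝 y) := by
    have := (hγd 0).continuousAt
    rwa [ContinuousAt, hγ0] at this
  have h1 : ∀ᶠ t in 𝓝 (0 : ℝ), HasDerivAt (fun t => u (γ t)) (fderiv ℝ u (γ t) v) t := by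
    filter_upwards [hγc.eventually hu.eventually_differentiableAt] with t ht
    exact ht.hasFDerivAt.comp_hasDerivAt t (hγd t)
  have e1 : deriv (fun t => u (γ t)) =ᶠ[𝓝 0] fun t => fderiv ℝ u (γ t) v :=
    h1.mono fun t ht => ht.deriv
  have h2 : HasDerivAt (fun t => fderiv ℝ u (γ t) v) (fderiv ℝ (fderiv ℝ u) y v v) 0 := by
    have hd0 : HasFDerivAt (fderiv ℝ u) (fderiv ℝ (fderiv ℝ u) y) (γ 0) := by rwa [hγ0]
    have := (hd0.comp_hasDerivAt (0 : ℝ) (hγd 0)).clm_apply (hasDerivAt_const (0 : ℝ) v)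
    simpa using this
  have h3 : deriv (deriv fun t => u (γ t)) 0 = fderiv ℝ (fderiv ℝ u) y v v := by
    rw [e1.deriv_eq, h2.deriv]
  have hmin : IsLocalMin (fun t => u (γ t)) 0 := by
    have := hγc.eventually hm
    simpa [IsLocalMin, IsMinFilter, hγ0] using this
  have hmax : IsLocalMax (fun t => u (γ t)) 0 :=
    isLocalMax_of_deriv_deriv_neg (by rw [h3]; exact hneg) hmin.deriv_eq_zero
      h1.self_of_nhds.continuousAt
  have hc : (fun t => u (γ t)) =ᶠ[𝓝 0] fun _ => u (γ 0) := by
    filter_upwards [hmin, hmax] with t h1 h2 using le_antisymm h2 h1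
  rw [← h3, hc.deriv.deriv_eq] at hneg
  simp at hneg

/-- The Laplacian, with the nonnegative sign convention, is nonpositive at a local minimum. -/
theorem IsLocalMin.laplacianCoord_nonpos (G : V → Matrix ι ι ℝ) {u : V → ℝ} {y : V}
    (hu : ContDiffAt ℝ ∞ u y) (hm : IsLocalMin u y) (hG : ((G y)⁻¹).PosSemidef) :
    laplacianCoord b G u y ≤ 0 := by
  have h0 : ∀ k, _root_.partialDeriv b k u y = 0 := fun k => by
    rw [_root_.partialDeriv, hm.fderiv_eq_zero]; simp
  have hd : DifferentiableAt ℝ (fderiv ℝ u) y :=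
    (hu.fderiv_right (m := ∞) (by simp)).differentiableAt (by simp)
  have h2 : ∀ i j, _root_.partialDeriv b i (_root_.partialDeriv b j u) y =
      fderiv ℝ (fderiv ℝ u) y (b i) (b j) := fun i j => by
    change fderiv ℝ (fun z => fderiv ℝ u z (b j)) y (b i) = _
    rw [fderiv_clm_apply hd (by fun_prop)]
    simp
  -- A decomposition into rank one matrices writes the trace of the Hessian as a sum of second
  -- derivatives along single vectors.
  obtain ⟨m, B, hB⟩ := Matrix.posSemidef_iff_eq_sum_vecMulVec.1 hG
  have hBij : ∀ i j, (G y)⁻¹ i j = ∑ c, B c i * B c j := fun i j => by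
    rw [hB, Matrix.sum_apply]; simp [Matrix.vecMulVec_apply]
  simp only [laplacianCoord, h0, h2, mul_zero, Finset.sum_const_zero, sub_zero, hBij]
  rw [neg_nonpos]
  have e : ∑ i, ∑ j, (∑ c, B c i * B c j) * fderiv ℝ (fderiv ℝ u) y (b i) (b j) =
      ∑ c, fderiv ℝ (fderiv ℝ u) y (∑ i, B c i • b i) (∑ i, B c i • b i) := by
    simp only [map_sum, map_smul, sum_apply, smul_apply, smul_eq_mul, Finset.sum_mul,
      Finset.mul_sum]
    rw [Finset.sum_congr rfl fun i _ => Finset.sum_comm, Finset.sum_comm]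
    refine Finset.sum_congr rfl fun c _ => ?_
    rw [Finset.sum_comm]
    refine Finset.sum_congr rfl fun i _ => Finset.sum_congr rfl fun j _ => ?_
    ring
  rw [e]
  exact Finset.sum_nonneg fun c _ => hm.fderiv_fderiv_nonneg hu _

end CoordLaplacian

/-! ### The Laplacian of products of a function of y and a function of x. -/

section Product

variable {n : ℕ}

theorem partialDeriv_collar_inl_mul {φ : EuclideanSpace ℝ (Fin n) → ℝ} {ψ : ℝ → ℝ}
    {q : EuclideanSpace ℝ (Fin n) × ℝ} (hφ : DifferentiableAt ℝ φ q.1)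
    (hψ : DifferentiableAt ℝ ψ q.2) (i : Fin n) :
    partialDeriv (collarBasis n) (Sum.inl i) (fun z => φ z.1 * ψ z.2) q =
      partialDeriv (stdBasis n) i φ q.1 * ψ q.2 := by
  have h1 : HasFDerivAt (fun z : EuclideanSpace ℝ (Fin n) × ℝ => φ z.1) _ q :=
    hφ.hasFDerivAt.comp q (hasFDerivAt_fst (𝕜 := ℝ))
  have h2 : HasFDerivAt (fun z : EuclideanSpace ℝ (Fin n) × ℝ => ψ z.2) _ q :=
    hψ.hasFDerivAt.comp q (hasFDerivAt_snd (𝕜 := ℝ))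
  rw [partialDeriv, (h1.fun_mul h2).fderiv, Module.Basis.prod_apply]
  simp [partialDeriv]
  ring

theorem partialDeriv_collar_inr_mul {φ : EuclideanSpace ℝ (Fin n) → ℝ} {ψ : ℝ → ℝ}
    {q : EuclideanSpace ℝ (Fin n) × ℝ} (hφ : DifferentiableAt ℝ φ q.1)
    (hψ : DifferentiableAt ℝ ψ q.2) (u : Unit) :
    partialDeriv (collarBasis n) (Sum.inr u) (fun z => φ z.1 * ψ z.2) q =
      φ q.1 * deriv ψ q.2 := by
  have h1 : HasFDerivAt (fun z : EuclideanSpace ℝ (Fin n) × ℝ => φ z.1) _ q :=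
    hφ.hasFDerivAt.comp q (hasFDerivAt_fst (𝕜 := ℝ))
  have h2 : HasFDerivAt (fun z : EuclideanSpace ℝ (Fin n) × ℝ => ψ z.2) _ q :=
    hψ.hasFDerivAt.comp q (hasFDerivAt_snd (𝕜 := ℝ))
  rw [partialDeriv, (h1.fun_mul h2).fderiv, Module.Basis.prod_apply]
  simp

/-- The trace of the Hessian of `φ` for the slice metrics. -/
noncomputable def sliceLaplacian (K : EuclideanSpace ℝ (Fin n) × ℝ → Matrix (Fin n) (Fin n) ℝ)
    (φ : EuclideanSpace ℝ (Fin n) → ℝ) : EuclideanSpace ℝ (Fin n) × ℝ → ℝ :=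
  fun q => ∑ i, ∑ j, (K q)⁻¹ i j *
    (partialDeriv (stdBasis n) i (partialDeriv (stdBasis n) j φ) q.1
      - ∑ k, sliceChristoffel K k i j q * partialDeriv (stdBasis n) k φ q.1)

namespace IsMetricFamily

variable {S : Set (EuclideanSpace ℝ (Fin n))} {ε : ℝ}
  {K : EuclideanSpace ℝ (Fin n) × ℝ → Matrix (Fin n) (Fin n) ℝ}
  {q : EuclideanSpace ℝ (Fin n) × ℝ}

theorem smooth_sliceChristoffel (h : IsMetricFamily S ε K) (k i j : Fin n) :
    SmoothUpTo S ε (sliceChristoffel K k i j) := by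
  have hd : ∀ a i j, SmoothUpTo S ε (tangDeriv a fun z => K z i j) := fun a i j =>
    (h.smooth i j).halfDeriv h.isOpen _
  exact ((SmoothUpTo.const (1 / 2)).mul (SmoothUpTo.sum (s := Finset.univ) fun l _ =>
    (h.smooth_inv k l).mul (((hd i j l).add (hd j i l)).sub (hd l i j)))).congr fun q _ => by
      simp [sliceChristoffel]

theorem smooth_sliceLaplacian (h : IsMetricFamily S ε K) {φ : EuclideanSpace ℝ (Fin n) → ℝ}
    (hφ : ContDiffOn ℝ ∞ φ S) : SmoothUpTo S ε (sliceLaplacian K φ) := by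
  have h1 := fun k => ContDiffOn.partialDeriv h.isOpen hφ (stdBasis n) k
  have h2 := fun i j => ContDiffOn.partialDeriv h.isOpen (h1 j) (stdBasis n) i
  exact (SmoothUpTo.sum (s := Finset.univ) fun i _ => SmoothUpTo.sum (s := Finset.univ) fun j _ =>
    (h.smooth_inv i j).mul ((SmoothUpTo.of_fst (h2 i j)).sub
      (SmoothUpTo.sum (s := Finset.univ) fun k _ =>
        (h.smooth_sliceChristoffel k i j).mul (SmoothUpTo.of_fst (h1 k))))).congr fun q _ => by
      simp [sliceLaplacian]

theorem contDiffAt_mul (h : IsMetricFamily S ε K) {φ : EuclideanSpace ℝ (Fin n) → ℝ} {ψ : ℝ → ℝ}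
    (hφ : ContDiffOn ℝ ∞ φ S) (hψ : ContDiffOn ℝ ∞ ψ (Ioi 0)) (hq : q ∈ S ×ˢ Ioo 0 ε) :
    ContDiffAt ℝ ∞ (fun z : EuclideanSpace ℝ (Fin n) × ℝ => φ z.1 * ψ z.2) q :=
  ((hφ.contDiffAt (h.isOpen.mem_nhds hq.1)).comp q contDiffAt_fst).mul
    ((hψ.contDiffAt (Ioi_mem_nhds hq.2.1)).comp q contDiffAt_snd)

theorem laplacianCoord_mul (h : IsMetricFamily S ε K) {φ : EuclideanSpace ℝ (Fin n) → ℝ}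
    {ψ : ℝ → ℝ} (hφ : ContDiffOn ℝ ∞ φ S) (hψ : ContDiffOn ℝ ∞ ψ (Ioi 0))
    (hq : q ∈ S ×ˢ Ioo 0 ε) :
    laplacianCoord (collarBasis n) (collarMatrix K) (fun z => φ z.1 * ψ z.2) q =
      -(φ q.1 * (q.2 ^ 2 * deriv (deriv ψ) q.2 + (1 - n) * (q.2 * deriv ψ q.2)
          + 1 / 2 * (q.2 ^ 2 * (traceDeriv K q * deriv ψ q.2)))
        + q.2 ^ 2 * ψ q.2 * sliceLaplacian K φ q) := by
  have hφd : ∀ y ∈ S, DifferentiableAt ℝ φ y := fun y hy =>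
    (hφ.contDiffAt (h.isOpen.mem_nhds hy)).differentiableAt (by simp)
  have hψd : ∀ x ∈ Ioi (0 : ℝ), DifferentiableAt ℝ ψ x := fun x hx =>
    (hψ.contDiffAt (Ioi_mem_nhds hx)).differentiableAt (by simp)
  have hφ1 : ∀ j, ∀ y ∈ S, DifferentiableAt ℝ (partialDeriv (stdBasis n) j φ) y := fun j y hy =>
    ((ContDiffOn.partialDeriv h.isOpen hφ (stdBasis n) j).contDiffAt
      (h.isOpen.mem_nhds hy)).differentiableAt (by simp)
  have hψ1 : ∀ x ∈ Ioi (0 : ℝ), DifferentiableAt ℝ (deriv ψ) x := fun x hx =>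
    ((hψ.deriv_of_isOpen (m := ∞) isOpen_Ioi (by simp)).contDiffAt
      (Ioi_mem_nhds hx)).differentiableAt (by simp)
  have e1 : ∀ j, partialDeriv (collarBasis n) (Sum.inl j) (fun z => φ z.1 * ψ z.2) =ᶠ[𝓝 q]
      fun z => partialDeriv (stdBasis n) j φ z.1 * ψ z.2 := fun j =>
    (h.eventually_mem hq).mono fun z hz =>
      partialDeriv_collar_inl_mul (hφd _ hz.1) (hψd _ hz.2.1) j
  have e2 : partialDeriv (collarBasis n) (Sum.inr ()) (fun z => φ z.1 * ψ z.2) =ᶠ[𝓝 q]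
      fun z => φ z.1 * deriv ψ z.2 :=
    (h.eventually_mem hq).mono fun z hz =>
      partialDeriv_collar_inr_mul (hφd _ hz.1) (hψd _ hz.2.1) ()
  rw [h.laplacianCoord_collarMatrix hq]
  simp only [(e1 _).partialDeriv_eq, e2.partialDeriv_eq, (e1 _).eq_of_nhds, e2.eq_of_nhds,
    partialDeriv_collar_inl_mul (hφ1 _ _ hq.1) (hψd _ hq.2.1),
    partialDeriv_collar_inr_mul (hφd _ hq.1) (hψ1 _ hq.2.1)]
  have e3 : ∑ i, ∑ j, (K q)⁻¹ i j * (partialDeriv (stdBasis n) i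
        (partialDeriv (stdBasis n) j φ) q.1 * ψ q.2
      - ∑ k, sliceChristoffel K k i j q * (partialDeriv (stdBasis n) k φ q.1 * ψ q.2)) =
      ψ q.2 * sliceLaplacian K φ q := by
    simp only [sliceLaplacian, Finset.mul_sum]
    refine Finset.sum_congr rfl fun i _ => Finset.sum_congr rfl fun j _ => ?_
    simp only [← mul_assoc, ← Finset.sum_mul]
    ring
  rw [e3]
  ring

/-- The indicial polynomial `s(s-n)` appears here. Real exponents are allowed because the barriers
use half-integral powers. -/
theorem laplacianCoord_mul_rpow (h : IsMetricFamily S ε K) {φ : EuclideanSpace ℝ (Fin n) → ℝ}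
    (hφ : ContDiffOn ℝ ∞ φ S) (s : ℝ) (hq : q ∈ S ×ˢ Ioo 0 ε) :
    laplacianCoord (collarBasis n) (collarMatrix K) (fun z => φ z.1 * z.2 ^ s) q =
      -(q.2 ^ s * (φ q.1 * (s * (s - n) + 1 / 2 * (s * (q.2 * traceDeriv K q)))
        + q.2 ^ 2 * sliceLaplacian K φ q)) := by
  have hx := hq.2.1
  have hψ : ContDiffOn ℝ ∞ (fun x : ℝ => x ^ s) (Ioi 0) := fun x hx =>
    (Real.contDiffAt_rpow_const_of_ne (ne_of_gt hx)).contDiffWithinAt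
  have d1 : ∀ (s : ℝ), ∀ x ∈ Ioi (0 : ℝ), deriv (fun x : ℝ => x ^ s) x = s * x ^ (s - 1) :=
    fun s x hx => (Real.hasDerivAt_rpow_const (Or.inl (ne_of_gt hx))).deriv
  have d2 : deriv (deriv fun x : ℝ => x ^ s) q.2 = s * ((s - 1) * q.2 ^ (s - 1 - 1)) := by
    have e : deriv (fun x : ℝ => x ^ s) =ᶠ[𝓝 q.2] fun x => s * x ^ (s - 1) :=
      (Ioi_mem_nhds hx : Ioi 0 ∈ 𝓝 q.2) |> fun h => Filter.mem_of_superset h (d1 s)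
    rw [e.deriv_eq, deriv_const_mul_field, d1 _ _ hx]
  have p1 : q.2 * q.2 ^ (s - 1) = q.2 ^ s := by
    rw [Real.rpow_sub_one hx.ne']; field_simp
  have p2 : q.2 ^ 2 * q.2 ^ (s - 1 - 1) = q.2 ^ s := by
    rw [Real.rpow_sub_one hx.ne', Real.rpow_sub_one hx.ne']; field_simp
  rw [h.laplacianCoord_mul hφ hψ hq, d2, d1 _ _ hx]
  linear_combination (-(φ q.1) * s * (s - 1)) * p2 + (-(φ q.1) * (1 - n) * s
    - 1 / 2 * φ q.1 * q.2 * traceDeriv K q * s) * p1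

theorem posSemidef_inv (h : IsMetricFamily S ε K) (hq : q ∈ S ×ˢ Ioo 0 ε) :
    ((collarMatrix K q)⁻¹).PosSemidef := by
  have hK := h.posDef q ⟨hq.1, Ioo_subset_Ico_self hq.2⟩
  rw [h.inv_collarMatrix hq]
  refine Matrix.PosSemidef.smul ?_ (by positivity)
  have : Invertible (K q)⁻¹ := hK.inv.isUnit.invertible
  -- Schur complement criterion with vanishing off-diagonal block.
  have h0 := (Matrix.PosDef.fromBlocks₁₁ (0 : Matrix (Fin n) Unit ℝ) (1 : Matrix Unit Unit ℝ)
    hK.inv).2 (by simpa using Matrix.PosSemidef.one)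
  simpa using h0

end IsMetricFamily

end Product

/-! ### Locally uniform asymptotics at the boundary. -/

section BoundaryAsymptotics

variable {Y : Type*} [TopologicalSpace Y] {S : Set Y} {f f' : Y × ℝ → ℝ} {w w' : ℝ → ℝ}

theorem eventually_principal_prod_nhdsGT_iff {K : Set Y} {P : Y × ℝ → Prop} :
    (∀ᶠ q in 𝓟 K ×ˢ 𝓝[>] (0 : ℝ), P q) ↔ ∃ δ > 0, ∀ y ∈ K, ∀ x ∈ Ioo 0 δ, P (y, x) := by
  rw [eventually_prod_iff]
  constructor
  · rintro ⟨pa, ha, pb, hb, h⟩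
    obtain ⟨δ, hδ, hsub⟩ := mem_nhdsGT_iff_exists_Ioo_subset.1 hb
    exact ⟨δ, hδ, fun y hy x hx => h (ha hy) (hsub hx)⟩
  · rintro ⟨δ, hδ, h⟩
    exact ⟨fun y => y ∈ K, mem_principal_self K, fun x => x ∈ Ioo 0 δ, Ioo_mem_nhdsGT hδ,
      fun hy _ hx => h _ hy _ hx⟩

theorem isBigOAtBoundary_iff : IsBigOAtBoundary S f w ↔ ∀ K ⊆ S, IsCompact K →
    ∃ C, 0 ≤ C ∧ ∃ δ > 0, ∀ y ∈ K, ∀ x ∈ Ioo 0 δ, |f (y, x)| ≤ C * |w x| := by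
  refine forall_congr' fun K => forall_congr' fun _ => forall_congr' fun _ => ?_
  rw [Asymptotics.isBigO_iff']
  constructor
  · rintro ⟨C, hC, h⟩
    exact ⟨C, hC.le, eventually_principal_prod_nhdsGT_iff.1 h⟩
  · rintro ⟨C, hC, δ, hδ, h⟩
    refine ⟨C + 1, by positivity, eventually_principal_prod_nhdsGT_iff.2 ⟨δ, hδ, fun y hy x hx => ?_⟩⟩
    refine (h y hy x hx).trans ?_
    simp only [Real.norm_eq_abs]
    gcongr
    linarith

namespace IsBigOAtBoundary

theorem trans (h : IsBigOAtBoundary S f w) (hw : w =O[𝓝[>] 0] w') : IsBigOAtBoundary S f w' :=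
  fun K hK hc => (h K hK hc).trans (hw.comp_tendsto tendsto_snd)

theorem mono {S' : Set Y} (h : IsBigOAtBoundary S f w) (hS : S' ⊆ S) : IsBigOAtBoundary S' f w :=
  fun K hK hc => h K (hK.trans hS) hc

theorem add (h : IsBigOAtBoundary S f w) (h' : IsBigOAtBoundary S f' w) :
    IsBigOAtBoundary S (fun q => f q + f' q) w := fun K hK hc => (h K hK hc).add (h' K hK hc)

theorem sub (h : IsBigOAtBoundary S f w) (h' : IsBigOAtBoundary S f' w) :
    IsBigOAtBoundary S (fun q => f q - f' q) w := fun K hK hc => (h K hK hc).sub (h' K hK hc)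

theorem mul {w₂ : ℝ → ℝ} (h : IsBigOAtBoundary S f w) (h' : IsBigOAtBoundary S f' w₂) :
    IsBigOAtBoundary S (fun q => f q * f' q) (fun x => w x * w₂ x) :=
  fun K hK hc => (h K hK hc).mul (h' K hK hc)

theorem of_snd (w : ℝ → ℝ) : IsBigOAtBoundary S (fun q => w q.2) w :=
  fun K hK hc => Asymptotics.isBigO_refl _ _

theorem congr' (h : IsBigOAtBoundary S f w) {ε : ℝ} (hε : 0 < ε)
    (e : ∀ q ∈ S ×ˢ Ioo 0 ε, f' q = f q) : IsBigOAtBoundary S f' w := fun K hK hc =>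
  (h K hK hc).congr' (eventually_principal_prod_nhdsGT_iff.2
    ⟨ε, hε, fun y hy x hx => (e (y, x) ⟨hK hy, hx⟩).symm⟩) EventuallyEq.rfl

theorem at_point (h : IsBigOAtBoundary S f w) {y : Y} (hy : y ∈ S) :
    (fun x => f (y, x)) =O[𝓝[>] 0] w := by
  have := h {y} (singleton_subset_iff.2 hy) isCompact_singleton
  have ht : Tendsto (fun x : ℝ => (y, x)) (𝓝[>] 0) (𝓟 {y} ×ˢ 𝓝[>] 0) :=
    (tendsto_principal.2 (by simp)).prodMk tendsto_id
  exact this.comp_tendsto ht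

end IsBigOAtBoundary

theorem SmoothUpTo.isBigOAtBoundary {V : Type*} [NormedAddCommGroup V] [NormedSpace ℝ V]
    {S : Set V} (hS : IsOpen S) {ε : ℝ} (hε : 0 < ε) {m : ℕ} {f : V × ℝ → ℝ}
    (hf : SmoothUpTo S ε f)
    (h : ∀ j < m, ∀ y ∈ S, PowerSeries.coeff j (bdrySeries f y) = 0) :
    IsBigOAtBoundary S f (fun x => x ^ m) := by
  rw [isBigOAtBoundary_iff]
  intro K hK hc
  obtain ⟨C, hC, hb⟩ := exists_bound_of_coeff_eq_zero hS hε (m := m) hf hK hc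
    (half_lt_self hε) (fun j hj y hy => h j hj y (hK hy))
  refine ⟨C, hC, ε / 2, half_pos hε, fun y hy x hx => ?_⟩
  rw [abs_of_nonneg (pow_nonneg hx.1.le m)]
  exact hb y hy x ⟨hx.1.le, hx.2.le⟩

theorem SmoothUpTo.isBigOAtBoundary_one {V : Type*} [NormedAddCommGroup V] [NormedSpace ℝ V]
    {S : Set V} (hS : IsOpen S) {ε : ℝ} (hε : 0 < ε) {f : V × ℝ → ℝ}
    (hf : SmoothUpTo S ε f) : IsBigOAtBoundary S f (fun _ => 1) := by
  simpa using hf.isBigOAtBoundary hS hε (m := 0) (by simp)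

theorem isBigO_rpow_rpow_nhdsGT {s t : ℝ} (h : t ≤ s) :
    (fun x : ℝ => x ^ s) =O[𝓝[>] 0] fun x => x ^ t := by
  refine Asymptotics.IsBigO.of_bound 1 ?_
  filter_upwards [Ioo_mem_nhdsGT (zero_lt_one' ℝ)] with x hx
  rw [one_mul, Real.norm_of_nonneg (Real.rpow_nonneg hx.1.le _),
    Real.norm_of_nonneg (Real.rpow_nonneg hx.1.le _)]
  exact Real.rpow_le_rpow_of_exponent_ge hx.1 hx.2.le h

theorem isBigO_pow_mul_log_rpow {m : ℕ} {t : ℝ} (h : t < m) :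
    (fun x : ℝ => x ^ m * Real.log x) =O[𝓝[>] 0] fun x => x ^ t := by
  have h1 : Real.log =O[𝓝[>] 0] fun x : ℝ => x ^ (t - m) :=
    (isLittleO_log_rpow_nhdsGT_zero (by linarith)).isBigO
  refine ((Asymptotics.isBigO_refl (fun x : ℝ => x ^ m) _).mul h1).congr' EventuallyEq.rfl ?_
  filter_upwards [self_mem_nhdsWithin] with x hx
  rw [← Real.rpow_natCast, ← Real.rpow_add hx]
  congr 1; ring

end BoundaryAsymptotics

/-! ### Comparison with a barrier on a half ball. -/

section Barrier

variable {n : ℕ} {S : Set (EuclideanSpace ℝ (Fin n))} {ε : ℝ}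
  {K : EuclideanSpace ℝ (Fin n) × ℝ → Matrix (Fin n) (Fin n) ℝ}

/-- Compare `W` with `Λ|y-p|²xˢ + μβ`. The first term dominates `W` on the lateral boundary and
vanishes over `p`, so it does not weaken the conclusion there. It spoils the Laplacian only by
`O(xˢ⁺¹)`, which `μβ` compensates for large `μ`. A negative value over `p` would force a negative
interior minimum at which the Laplacian is positive. -/
theorem IsMetricFamily.le_barrier (h : IsMetricFamily S ε K) {p : EuclideanSpace ℝ (Fin n)}
    {r δ s C₀ C₁ c : ℝ} (hr : 0 < r) (hball : Metric.closedBall p r ⊆ S) (hδ : 0 < δ) (hδε : δ < ε)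
    (hs : 0 < s) (hsn : s < n) {W : EuclideanSpace ℝ (Fin n) × ℝ → ℝ}
    (hW : ContDiffOn ℝ ∞ W (S ×ˢ Ioo 0 ε)) (hC₀ : 0 ≤ C₀)
    (hW₀ : ∀ y ∈ Metric.closedBall p r, ∀ x ∈ Ioc 0 δ, |W (y, x)| ≤ C₀ * x ^ s)
    (hW₁ : ∀ y ∈ Metric.closedBall p r, ∀ x ∈ Ioc 0 δ,
      laplacianCoord (collarBasis n) (collarMatrix K) W (y, x) ≤ C₁ * x ^ (s + 1))
    {β : ℝ → ℝ} (hβ : ContDiffOn ℝ ∞ β (Ioi 0)) (hβ₀ : ∀ x ∈ Ioc 0 δ, 0 < β x) (hc : 0 < c)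
    (hβ₁ : ∀ y ∈ Metric.closedBall p r, ∀ x ∈ Ioc 0 δ, c * x ^ (s + 1) ≤
      laplacianCoord (collarBasis n) (collarMatrix K) (fun z => 1 * β z.2) (y, x)) :
    ∃ μ, ∀ x ∈ Ioc 0 δ, W (p, x) ≤ μ * β x := by
  have hδm : δ ∈ Ioc 0 δ := ⟨hδ, le_rfl⟩
  set φ : EuclideanSpace ℝ (Fin n) → ℝ := fun y => ‖y - p‖ ^ 2 with hφdef
  have hφ : ContDiff ℝ ∞ φ := (contDiff_id.sub contDiff_const).norm_sq ℝ
  have hxm : ∀ {y x}, y ∈ Metric.closedBall p r → x ∈ Ioc 0 δ → (y, x) ∈ S ×ˢ Ioo 0 ε :=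
    fun hy hx => ⟨hball hy, hx.1, hx.2.trans_lt hδε⟩
  have hKc : IsCompact (Metric.closedBall p r) := isCompact_closedBall p r
  have hε : 0 < ε := hδ.trans hδε
  obtain ⟨T, hT0, hT⟩ := exists_bound_of_coeff_eq_zero h.isOpen hε (m := 0) h.smooth_traceDeriv
    hball hKc hδε (by simp)
  obtain ⟨L, hL0, hL⟩ := exists_bound_of_coeff_eq_zero h.isOpen hε (m := 0)
    (h.smooth_sliceLaplacian hφ.contDiffOn) hball hKc hδε (by simp)
  simp only [pow_zero, mul_one] at hT hL
  -- Only errors of order `xˢ⁺¹` enter `D`: the main term `s(n-s)|y-p|²xˢ` of the Laplacian is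
  -- nonnegative for `0 < s < n` and is dropped.
  set D := 1 / 2 * s * T * r ^ 2 + δ * L with hD
  have hlapφ : ∀ y ∈ Metric.closedBall p r, ∀ x ∈ Ioc 0 δ, -D * x ^ (s + 1) ≤
      laplacianCoord (collarBasis n) (collarMatrix K) (fun z => φ z.1 * z.2 ^ s) (y, x) := by
    intro y hy x hx
    rw [h.laplacianCoord_mul_rpow hφ.contDiffOn s (hxm hy hx), Real.rpow_add hx.1, Real.rpow_one]
    have hxI : x ∈ Icc 0 δ := ⟨hx.1.le, hx.2⟩
    have h1 := abs_le.1 (hT y hy x hxI)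
    have h2 := abs_le.1 (hL y hy x hxI)
    have hφ0 : 0 ≤ φ y := by positivity
    have hφ1 : φ y ≤ r ^ 2 := by
      have : ‖y - p‖ ≤ r := by simpa [dist_eq_norm] using hy
      exact pow_le_pow_left₀ (norm_nonneg _) this 2
    have hxs : 0 ≤ x ^ s := Real.rpow_nonneg hx.1.le s
    have hx0 := hx.1
    have k1 : φ y * traceDeriv K (y, x) ≤ r ^ 2 * T :=
      (mul_le_mul_of_nonneg_left h1.2 hφ0).trans (mul_le_mul_of_nonneg_right hφ1 hT0)
    have k2 : x * sliceLaplacian K φ (y, x) ≤ δ * L :=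
      (mul_le_mul_of_nonneg_left h2.2 hx0.le).trans (mul_le_mul_of_nonneg_right hx.2 hL0)
    have k3 : φ y * (s * (s - n)) ≤ 0 :=
      mul_nonpos_of_nonneg_of_nonpos hφ0 (mul_nonpos_of_nonneg_of_nonpos hs.le (by linarith))
    have k4 : φ y * (s * (s - n) + 1 / 2 * (s * (x * traceDeriv K (y, x))))
        + x ^ 2 * sliceLaplacian K φ (y, x) ≤ D * x := by
      have e : φ y * (s * (s - n) + 1 / 2 * (s * (x * traceDeriv K (y, x))))
        + x ^ 2 * sliceLaplacian K φ (y, x) = φ y * (s * (s - n))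
          + x * (1 / 2 * s * (φ y * traceDeriv K (y, x)) + x * sliceLaplacian K φ (y, x)) := by ring
      rw [e]
      have : 1 / 2 * s * (φ y * traceDeriv K (y, x)) + x * sliceLaplacian K φ (y, x) ≤ D := by
        have := mul_le_mul_of_nonneg_left k1 (by positivity : 0 ≤ 1 / 2 * s)
        rw [hD]; linarith
      nlinarith [mul_le_mul_of_nonneg_left this hx0.le]
    have := mul_le_mul_of_nonneg_left k4 hxs
    simp only
    linarith
  -- This makes the first term equal to `C₀ xˢ` on the sphere of radius `r`.
  set Λ := C₀ / r ^ 2 with hΛ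
  have hΛ0 : 0 ≤ Λ := by positivity
  -- The strict inequality makes the Laplacian of the difference positive; the last one gives
  -- domination on the face `x = δ`.
  obtain ⟨μ, hμ0, hμ1, hμ2⟩ : ∃ μ, 0 ≤ μ ∧ C₁ + Λ * D < μ * c ∧ C₀ * δ ^ s ≤ μ * β δ := by
    refine ⟨max 0 (max ((C₁ + Λ * D) / c + 1) (C₀ * δ ^ s / β δ)), le_max_left _ _, ?_, ?_⟩
    · have : (C₁ + Λ * D) / c + 1 ≤ max 0 (max ((C₁ + Λ * D) / c + 1) (C₀ * δ ^ s / β δ)) :=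
        (le_max_left _ _).trans (le_max_right _ _)
      have h2 := mul_le_mul_of_nonneg_right this hc.le
      have h3 : ((C₁ + Λ * D) / c + 1) * c = C₁ + Λ * D + c := by field_simp
      linarith
    · rw [← div_le_iff₀ (hβ₀ δ hδm)]
      exact (le_max_right _ _).trans (le_max_right _ _)
  refine ⟨μ, fun x₀ hx₀ => ?_⟩
  by_contra! hlt
  set u : EuclideanSpace ℝ (Fin n) × ℝ → ℝ :=
    fun z => (Λ * (φ z.1 * z.2 ^ s) + μ * (1 * β z.2)) - W z with hu
  have hrpow : ContDiffOn ℝ ∞ (fun x : ℝ => x ^ s) (Ioi 0) := fun x hx =>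
    (Real.contDiffAt_rpow_const_of_ne (ne_of_gt hx)).contDiffWithinAt
  have hWat : ∀ {q}, q ∈ S ×ˢ Ioo 0 ε → ContDiffAt ℝ ∞ W q := fun hq =>
    hW.contDiffAt ((h.isOpen.prod isOpen_Ioo).mem_nhds hq)
  have s1 : ∀ {q}, q ∈ S ×ˢ Ioo 0 ε → ContDiffAt ℝ ∞
      (fun z : EuclideanSpace ℝ (Fin n) × ℝ => φ z.1 * z.2 ^ s) q := fun hq =>
    h.contDiffAt_mul hφ.contDiffOn hrpow hq
  have s2 : ∀ {q}, q ∈ S ×ˢ Ioo 0 ε → ContDiffAt ℝ ∞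
      (fun z : EuclideanSpace ℝ (Fin n) × ℝ => 1 * β z.2) q := fun hq =>
    h.contDiffAt_mul contDiffOn_const hβ hq
  have s3 : ∀ {q}, q ∈ S ×ˢ Ioo 0 ε → ContDiffAt ℝ ∞
      (fun z : EuclideanSpace ℝ (Fin n) × ℝ => Λ * (φ z.1 * z.2 ^ s) + μ * (1 * β z.2)) q :=
    fun hq => (contDiffAt_const.mul (s1 hq)).add (contDiffAt_const.mul (s2 hq))
  have hus : ∀ {q}, q ∈ S ×ˢ Ioo 0 ε → ContDiffAt ℝ ∞ u q := fun hq => (s3 hq).sub (hWat hq)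
  have hulap : ∀ y ∈ Metric.closedBall p r, ∀ x ∈ Ioc 0 δ,
      0 < laplacianCoord (collarBasis n) (collarMatrix K) u (y, x) := by
    intro y hy x hx
    have hq := hxm hy hx
    rw [hu, laplacianCoord_sub _ _ (s3 hq) (hWat hq),
      laplacianCoord_add _ _ (contDiffAt_const.mul (s1 hq)) (contDiffAt_const.mul (s2 hq)),
      laplacianCoord_const_mul _ _ _ (s1 hq), laplacianCoord_const_mul _ _ _ (s2 hq)]
    have k1 := mul_le_mul_of_nonneg_left (hlapφ y hy x hx) hΛ0
    have k2 := mul_le_mul_of_nonneg_left (hβ₁ y hy x hx) hμ0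
    have k3 := hW₁ y hy x hx
    have k4 : 0 < x ^ (s + 1) := Real.rpow_pos_of_pos hx.1 _
    have k5 := mul_lt_mul_of_pos_right hμ1 k4
    nlinarith
  have hpb : p ∈ Metric.closedBall p r := Metric.mem_closedBall_self hr.le
  have hu0 : u (p, x₀) < 0 := by
    simp only [hu, hφdef, sub_self, norm_zero]
    norm_num
    linarith
  -- The barrier need not dominate `W` on a lower face. There `W` is so small that the difference
  -- stays above its negative value over `p`, so the minimum is not attained on that face.
  obtain ⟨δ', hδ'0, hδ'x, hδ'⟩ : ∃ δ', 0 < δ' ∧ δ' < x₀ ∧ C₀ * δ' ^ s < -u (p, x₀) := by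
    have ht : Tendsto (fun x : ℝ => C₀ * x ^ s) (𝓝[>] 0) (𝓝 0) := by
      have := ((Real.continuousAt_rpow_const 0 s (Or.inr hs.le)).tendsto.const_mul C₀).mono_left
        (nhdsWithin_le_nhds (s := Ioi (0 : ℝ)))
      simpa [Real.zero_rpow hs.ne'] using this
    have := (ht.eventually (gt_mem_nhds (neg_pos.2 hu0))).and (Ioo_mem_nhdsGT hx₀.1)
    obtain ⟨x, hx1, hx2⟩ := this.exists
    exact ⟨x, hx2.1, hx2.2, hx1⟩
  have hδ'δ : δ' ≤ δ := hδ'x.le.trans hx₀.2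
  obtain ⟨⟨y₁, x₁⟩, hz, hmin⟩ := (hKc.prod (isCompact_Icc (a := δ') (b := δ))).exists_isMinOn
    ⟨(p, x₀), hpb, hδ'x.le, hx₀.2⟩ (fun q hq => (hus (hxm hq.1
      ⟨hδ'0.trans_le hq.2.1, hq.2.2⟩)).continuousAt.continuousWithinAt : ContinuousOn u _)
  have hle : u (y₁, x₁) ≤ u (p, x₀) := hmin ⟨hpb, hδ'x.le, hx₀.2⟩
  obtain ⟨hy₁, hx₁⟩ := hz
  simp only at hy₁ hx₁
  have hx₁' : x₁ ∈ Ioc 0 δ := ⟨hδ'0.trans_le hx₁.1, hx₁.2⟩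
  have hxs : 0 ≤ x₁ ^ s := Real.rpow_nonneg hx₁'.1.le s
  have hWz := abs_le.1 (hW₀ y₁ hy₁ x₁ hx₁')
  have hβz := mul_nonneg hμ0 (hβ₀ x₁ hx₁').le
  have hφz : 0 ≤ Λ * (φ y₁ * x₁ ^ s) := by positivity
  have hune : u (y₁, x₁) < 0 := hle.trans_lt hu0
  have huz : u (y₁, x₁) = (Λ * (φ y₁ * x₁ ^ s) + μ * (1 * β x₁)) - W (y₁, x₁) := rfl
  have b1 : y₁ ∈ Metric.ball p r := by
    rcases (Metric.mem_closedBall.1 hy₁).lt_or_eq with hlt' | heq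
    · exact hlt'
    · exfalso
      have : φ y₁ = r ^ 2 := by rw [hφdef]; simp only [← dist_eq_norm, heq]
      have : Λ * (φ y₁ * x₁ ^ s) = C₀ * x₁ ^ s := by rw [this, hΛ]; field_simp
      linarith
  have b2 : x₁ < δ := by
    refine lt_of_le_of_ne hx₁.2 fun heq => ?_
    rw [heq] at hWz huz hφz hune
    linarith
  have b3 : δ' < x₁ := by
    refine lt_of_le_of_ne hx₁.1 fun heq => ?_
    rw [← heq] at hWz huz hφz hune hle hβz
    linarith
  have hloc : IsLocalMin u (y₁, x₁) :=
    hmin.isLocalMin (prod_mem_nhds (mem_of_superset (Metric.isOpen_ball.mem_nhds b1)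
      Metric.ball_subset_closedBall) (Icc_mem_nhds b3 b2))
  exact absurd (IsLocalMin.laplacianCoord_nonpos (collarBasis n) (collarMatrix K)
    (hus (hxm hy₁ hx₁')) hloc (h.posSemidef_inv (hxm hy₁ hx₁'))) (not_le.2 (hulap y₁ hy₁ x₁ hx₁'))

end Barrier

/-! ### Improvement of decay and vanishing of the difference of two solutions. -/

section Decay

variable {n : ℕ} {S : Set (EuclideanSpace ℝ (Fin n))} {ε : ℝ}
  {K : EuclideanSpace ℝ (Fin n) × ℝ → Matrix (Fin n) (Fin n) ℝ}
  {W : EuclideanSpace ℝ (Fin n) × ℝ → ℝ} {p : EuclideanSpace ℝ (Fin n)} {s : ℝ}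

theorem sliceLaplacian_const (c : ℝ) (q : EuclideanSpace ℝ (Fin n) × ℝ) :
    sliceLaplacian K (fun _ => c) q = 0 := by
  have e : ∀ j (c : ℝ), partialDeriv (stdBasis n) j (fun _ => c) = fun _ => 0 := fun j c => by
    funext z; simp [partialDeriv]
  simp [sliceLaplacian, e]

theorem eventually_mem_collar {Y : Type*} {S B : Set Y} (hB : B ⊆ S) {ε : ℝ} (hε : 0 < ε) :
    ∀ᶠ q in 𝓟 B ×ˢ 𝓝[>] (0 : ℝ), q ∈ S ×ˢ Ioo 0 ε :=
  prod_mem_prod hB (Ioo_mem_nhdsGT hε)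

theorem contDiffOn_rpow_Ioi (s : ℝ) : ContDiffOn ℝ ∞ (fun x : ℝ => x ^ s) (Ioi 0) := fun x hx =>
  (Real.contDiffAt_rpow_const_of_ne (ne_of_gt hx)).contDiffWithinAt

namespace IsMetricFamily

/-- Comparison for `W` and for `-W` on a ball about `p`, with `δ` below all thresholds. The bound
over a single point suffices: it is used only to kill Taylor coefficients at `p`, and locally
uniform bounds are recovered from those by smoothness. -/
theorem isBigO_barrier (h : IsMetricFamily S ε K) (hε : 0 < ε) (hs : 0 < s) (hsn : s < n)
    (hW : ContDiffOn ℝ ∞ W (S ×ˢ Ioo 0 ε)) (hW₀ : IsBigOAtBoundary S W fun x => x ^ s)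
    (hW₁ : IsBigOAtBoundary S (laplacianCoord (collarBasis n) (collarMatrix K) W)
      fun x => x ^ (s + 1)) (hp : p ∈ S)
    {β : ℝ → ℝ} (hβ : ContDiffOn ℝ ∞ β (Ioi 0)) (hβ₀ : ∀ᶠ x in 𝓝[>] (0 : ℝ), 0 < β x) {c : ℝ}
    (hc : 0 < c) (hβ₁ : ∀ B ⊆ S, IsCompact B → ∀ᶠ q in 𝓟 B ×ˢ 𝓝[>] (0 : ℝ), c * q.2 ^ (s + 1) ≤
      laplacianCoord (collarBasis n) (collarMatrix K) (fun z => 1 * β z.2) q) :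
    (fun x => W (p, x)) =O[𝓝[>] 0] β := by
  obtain ⟨r, hr, hball⟩ := Metric.nhds_basis_closedBall.mem_iff.1 (h.isOpen.mem_nhds hp)
  have hB := isCompact_closedBall p r
  obtain ⟨C₀, hC₀, δ₀, hδ₀, hb₀⟩ := isBigOAtBoundary_iff.1 hW₀ _ hball hB
  obtain ⟨C₁, hC₁, δ₁, hδ₁, hb₁⟩ := isBigOAtBoundary_iff.1 hW₁ _ hball hB
  obtain ⟨δ₂, hδ₂, hb₂⟩ := eventually_principal_prod_nhdsGT_iff.1 (hβ₁ _ hball hB)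
  obtain ⟨δ₃, hδ₃, hb₃⟩ := mem_nhdsGT_iff_exists_Ioo_subset.1 hβ₀
  obtain ⟨δ, hδ, hlt⟩ := exists_between (show 0 < min (min δ₀ δ₁) (min (min δ₂ δ₃) ε) by
    simp only [lt_min_iff]; exact ⟨⟨hδ₀, hδ₁⟩, ⟨hδ₂, hδ₃⟩, hε⟩)
  simp only [lt_min_iff] at hlt
  obtain ⟨⟨l0, l1⟩, ⟨l2, l3⟩, l4⟩ := hlt
  have hrp : ∀ {x t : ℝ}, x ∈ Ioc 0 δ → |x ^ t| = x ^ t := fun hx =>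
    abs_of_nonneg (Real.rpow_nonneg hx.1.le _)
  have k0 : ∀ y ∈ Metric.closedBall p r, ∀ x ∈ Ioc 0 δ, |W (y, x)| ≤ C₀ * x ^ s :=
    fun y hy x hx => by
      have := hb₀ y hy x ⟨hx.1, hx.2.trans_lt l0⟩
      rwa [hrp hx] at this
  have k1 : ∀ y ∈ Metric.closedBall p r, ∀ x ∈ Ioc 0 δ,
      |laplacianCoord (collarBasis n) (collarMatrix K) W (y, x)| ≤ C₁ * x ^ (s + 1) :=
    fun y hy x hx => by
      have := hb₁ y hy x ⟨hx.1, hx.2.trans_lt l1⟩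
      rwa [hrp hx] at this
  have k2 : ∀ y ∈ Metric.closedBall p r, ∀ x ∈ Ioc 0 δ, c * x ^ (s + 1) ≤
      laplacianCoord (collarBasis n) (collarMatrix K) (fun z => 1 * β z.2) (y, x) :=
    fun y hy x hx => hb₂ y hy x ⟨hx.1, hx.2.trans_lt l2⟩
  have k3 : ∀ x ∈ Ioc 0 δ, 0 < β x := fun x hx => hb₃ ⟨hx.1, hx.2.trans_lt l3⟩
  obtain ⟨μ, hμ⟩ := h.le_barrier hr hball hδ l4 hs hsn hW hC₀ k0
    (fun y hy x hx => (abs_le.1 (k1 y hy x hx)).2) hβ k3 hc k2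
  have k0' : ∀ y ∈ Metric.closedBall p r, ∀ x ∈ Ioc 0 δ, |(-1) * W (y, x)| ≤ C₀ * x ^ s :=
    fun y hy x hx => by
      rw [neg_one_mul, abs_neg]
      exact k0 y hy x hx
  have k1' : ∀ y ∈ Metric.closedBall p r, ∀ x ∈ Ioc 0 δ, laplacianCoord (collarBasis n)
      (collarMatrix K) (fun q => (-1) * W q) (y, x) ≤ C₁ * x ^ (s + 1) := fun y hy x hx => by
    have hm : (y, x) ∈ S ×ˢ Ioo 0 ε := ⟨hball hy, hx.1, hx.2.trans_lt l4⟩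
    have hd : ContDiffAt ℝ ∞ W (y, x) :=
      hW.contDiffAt ((h.isOpen.prod isOpen_Ioo).mem_nhds hm)
    rw [laplacianCoord_const_mul _ _ _ hd]
    have := (abs_le.1 (k1 y hy x hx)).1
    linarith
  obtain ⟨ν, hν⟩ := h.le_barrier (W := fun q => (-1) * W q) hr hball hδ l4 hs hsn
    (contDiffOn_const.mul hW) hC₀
    k0' k1' hβ k3 hc k2
  refine Asymptotics.IsBigO.of_bound (max μ ν) ?_
  filter_upwards [Ioo_mem_nhdsGT hδ] with x hx
  have hx' := Ioo_subset_Ioc_self hx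
  have hb := k3 x hx'
  rw [Real.norm_eq_abs, Real.norm_of_nonneg hb.le, abs_le]
  have a1 := hμ x hx'
  have a2 := hν x hx'
  have a3 := mul_le_mul_of_nonneg_right (le_max_left μ ν) hb.le
  have a4 := mul_le_mul_of_nonneg_right (le_max_right μ ν) hb.le
  constructor <;> linarith

theorem eventually_abs_mul_traceDeriv_le (h : IsMetricFamily S ε K) (hε : 0 < ε)
    {B : Set (EuclideanSpace ℝ (Fin n))} (hB : B ⊆ S) (hBc : IsCompact B) {w : ℝ → ℝ}
    (hw : Tendsto w (𝓝[>] 0) (𝓝 0)) {η : ℝ} (hη : 0 < η) :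
    ∀ᶠ q in 𝓟 B ×ˢ 𝓝[>] (0 : ℝ), |w q.2 * traceDeriv K q| ≤ η := by
  have h1 := h.smooth_traceDeriv.isBigOAtBoundary_one h.isOpen hε B hB hBc
  have h2 : (fun q : EuclideanSpace ℝ (Fin n) × ℝ => w q.2) =o[𝓟 B ×ˢ 𝓝[>] (0 : ℝ)]
      fun _ => (1 : ℝ) := (Asymptotics.isLittleO_one_iff ℝ).2 (hw.comp tendsto_snd)
  have h3 := (h2.mul_isBigO h1).def hη
  filter_upwards [h3] with q hq
  simpa using hq

/-- The barrier is `xˢ⁺¹`, whose Laplacian is `(s+1)(n-s-1)xˢ⁺¹` up to higher order. Half of this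
positive constant is given up to absorb the trace term near the boundary. -/
theorem isBigO_rpow_add_one (h : IsMetricFamily S ε K) (hε : 0 < ε) (hs : 0 < s) (hsn : s + 1 < n)
    (hW : ContDiffOn ℝ ∞ W (S ×ˢ Ioo 0 ε)) (hW₀ : IsBigOAtBoundary S W fun x => x ^ s)
    (hW₁ : IsBigOAtBoundary S (laplacianCoord (collarBasis n) (collarMatrix K) W)
      fun x => x ^ (s + 1)) (hp : p ∈ S) :
    (fun x => W (p, x)) =O[𝓝[>] 0] fun x => x ^ (s + 1) := by
  have hc : 0 < (s + 1) * (n - (s + 1)) / 2 := by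
    have : 0 < n - (s + 1) := by linarith
    positivity
  refine h.isBigO_barrier hε hs (by linarith) hW hW₀ hW₁ hp (contDiffOn_rpow_Ioi _)
    (by filter_upwards [self_mem_nhdsWithin] with x hx using Real.rpow_pos_of_pos hx _) hc ?_
  intro B hB hBc
  have h1 := h.eventually_abs_mul_traceDeriv_le hε hB hBc (w := fun x => x)
    (tendsto_id.mono_left nhdsWithin_le_nhds) (η := n - (s + 1)) (by linarith)
  filter_upwards [h1, eventually_mem_collar hB hε] with q hq hqm
  rw [h.laplacianCoord_mul_rpow contDiffOn_const (s + 1) hqm, sliceLaplacian_const]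
  have h2 := (abs_le.1 hq).2
  have h3 : 0 < q.2 ^ (s + 1) := Real.rpow_pos_of_pos hqm.2.1 _
  have h4 : (s + 1) * (n - (s + 1)) / 2 ≤ -(1 * ((s + 1) * (s + 1 - n)
      + 1 / 2 * ((s + 1) * (q.2 * traceDeriv K q))) + q.2 ^ 2 * 0) := by nlinarith
  nlinarith [mul_le_mul_of_nonneg_left h4 h3.le]

/-- At the indicial root `n` the power `xⁿ` is no longer a strict supersolution. Subtracting
`xⁿ⁺¹ᐟ²` adds `½(n+½)xⁿ⁺¹ᐟ²` to the Laplacian, which beats the error `O(xⁿ⁺¹)` left by `xⁿ`, and the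
barrier is still comparable to `xⁿ`. -/
theorem isBigO_pow (h : IsMetricFamily S ε K) (hε : 0 < ε) (hn : 0 < n)
    (hW : ContDiffOn ℝ ∞ W (S ×ˢ Ioo 0 ε))
    (hW₀ : IsBigOAtBoundary S W fun x => x ^ ((n : ℝ) - 1 / 2))
    (hW₁ : IsBigOAtBoundary S (laplacianCoord (collarBasis n) (collarMatrix K) W)
      fun x => x ^ ((n : ℝ) + 1 / 2)) (hp : p ∈ S) :
    (fun x => W (p, x)) =O[𝓝[>] 0] fun x => x ^ n := by
  have hn1 : (1 : ℝ) ≤ n := by exact_mod_cast hn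
  have es : (n : ℝ) - 1 / 2 + 1 = n + 1 / 2 := by ring
  have hβ : (fun x => W (p, x)) =O[𝓝[>] 0] fun x => x ^ (n : ℝ) - x ^ ((n : ℝ) + 1 / 2) := by
    refine h.isBigO_barrier hε (s := (n : ℝ) - 1 / 2) (by linarith) (by linarith) hW hW₀
      (by rwa [es]) hp ((contDiffOn_rpow_Ioi _).sub (contDiffOn_rpow_Ioi _)) ?_
      (c := ((n : ℝ) + 1 / 2) / 4) (by positivity) ?_
    · filter_upwards [Ioo_mem_nhdsGT (zero_lt_one' ℝ)] with x hx
      exact sub_pos.2 (Real.rpow_lt_rpow_of_exponent_gt hx.1 hx.2 (by linarith))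
    · intro B hB hBc
      have h1 := h.eventually_abs_mul_traceDeriv_le hε hB hBc (w := fun x => x)
        (tendsto_id.mono_left nhdsWithin_le_nhds) (η := 1 / 4) (by norm_num)
      have h2 := h.eventually_abs_mul_traceDeriv_le hε hB hBc (w := fun x => x ^ (1 / 2 : ℝ))
        (by
          have := (Real.continuousAt_rpow_const 0 (1 / 2) (Or.inr (by norm_num))).tendsto
          rw [Real.zero_rpow (by norm_num)] at this
          exact this.mono_left nhdsWithin_le_nhds) (η := 1 / 4) (by norm_num)
      filter_upwards [h1, h2, eventually_mem_collar hB hε] with q hq1 hq2 hqm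
      have hx := hqm.2.1
      have e : (fun z : EuclideanSpace ℝ (Fin n) × ℝ =>
          1 * (z.2 ^ (n : ℝ) - z.2 ^ ((n : ℝ) + 1 / 2))) =
          fun z => 1 * z.2 ^ (n : ℝ) - 1 * z.2 ^ ((n : ℝ) + 1 / 2) := by funext z; ring
      have d1 := h.contDiffAt_mul contDiffOn_const (φ := fun _ => 1)
        (contDiffOn_rpow_Ioi (n : ℝ)) hqm
      have d2 := h.contDiffAt_mul contDiffOn_const (φ := fun _ => 1)
        (contDiffOn_rpow_Ioi ((n : ℝ) + 1 / 2)) hqm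
      rw [e, laplacianCoord_sub _ _ d1 d2, h.laplacianCoord_mul_rpow contDiffOn_const _ hqm,
        h.laplacianCoord_mul_rpow contDiffOn_const _ hqm, sliceLaplacian_const, es]
      have e2 : q.2 ^ (n : ℝ) * q.2 = q.2 ^ ((n : ℝ) + 1 / 2) * q.2 ^ (1 / 2 : ℝ) := by
        rw [← Real.rpow_add_one hx.ne', ← Real.rpow_add hx]; congr 1; ring
      have h3 : 0 < q.2 ^ ((n : ℝ) + 1 / 2) := Real.rpow_pos_of_pos hx _
      have k1 := (abs_le.1 hq1)
      have k2 := (abs_le.1 hq2)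
      have e3 : -(q.2 ^ (n : ℝ) * (1 * ((n : ℝ) * (n - n) + 1 / 2 * (n * (q.2 * traceDeriv K q)))
            + q.2 ^ 2 * 0))
          - -(q.2 ^ ((n : ℝ) + 1 / 2) * (1 * (((n : ℝ) + 1 / 2) * (n + 1 / 2 - n)
            + 1 / 2 * ((n + 1 / 2) * (q.2 * traceDeriv K q))) + q.2 ^ 2 * 0)) =
          q.2 ^ ((n : ℝ) + 1 / 2) * (-(1 / 2 * (n * (q.2 ^ (1 / 2 : ℝ) * traceDeriv K q)))
            + ((n : ℝ) + 1 / 2) * (1 / 2) + 1 / 2 * ((n + 1 / 2) * (q.2 * traceDeriv K q))) := by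
        linear_combination (-(1 / 2) * n * traceDeriv K q) * e2
      rw [e3, mul_comm _ (q.2 ^ ((n : ℝ) + 1 / 2))]
      refine mul_le_mul_of_nonneg_left ?_ h3.le
      nlinarith
  refine hβ.trans (((Asymptotics.isBigO_refl _ _).sub (isBigO_rpow_rpow_nhdsGT (by linarith))).trans
    (Asymptotics.IsBigO.of_bound 1 (Eventually.of_forall fun x => by simp)))

/-- A solution of `Δ_g W = O(x^(n+1) log x)` with `W = a + b x^n log x + O(x^n)` and `a = 0` on
the boundary is `O(x^n)`. -/
theorem vanishing (h : IsMetricFamily S ε K) (hε : 0 < ε) (hn : 0 < n)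
    {a b : EuclideanSpace ℝ (Fin n) × ℝ → ℝ} (hW : ContDiffOn ℝ ∞ W (S ×ˢ Ioo 0 ε))
    (ha : SmoothUpTo S ε a) (hb : SmoothUpTo S ε b) (ha₀ : ∀ y ∈ S, a (y, 0) = 0)
    (he : IsBigOAtBoundary S (fun q => W q - (a q + b q * q.2 ^ n * Real.log q.2)) fun x => x ^ n)
    (hW₁ : IsBigOAtBoundary S (laplacianCoord (collarBasis n) (collarMatrix K) W)
      fun x => x ^ (n + 1) * Real.log x) :
    (∀ j < n, ∀ y ∈ S, PowerSeries.coeff j (bdrySeries a y) = 0) ∧ ∀ y ∈ S, b (y, 0) = 0 := by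
  have hlog : ∀ {t : ℝ}, t < n → IsBigOAtBoundary S (fun q => b q * q.2 ^ n * Real.log q.2)
      fun x => x ^ t := fun ht => by
    have := (hb.isBigOAtBoundary_one h.isOpen hε).mul
      (IsBigOAtBoundary.of_snd (fun x : ℝ => x ^ n * Real.log x))
    simp only [one_mul, ← mul_assoc] at this
    exact this.trans (isBigO_pow_mul_log_rpow ht)
  have hpow : ∀ {m : ℕ} {t : ℝ}, t ≤ m → (fun x : ℝ => x ^ m) =O[𝓝[>] 0] fun x : ℝ => x ^ t :=
    fun {m t} ht => by simpa using isBigO_rpow_rpow_nhdsGT ht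
  -- Half a power is given up so that the logarithm is absorbed even for `m = n`.
  have hsize : ∀ m ≤ n, (∀ j < m, ∀ y ∈ S, PowerSeries.coeff j (bdrySeries a y) = 0) →
      IsBigOAtBoundary S W fun x => x ^ ((m : ℝ) - 1 / 2) := fun m hm hcoef => by
    have hmn : (m : ℝ) ≤ n := by exact_mod_cast hm
    have h1 := (ha.isBigOAtBoundary h.isOpen hε hcoef).trans
      (hpow (show (m : ℝ) - 1 / 2 ≤ m by linarith))
    have h2 := hlog (show (m : ℝ) - 1 / 2 < n by linarith)
    have h3 := he.trans (hpow (show (m : ℝ) - 1 / 2 ≤ n by linarith))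
    exact (h3.add (h1.add h2)).congr' hε fun q _ => by ring
  have hlap : ∀ m ≤ n, IsBigOAtBoundary S (laplacianCoord (collarBasis n) (collarMatrix K) W)
      fun x => x ^ ((m : ℝ) + 1 / 2) := fun m hm => by
    have hmn : (m : ℝ) ≤ n := by exact_mod_cast hm
    exact hW₁.trans (isBigO_pow_mul_log_rpow (by push_cast; linarith))
  -- The gain of one power leads from exponent `m - ½` to `m + ½`, which exceeds `m`, so the
  -- coefficient of order `m` vanishes.
  have hstep : ∀ m < n, 1 ≤ m → (∀ j < m, ∀ y ∈ S, PowerSeries.coeff j (bdrySeries a y) = 0) →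
      ∀ y ∈ S, PowerSeries.coeff m (bdrySeries a y) = 0 := fun m hm hm1 hcoef y hy => by
    have hmn : (m : ℝ) + 1 ≤ n := by exact_mod_cast hm
    have hm1' : (1 : ℝ) ≤ m := by exact_mod_cast hm1
    have es : (m : ℝ) - 1 / 2 + 1 = m + 1 / 2 := by ring
    have h1 := h.isBigO_rpow_add_one hε (s := (m : ℝ) - 1 / 2) (by linarith) (by linarith) hW
      (hsize m hm.le hcoef) (by rw [es]; exact hlap m hm.le) hy
    rw [es] at h1
    have h2 := (hlog (show (m : ℝ) + 1 / 2 < n by linarith)).at_point hy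
    have h3 := (he.trans (hpow (show (m : ℝ) + 1 / 2 ≤ n by linarith))).at_point hy
    have h4 : (fun x => a (y, x)) =O[𝓝[>] 0] fun x => x ^ ((m : ℝ) + 1 / 2) :=
      ((h1.sub h3).sub h2).congr_left fun x => by ring
    refine coeff_eq_zero_of_isLittleO h.isOpen hε ha hy (fun j hj => hcoef j hj y hy)
      (h4.trans_isLittleO ?_)
    have h5 : (fun x : ℝ => x ^ (1 / 2 : ℝ)) =o[𝓝[>] 0] fun _ => (1 : ℝ) := by
      refine (Asymptotics.isLittleO_one_iff ℝ).2 ?_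
      have := (Real.continuousAt_rpow_const 0 (1 / 2) (Or.inr (by norm_num))).tendsto
      rw [Real.zero_rpow (by norm_num)] at this
      exact this.mono_left nhdsWithin_le_nhds
    refine ((Asymptotics.isBigO_refl (fun x : ℝ => x ^ m) _).mul_isLittleO h5).congr' ?_ ?_
    · filter_upwards [self_mem_nhdsWithin] with x hx
      rw [Real.rpow_add hx, Real.rpow_natCast]
    · exact Eventually.of_forall fun x => mul_one _
  have hall : ∀ j < n, ∀ y ∈ S, PowerSeries.coeff j (bdrySeries a y) = 0 := by
    intro j
    induction j using Nat.strong_induction_on with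
    | _ j ih =>
      intro hj y hy
      rcases Nat.eq_zero_or_pos j with rfl | hj0
      · simpa using ha₀ y hy
      · exact hstep j hj hj0 (fun i hi => ih i hi (hi.trans hj)) y hy
  refine ⟨hall, fun y hy => ?_⟩
  -- Once `W` and `a` are both `O(xⁿ)`, so is `b xⁿ log x`; hence `b = O(1/log x)` tends to zero at
  -- the boundary.
  have h1 := h.isBigO_pow hε hn hW (hsize n le_rfl hall) (hlap n le_rfl) hy
  have h2 := (ha.isBigOAtBoundary h.isOpen hε hall).at_point hy
  have h3 := he.at_point hy
  have h4 : (fun x => b (y, x) * x ^ n * Real.log x) =O[𝓝[>] 0] fun x => x ^ n :=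
    ((h1.sub h3).sub h2).congr_left fun x => by ring
  have h5 : (fun x => b (y, x)) =O[𝓝[>] 0] fun x => (Real.log x)⁻¹ := by
    refine (h4.mul (Asymptotics.isBigO_refl (fun x : ℝ => (x ^ n * Real.log x)⁻¹) _)).congr' ?_ ?_
    · filter_upwards [Ioo_mem_nhdsGT (zero_lt_one' ℝ)] with x hx
      have := (Real.log_neg hx.1 hx.2).ne
      have := pow_ne_zero n hx.1.ne'
      field_simp
    · filter_upwards [Ioo_mem_nhdsGT (zero_lt_one' ℝ)] with x hx
      have := (Real.log_neg hx.1 hx.2).ne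
      have := pow_ne_zero n hx.1.ne'
      field_simp
  have h6 : Tendsto (fun x : ℝ => (Real.log x)⁻¹) (𝓝[>] 0) (𝓝 0) :=
    tendsto_inv_atBot_zero.comp Real.tendsto_log_nhdsGT_zero
  have h7 := h5.trans_tendsto h6
  have h8 : Tendsto (fun x => b (y, x)) (𝓝[>] 0) (𝓝 (b (y, 0))) := by
    have hc := (ContDiffOn.continuousOn hb) (y, 0) (zero_mem_collar hε hy)
    refine hc.tendsto.comp (tendsto_nhdsWithin_iff.2 ⟨?_, ?_⟩)
    · exact ((continuous_const.prodMk continuous_id).tendsto (0 : ℝ)).mono_left nhdsWithin_le_nhds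
    · filter_upwards [Ioo_mem_nhdsGT hε] with x hx using ⟨hy, Ioo_subset_Ico_self hx⟩
  exact tendsto_nhds_unique h8 h7

end IsMetricFamily

end Decay

/-! ### Solutions in coordinates: uniqueness and construction. -/

section LocalSolution

variable {n : ℕ} {S S' : Set (EuclideanSpace ℝ (Fin n))} {ε : ℝ}
  {K : EuclideanSpace ℝ (Fin n) × ℝ → Matrix (Fin n) (Fin n) ℝ}
  {U A B U' A' B' : EuclideanSpace ℝ (Fin n) × ℝ → ℝ}

/-- `U` is a solution of `Δ_g U = n + O(x^(n+1) log x)` for `g = x⁻² (K + dx²)`, with the expansion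
`U = log x + A + B x^n log x + O(x^n)`. -/
structure IsLocalSolution (S : Set (EuclideanSpace ℝ (Fin n))) (ε : ℝ)
    (K : EuclideanSpace ℝ (Fin n) × ℝ → Matrix (Fin n) (Fin n) ℝ)
    (U A B : EuclideanSpace ℝ (Fin n) × ℝ → ℝ) : Prop where
  smooth_U : ContDiffOn ℝ ∞ U (S ×ˢ Ioo 0 ε)
  smooth_A : SmoothUpTo S ε A
  smooth_B : SmoothUpTo S ε B
  A_boundary : ∀ y ∈ S, A (y, 0) = 0
  expansion : IsBigOAtBoundary S
    (fun q => U q - (Real.log q.2 + A q + B q * q.2 ^ n * Real.log q.2)) (fun x => x ^ n)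
  equation : IsBigOAtBoundary S
    (fun q => laplacianCoord (collarBasis n) (collarMatrix K) U q - n)
    (fun x => x ^ (n + 1) * Real.log x)

theorem IsMetricFamily.mono (h : IsMetricFamily S ε K) (hS' : IsOpen S') (hS : S' ⊆ S) :
    IsMetricFamily S' ε K :=
  ⟨hS', fun i j => (h.smooth i j).mono hS le_rfl, fun q hq => h.posDef q ⟨hS hq.1, hq.2⟩⟩

theorem PoincareData.isMetricFamily (d : PoincareData n) : IsMetricFamily d.S d.ε d.K :=
  ⟨d.isOpen, d.smooth, d.posDef⟩

namespace IsLocalSolution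

theorem mono (h : IsLocalSolution S ε K U A B) (hS : S' ⊆ S) : IsLocalSolution S' ε K U A B :=
  ⟨h.smooth_U.mono (prod_mono hS Subset.rfl), h.smooth_A.mono hS le_rfl,
    h.smooth_B.mono hS le_rfl, fun y hy => h.A_boundary y (hS hy), h.expansion.mono hS,
    h.equation.mono hS⟩

theorem unique (h : IsLocalSolution S ε K U A B) (h' : IsLocalSolution S ε K U' A' B')
    (hK : IsMetricFamily S ε K) (hε : 0 < ε) (hn : 0 < n) :
    (∀ j < n, ∀ y ∈ S, PowerSeries.coeff j (bdrySeries A y) =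
      PowerSeries.coeff j (bdrySeries A' y)) ∧ ∀ y ∈ S, B (y, 0) = B' (y, 0) := by
  have hop := hK.isOpen.prod (isOpen_Ioo (a := (0 : ℝ)) (b := ε))
  obtain ⟨h1, h2⟩ := hK.vanishing hε hn (W := fun q => U q - U' q) (a := A - A') (b := B - B')
    (h.smooth_U.sub h'.smooth_U) (h.smooth_A.sub h'.smooth_A) (h.smooth_B.sub h'.smooth_B)
    (fun y hy => by simp [h.A_boundary y hy, h'.A_boundary y hy])
    ((h.expansion.sub h'.expansion).congr' hε fun q _ => by
      simp only [Pi.sub_apply]; ring)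
    ((h.equation.sub h'.equation).congr' hε fun q hq => by
      rw [laplacianCoord_sub _ _ (h.smooth_U.contDiffAt (hop.mem_nhds hq))
        (h'.smooth_U.contDiffAt (hop.mem_nhds hq))]
      ring)
  refine ⟨fun j hj y hy => ?_, fun y hy => sub_eq_zero.1 (h2 y hy)⟩
  have := h1 j hj y hy
  rw [bdrySeries_sub hK.isOpen hε h.smooth_A h'.smooth_A hy, map_sub] at this
  exact sub_eq_zero.1 this

end IsLocalSolution

theorem isBigO_one_log : (fun _ : ℝ => (1 : ℝ)) =O[𝓝[>] 0] Real.log :=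
  (Asymptotics.isLittleO_const_left.2 (Or.inr
    (tendsto_abs_atBot_atTop.comp Real.tendsto_log_nhdsGT_zero))).isBigO

theorem hasDerivAt_pow_mul_log (m : ℕ) {x : ℝ} (hx : 0 < x) :
    HasDerivAt (fun x : ℝ => x ^ m * Real.log x)
      (m * (x ^ m * Real.log x) * x⁻¹ + x ^ m * x⁻¹) x := by
  refine ((hasDerivAt_pow m x).mul (Real.hasDerivAt_log hx.ne')).congr_deriv ?_
  rcases m with _ | m
  · simp
  · rw [Nat.add_sub_cancel, pow_succ]; field_simp

theorem contDiffOn_pow_mul_log (m : ℕ) :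
    ContDiffOn ℝ ∞ (fun x : ℝ => x ^ m * Real.log x) (Ioi 0) := fun x hx =>
  ((contDiffAt_id.pow m).mul (Real.contDiffAt_log.2 (ne_of_gt hx))).contDiffWithinAt

namespace IsMetricFamily

theorem laplacianCoord_log (h : IsMetricFamily S ε K) {q : EuclideanSpace ℝ (Fin n) × ℝ}
    (hq : q ∈ S ×ˢ Ioo 0 ε) :
    laplacianCoord (collarBasis n) (collarMatrix K) (fun z => 1 * Real.log z.2) q =
      n - q.2 * (1 / 2 * traceDeriv K q) := by
  have hx : q.2 ≠ 0 := hq.2.1.ne'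
  rw [h.laplacianCoord_mul contDiffOn_const
    (fun x hx => (Real.contDiffAt_log.2 (ne_of_gt hx)).contDiffWithinAt) hq, sliceLaplacian_const,
    Real.deriv_log', deriv_inv]
  field_simp
  ring

theorem laplacianCoord_mul_pow (h : IsMetricFamily S ε K) {φ : EuclideanSpace ℝ (Fin n) → ℝ}
    (hφ : ContDiffOn ℝ ∞ φ S) (j : ℕ) {q : EuclideanSpace ℝ (Fin n) × ℝ}
    (hq : q ∈ S ×ˢ Ioo 0 ε) :
    laplacianCoord (collarBasis n) (collarMatrix K) (fun z => φ z.1 * z.2 ^ j) q =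
      -(q.2 ^ j * (j * ((j : ℝ) - n) * φ q.1 + q.2 * (1 / 2 * (j * (traceDeriv K q * φ q.1))
        + q.2 * sliceLaplacian K φ q))) := by
  have := h.laplacianCoord_mul_rpow hφ j hq
  simp only [Real.rpow_natCast] at this
  rw [this]
  ring

/-- Since `n` is a root of `s(s-n)`, the terms in `xⁿ log x` cancel; the derivative `n` of this
polynomial at the root leaves the term `n φ xⁿ`. -/
theorem laplacianCoord_mul_pow_log (h : IsMetricFamily S ε K) {φ : EuclideanSpace ℝ (Fin n) → ℝ}
    (hφ : ContDiffOn ℝ ∞ φ S) {q : EuclideanSpace ℝ (Fin n) × ℝ} (hq : q ∈ S ×ˢ Ioo 0 ε) :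
    laplacianCoord (collarBasis n) (collarMatrix K)
        (fun z => φ z.1 * (z.2 ^ n * Real.log z.2)) q =
      -(q.2 ^ n * (n * φ q.1)) - 1 / 2 * (φ q.1 * traceDeriv K q) * (q.2 ^ (n + 1))
        - (1 / 2 * n * (φ q.1 * traceDeriv K q) + q.2 * sliceLaplacian K φ q)
          * (q.2 ^ (n + 1) * Real.log q.2) := by
  have hx := hq.2.1
  have d1 : ∀ {x : ℝ}, x ∈ Ioi (0 : ℝ) → deriv (fun x : ℝ => x ^ n * Real.log x) x =
      n * (x ^ n * Real.log x) * x⁻¹ + x ^ n * x⁻¹ := fun hx => (hasDerivAt_pow_mul_log n hx).deriv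
  have d2 : deriv (deriv fun x : ℝ => x ^ n * Real.log x) q.2 =
      (n * (n * (q.2 ^ n * Real.log q.2) * q.2⁻¹ + q.2 ^ n * q.2⁻¹) * q.2⁻¹
        + n * (q.2 ^ n * Real.log q.2) * (-(q.2 ^ 2)⁻¹))
      + (n * q.2 ^ (n - 1) * q.2⁻¹ + q.2 ^ n * (-(q.2 ^ 2)⁻¹)) := by
    have e : deriv (fun x : ℝ => x ^ n * Real.log x) =ᶠ[𝓝 q.2]
        fun x => n * (x ^ n * Real.log x) * x⁻¹ + x ^ n * x⁻¹ :=
      mem_of_superset (Ioi_mem_nhds hx) fun x hx => d1 hx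
    rw [e.deriv_eq]
    exact ((((hasDerivAt_pow_mul_log n hx).const_mul (n : ℝ)).mul (hasDerivAt_inv hx.ne')).add
      ((hasDerivAt_pow n q.2).mul (hasDerivAt_inv hx.ne'))).deriv
  have p : n * q.2 ^ (n - 1) = n * (q.2 ^ n * q.2⁻¹) := by
    rcases n with _ | m
    · simp
    · rw [Nat.add_sub_cancel, pow_succ]; field_simp
  rw [h.laplacianCoord_mul hφ (contDiffOn_pow_mul_log n) hq, d2, d1 hx, p]
  field_simp
  ring

end IsMetricFamily

theorem smoothUpTo_polynomial {c : ℕ → EuclideanSpace ℝ (Fin n) → ℝ} {m : ℕ}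
    (hc : ∀ j < m, ContDiffOn ℝ ∞ (c j) S) :
    SmoothUpTo S ε (fun q => ∑ j ∈ Finset.range m, c j q.1 * q.2 ^ j) :=
  ContDiffOn.sum fun j hj =>
    (SmoothUpTo.of_fst (hc j (Finset.mem_range.1 hj))).mul (SmoothUpTo.snd_pow j)

theorem coeff_bdrySeries_polynomial (hS : IsOpen S) (hε : 0 < ε)
    {c : ℕ → EuclideanSpace ℝ (Fin n) → ℝ} {m : ℕ} (hc : ∀ j < m, ContDiffOn ℝ ∞ (c j) S)
    {y : EuclideanSpace ℝ (Fin n)} (hy : y ∈ S) {i : ℕ} (hi : i < m) :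
    PowerSeries.coeff i (bdrySeries (fun q => ∑ j ∈ Finset.range m, c j q.1 * q.2 ^ j) y) =
      c i y := by
  have hs : ∀ j ∈ Finset.range m, SmoothUpTo S ε
      (fun q : EuclideanSpace ℝ (Fin n) × ℝ => c j q.1 * q.2 ^ j) := fun j hj =>
    (SmoothUpTo.of_fst (hc j (Finset.mem_range.1 hj))).mul (SmoothUpTo.snd_pow j)
  have e := bdrySeries_sum hS hε hs hy
  have e2 : (fun q : EuclideanSpace ℝ (Fin n) × ℝ => ∑ j ∈ Finset.range m, c j q.1 * q.2 ^ j) =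
      ∑ j ∈ Finset.range m, fun q : EuclideanSpace ℝ (Fin n) × ℝ => c j q.1 * q.2 ^ j := by
    funext q; simp
  rw [e2, e]
  rw [map_sum, Finset.sum_eq_single_of_mem i (Finset.mem_range.2 hi)]
  · have := bdrySeries_mul hS hε (SmoothUpTo.of_fst (ε := ε) (hc i hi)) (SmoothUpTo.snd_pow i) hy
    rw [bdrySeries_fst hS hε hy (hc i hi), bdrySeries_snd_pow hS hε hy] at this
    change PowerSeries.coeff i (bdrySeries ((fun q => c i q.1) * fun q => q.2 ^ i) y) = _
    rw [this, PowerSeries.coeff_C_mul, PowerSeries.coeff_X_pow]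
    simp
  · intro j hj hne
    have := bdrySeries_mul hS hε (SmoothUpTo.of_fst (ε := ε) (hc j (Finset.mem_range.1 hj)))
      (SmoothUpTo.snd_pow j) hy
    rw [bdrySeries_fst hS hε hy (hc j (Finset.mem_range.1 hj)),
      bdrySeries_snd_pow hS hε hy] at this
    change PowerSeries.coeff i (bdrySeries ((fun q => c j q.1) * fun q => q.2 ^ j) y) = _
    rw [this, PowerSeries.coeff_C_mul, PowerSeries.coeff_X_pow, if_neg (Ne.symm hne), mul_zero]

namespace PoincareData

variable (d : PoincareData n)

theorem sliceLaplacian_eval_jet (P : MvPolynomial (JetVar n) ℝ)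
    {q : EuclideanSpace ℝ (Fin n) × ℝ} (hq : q.1 ∈ d.S) :
    sliceLaplacian d.K (fun y => MvPolynomial.eval (d.jet y) P) q = sliceLaplacianJet P d q := by
  have e : ∀ (P : MvPolynomial (JetVar n) ℝ) j, ∀ y ∈ d.S,
      partialDeriv (stdBasis n) j (fun y => MvPolynomial.eval (d.jet y) P) y =
        MvPolynomial.eval (d.jet y) (totalDeriv j P) :=
    fun P j y hy => d.partialDeriv_eval_jet P j hy
  have e2 : ∀ i j, partialDeriv (stdBasis n) i (partialDeriv (stdBasis n) j
      (fun y => MvPolynomial.eval (d.jet y) P)) q.1 =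
        MvPolynomial.eval (d.jet q.1) (totalDeriv i (totalDeriv j P)) := fun i j => by
    have : partialDeriv (stdBasis n) j (fun y => MvPolynomial.eval (d.jet y) P) =ᶠ[𝓝 q.1]
        fun y => MvPolynomial.eval (d.jet y) (totalDeriv j P) :=
      mem_of_superset (d.isOpen.mem_nhds hq) fun y hy => e P j y hy
    rw [this.partialDeriv_eq, e _ _ _ hq]
  simp only [sliceLaplacian, sliceLaplacianJet, e2, e _ _ _ hq]

/-- The formal solution given by the polynomials `P j` and `Q` in the jet of the boundary
metric. -/
theorem isLocalSolution (hn : 0 < n) {P : ℕ → MvPolynomial (JetVar n) ℝ}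
    {Q : MvPolynomial (JetVar n) ℝ} (hP : P 0 = 0)
    (hs : SmoothUpTo d.S d.ε (fun q => equationResidual P n d q
      + q.2 ^ n * (n * MvPolynomial.eval (d.jet q.1) Q)))
    (h0 : ∀ y ∈ d.S, ∀ i < n + 1, PowerSeries.coeff i (bdrySeries (fun q =>
      equationResidual P n d q + q.2 ^ n * (n * MvPolynomial.eval (d.jet q.1) Q)) y) = 0) :
    IsLocalSolution d.S d.ε d.K
      (fun q => Real.log q.2
        + ∑ j ∈ Finset.range n, MvPolynomial.eval (d.jet q.1) (P j) * q.2 ^ j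
        + MvPolynomial.eval (d.jet q.1) Q * q.2 ^ n * Real.log q.2)
      (fun q => ∑ j ∈ Finset.range n, MvPolynomial.eval (d.jet q.1) (P j) * q.2 ^ j)
      (fun q => MvPolynomial.eval (d.jet q.1) Q) := by
  have hK := d.isMetricFamily
  have hA : SmoothUpTo d.S d.ε (fun q => ∑ j ∈ Finset.range n,
      MvPolynomial.eval (d.jet q.1) (P j) * q.2 ^ j) :=
    smoothUpTo_polynomial (c := fun j y => MvPolynomial.eval (d.jet y) (P j))
      fun j _ => d.contDiffOn_eval_jet (P j)
  have hB : SmoothUpTo d.S d.ε (fun q => MvPolynomial.eval (d.jet q.1) Q) :=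
    SmoothUpTo.of_fst (d.contDiffOn_eval_jet Q)
  have hlog : ContDiffOn ℝ ∞ (fun q : EuclideanSpace ℝ (Fin n) × ℝ => Real.log q.2)
      (d.S ×ˢ Ioo 0 d.ε) := contDiffOn_snd.log fun q hq => hq.2.1.ne'
  have hsub : d.S ×ˢ Ioo 0 d.ε ⊆ d.S ×ˢ Ico 0 d.ε := prod_mono Subset.rfl Ioo_subset_Ico_self
  refine ⟨(hlog.add (ContDiffOn.mono hA hsub)).add
    (((ContDiffOn.mono hB hsub).mul (contDiffOn_snd.pow n)).mul hlog), hA, hB, ?_, ?_, ?_⟩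
  · intro y hy
    refine Finset.sum_eq_zero fun j _ => ?_
    rcases j with _ | j
    · simp [hP]
    · simp
  · intro C hC hc
    simp only [sub_self]
    exact Asymptotics.isBigO_zero _ _
  -- The residual vanishes through order `n`, hence is `O(xⁿ⁺¹)`. The logarithmic term leaves errors
  -- in `xⁿ⁺¹` and `xⁿ⁺¹ log x` with coefficients smooth up to the boundary.
  · have hR := (hs.isBigOAtBoundary d.isOpen d.ε_pos fun j hj y hy => h0 y hy j hj).trans
      (show (fun x : ℝ => x ^ (n + 1)) =O[𝓝[>] 0] fun x => x ^ (n + 1) * Real.log x by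
        simpa using (Asymptotics.isBigO_refl (fun x : ℝ => x ^ (n + 1)) _).mul isBigO_one_log)
    have hφt : SmoothUpTo d.S d.ε (fun q => 1 / 2 * (MvPolynomial.eval (d.jet q.1) Q
        * traceDeriv d.K q)) := (SmoothUpTo.const (1 / 2)).mul (hB.mul hK.smooth_traceDeriv)
    have hψt : SmoothUpTo d.S d.ε (fun q => 1 / 2 * n * (MvPolynomial.eval (d.jet q.1) Q
        * traceDeriv d.K q)
          + q.2 * sliceLaplacian d.K (fun y => MvPolynomial.eval (d.jet y) Q) q) :=
      ((SmoothUpTo.const (1 / 2 * n)).mul (hB.mul hK.smooth_traceDeriv)).add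
        (smoothUpTo_snd.mul (hK.smooth_sliceLaplacian (d.contDiffOn_eval_jet Q)))
    have h1 := ((hφt.isBigOAtBoundary_one d.isOpen d.ε_pos).mul
      (IsBigOAtBoundary.of_snd fun x : ℝ => x ^ (n + 1))).trans
      (show (fun x : ℝ => 1 * x ^ (n + 1)) =O[𝓝[>] 0] fun x => x ^ (n + 1) * Real.log x by
        simpa using (Asymptotics.isBigO_refl (fun x : ℝ => x ^ (n + 1)) _).mul isBigO_one_log)
    have h2 := (hψt.isBigOAtBoundary_one d.isOpen d.ε_pos).mul
      (IsBigOAtBoundary.of_snd fun x : ℝ => x ^ (n + 1) * Real.log x)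
    simp only [one_mul] at h2
    refine ((IsBigOAtBoundary.sub (f := fun _ => 0)
      (fun C _ _ => Asymptotics.isBigO_zero _ _) (hR.add (h1.add h2)))).congr' d.ε_pos
      fun q hq => ?_
    have c1 : ContDiffAt ℝ ∞ (fun z : EuclideanSpace ℝ (Fin n) × ℝ => 1 * Real.log z.2) q :=
      hK.contDiffAt_mul contDiffOn_const
        (fun x hx => (Real.contDiffAt_log.2 (ne_of_gt hx)).contDiffWithinAt) hq
    have c2 : ∀ j ∈ Finset.range n, ContDiffAt ℝ ∞ (fun z : EuclideanSpace ℝ (Fin n) × ℝ =>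
        MvPolynomial.eval (d.jet z.1) (P j) * z.2 ^ j) q := fun j _ =>
      hK.contDiffAt_mul (d.contDiffOn_eval_jet (P j)) (contDiff_id.pow j).contDiffOn hq
    have c3 : ContDiffAt ℝ ∞ (fun z : EuclideanSpace ℝ (Fin n) × ℝ =>
        MvPolynomial.eval (d.jet z.1) Q * (z.2 ^ n * Real.log z.2)) q :=
      hK.contDiffAt_mul (d.contDiffOn_eval_jet Q) (contDiffOn_pow_mul_log n) hq
    have e : (fun q : EuclideanSpace ℝ (Fin n) × ℝ => Real.log q.2
        + ∑ j ∈ Finset.range n, MvPolynomial.eval (d.jet q.1) (P j) * q.2 ^ j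
        + MvPolynomial.eval (d.jet q.1) Q * q.2 ^ n * Real.log q.2) =
        fun q => (1 * Real.log q.2
        + ∑ j ∈ Finset.range n, MvPolynomial.eval (d.jet q.1) (P j) * q.2 ^ j)
        + MvPolynomial.eval (d.jet q.1) Q * (q.2 ^ n * Real.log q.2) := by
      funext q; ring
    rw [e, laplacianCoord_add _ _ (c1.add (ContDiffAt.sum c2)) c3,
      laplacianCoord_add _ _ c1 (ContDiffAt.sum c2), laplacianCoord_sum _ _ _ c2,
      hK.laplacianCoord_log hq, hK.laplacianCoord_mul_pow_log (d.contDiffOn_eval_jet Q) hq]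
    have e3 : ∑ j ∈ Finset.range n, laplacianCoord (collarBasis n) (collarMatrix d.K)
        (fun z => MvPolynomial.eval (d.jet z.1) (P j) * z.2 ^ j) q =
        - ∑ j ∈ Finset.range n, powerTerm (P j) j d q := by
      rw [← Finset.sum_neg_distrib]
      refine Finset.sum_congr rfl fun j _ => ?_
      rw [hK.laplacianCoord_mul_pow (d.contDiffOn_eval_jet (P j)) j hq,
        d.sliceLaplacian_eval_jet _ hq.1]
      rfl
    rw [e3]
    simp only [equationResidual]
    ring

end PoincareData

end LocalSolution

/-! ### Transport of solutions by changes of boundary coordinates. -/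

section Transport

variable {n : ℕ} {S S' : Set (EuclideanSpace ℝ (Fin n))} {ε : ℝ}
  {K K' : EuclideanSpace ℝ (Fin n) × ℝ → Matrix (Fin n) (Fin n) ℝ}
  {U A B f : EuclideanSpace ℝ (Fin n) × ℝ → ℝ}
  {τ : EuclideanSpace ℝ (Fin n) → EuclideanSpace ℝ (Fin n)}
  {q : EuclideanSpace ℝ (Fin n) × ℝ}

theorem IsBigOAtBoundary.comp {Y Y' : Type*} [TopologicalSpace Y] [TopologicalSpace Y']
    {S : Set Y} {S' : Set Y'} {τ : Y → Y'} {f : Y' × ℝ → ℝ} {w : ℝ → ℝ}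
    (h : IsBigOAtBoundary S' f w) (hτ : ContinuousOn τ S) (hm : MapsTo τ S S') :
    IsBigOAtBoundary S (fun q => f (τ q.1, q.2)) w := fun C hC hc => by
  have h1 := h (τ '' C) ((image_mono hC).trans hm.image_subset) (hc.image_of_continuousOn (hτ.mono hC))
  have ht : Tendsto (fun q : Y × ℝ => (τ q.1, q.2)) (𝓟 C ×ˢ 𝓝[>] 0) (𝓟 (τ '' C) ×ˢ 𝓝[>] 0) :=
    Tendsto.prodMap (tendsto_principal_principal.2 fun y hy => mem_image_of_mem τ hy) tendsto_id
  exact h1.comp_tendsto ht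

theorem formOfMatrix_collarMatrix (v w : EuclideanSpace ℝ (Fin n)) (s t : ℝ) :
    formOfMatrix (collarBasis n) (collarMatrix K q) (v, s) (w, t) =
      (q.2 ^ 2)⁻¹ * (formOfMatrix (stdBasis n) (K q) v w + s * t) := by
  simp only [formOfMatrix_apply, collarMatrix, Fintype.sum_sum_type]
  simp [Finset.mul_sum, mul_add, mul_assoc]

namespace IsMetricFamily

theorem det_collarMatrix_ne_zero (h : IsMetricFamily S ε K) (hq : q ∈ S ×ˢ Ioo 0 ε) :
    (collarMatrix K q).det ≠ 0 := by
  have hx := hq.2.1.ne'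
  rw [collarMatrix, Matrix.det_smul, Matrix.det_fromBlocks_zero₂₁, Matrix.det_one, mul_one]
  exact mul_ne_zero (by positivity) (h.det_ne_zero ⟨hq.1, Ioo_subset_Ico_self hq.2⟩)

theorem isSymm_collarMatrix (h : IsMetricFamily S ε K) (hq : q ∈ S ×ˢ Ioo 0 ε) :
    (collarMatrix K q).IsSymm := by
  have hK := h.posDef q ⟨hq.1, Ioo_subset_Ico_self hq.2⟩
  rw [collarMatrix, Matrix.IsSymm, Matrix.transpose_smul, Matrix.fromBlocks_transpose]
  have : (K q).IsSymm := by simpa using hK.isHermitian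
  rw [this.eq]
  simp

theorem differentiableAt_collarMatrix (h : IsMetricFamily S ε K) (hq : q ∈ S ×ˢ Ioo 0 ε)
    (i j : Fin n ⊕ Unit) : DifferentiableAt ℝ (fun z => collarMatrix K z i j) q := by
  have h1 : DifferentiableAt ℝ
      (fun z : EuclideanSpace ℝ (Fin n) × ℝ => (z.2 ^ 2)⁻¹) q :=
    (differentiableAt_snd.pow 2).inv (pow_ne_zero 2 hq.2.1.ne')
  have h2 : DifferentiableAt ℝ (fun z => Matrix.fromBlocks (K z) 0 0 (1 : Matrix Unit Unit ℝ) i j) q := by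
    rcases i with i | i <;> rcases j with j | j
    · exact ((h.smooth i j).contDiffAt h.isOpen hq).differentiableAt (by simp)
    all_goals simp
  exact h1.mul h2

/-- If `τ` pulls the slice metrics back to each other, then `(y, x) ↦ (τ y, x)` pulls back the
collar metrics, because it fixes `x` and preserves the splitting. -/
theorem laplacianCoord_comp (h : IsMetricFamily S ε K) (h' : IsMetricFamily S' ε K')
    (hτ : ContDiffOn ℝ ∞ τ S) (hm : MapsTo τ S S')
    (hK : ∀ q ∈ S ×ˢ Ioo 0 ε, ∀ i j, K q i j = formOfMatrix (stdBasis n) (K' (τ q.1, q.2))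
      (fderiv ℝ τ q.1 (stdBasis n i)) (fderiv ℝ τ q.1 (stdBasis n j)))
    (hq : q ∈ S ×ˢ Ioo 0 ε) (hf : ContDiffAt ℝ ∞ f (τ q.1, q.2)) :
    laplacianCoord (collarBasis n) (collarMatrix K) (fun q => f (τ q.1, q.2)) q =
      laplacianCoord (collarBasis n) (collarMatrix K') f (τ q.1, q.2) := by
  set Φ : EuclideanSpace ℝ (Fin n) × ℝ → EuclideanSpace ℝ (Fin n) × ℝ := fun q => (τ q.1, q.2)
   
  have hτat : ∀ y ∈ S, ContDiffAt ℝ ∞ τ y := fun y hy => hτ.contDiffAt (h.isOpen.mem_nhds hy)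
  have hΦ : ContDiffAt ℝ ∞ Φ q := ((hτat _ hq.1).comp q contDiffAt_fst).prodMk contDiffAt_snd
  have hΦq : Φ q ∈ S' ×ˢ Ioo 0 ε := ⟨hm hq.1, hq.2⟩
  have hd : ∀ z ∈ S ×ˢ Ioo 0 ε, ∀ v s, fderiv ℝ Φ z (v, s) = (fderiv ℝ τ z.1 v, s) := by
    intro z hz v s
    have h1 : HasFDerivAt (fun q : EuclideanSpace ℝ (Fin n) × ℝ => τ q.1) _ z :=
      ((hτat _ hz.1).differentiableAt (by simp)).hasFDerivAt.comp z (hasFDerivAt_fst (𝕜 := ℝ))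
    rw [(h1.prodMk (hasFDerivAt_snd (𝕜 := ℝ))).fderiv]
    simp
  refine _root_.laplacianCoord_comp (collarBasis n) hΦ (h'.differentiableAt_collarMatrix hΦq)
    (h'.isSymm_collarMatrix hΦq) (h'.det_collarMatrix_ne_zero hΦq) (h.det_collarMatrix_ne_zero hq)
    (h.differentiableAt_collarMatrix hq) ?_ hf
  filter_upwards [h.eventually_mem hq] with z hz i j
  have hb : ∀ i : Fin n ⊕ Unit, ((collarBasis n) i : EuclideanSpace ℝ (Fin n) × ℝ) =
      (((collarBasis n) i).1, ((collarBasis n) i).2) := fun i => rfl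
  rw [hb i, hb j, hd z hz, hd z hz, formOfMatrix_collarMatrix]
  rcases i with i | i <;> rcases j with j | j
  · simp [collarMatrix, hK z hz]
  all_goals simp [collarMatrix]

end IsMetricFamily

theorem IsLocalSolution.comp (hU : IsLocalSolution S' ε K' U A B) (h : IsMetricFamily S ε K)
    (h' : IsMetricFamily S' ε K') (hε : 0 < ε) (hτ : ContDiffOn ℝ ∞ τ S) (hm : MapsTo τ S S')
    (hK : ∀ q ∈ S ×ˢ Ioo 0 ε, ∀ i j, K q i j = formOfMatrix (stdBasis n) (K' (τ q.1, q.2))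
      (fderiv ℝ τ q.1 (stdBasis n i)) (fderiv ℝ τ q.1 (stdBasis n j))) :
    IsLocalSolution S ε K (fun q => U (τ q.1, q.2)) (fun q => A (τ q.1, q.2))
      (fun q => B (τ q.1, q.2)) := by
  have hΦ : ContDiffOn ℝ ∞ (fun q : EuclideanSpace ℝ (Fin n) × ℝ => (τ q.1, q.2)) (S ×ˢ univ) :=
    (hτ.comp contDiffOn_fst fun q hq => hq.1).prodMk contDiffOn_snd
  have hmap : ∀ I : Set ℝ, MapsTo (fun q : EuclideanSpace ℝ (Fin n) × ℝ => (τ q.1, q.2))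
      (S ×ˢ I) (S' ×ˢ I) := fun I q hq => ⟨hm hq.1, hq.2⟩
  have hsub : ∀ I : Set ℝ, S ×ˢ I ⊆ S ×ˢ univ := fun I => prod_mono Subset.rfl (subset_univ _)
  refine ⟨hU.smooth_U.comp (hΦ.mono (hsub _)) (hmap _),
    ContDiffOn.comp hU.smooth_A (hΦ.mono (hsub _)) (hmap _),
    ContDiffOn.comp hU.smooth_B (hΦ.mono (hsub _)) (hmap _),
    fun y hy => hU.A_boundary _ (hm hy), hU.expansion.comp hτ.continuousOn hm,
    (hU.equation.comp hτ.continuousOn hm).congr' hε fun q hq => ?_⟩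
  rw [h.laplacianCoord_comp h' hτ hm hK hq (hU.smooth_U.contDiffAt
    ((h'.isOpen.prod isOpen_Ioo).mem_nhds ⟨hm hq.1, hq.2⟩))]

end Transport

/-! ### Transition maps and components of a metric. -/

section MetricInChart

variable {n : ℕ} {M : Type*} [TopologicalSpace M] [ChartedSpace (EuclideanSpace ℝ (Fin n)) M]
  [IsManifold (𝓡 n) ∞ M] {e e' : OpenPartialHomeomorph M (EuclideanSpace ℝ (Fin n))}

theorem mdifferentiableAt_chart_symm (he : e ∈ IsManifold.maximalAtlas (𝓡 n) ∞ M)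
    {y : EuclideanSpace ℝ (Fin n)} (hy : y ∈ e.target) : MDifferentiableAt (𝓡 n) (𝓡 n) e.symm y :=
  (contMDiffAt_symm_of_mem_maximalAtlas he hy).mdifferentiableAt (by simp)

theorem contDiffOn_transition (he : e ∈ IsManifold.maximalAtlas (𝓡 n) ∞ M)
    (he' : e' ∈ IsManifold.maximalAtlas (𝓡 n) ∞ M) :
    ContDiffOn ℝ ∞ (fun y => e' (e.symm y)) (e.target ∩ e.symm ⁻¹' e'.source) :=
  contMDiffOn_iff_contDiffOn.1 ((contMDiffOn_of_mem_maximalAtlas he').comp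
    ((contMDiffOn_symm_of_mem_maximalAtlas he).mono inter_subset_left) fun y hy => hy.2)

theorem isOpen_transition_domain : IsOpen (e.target ∩ e.symm ⁻¹' e'.source) :=
  e.symm.isOpen_inter_preimage e'.open_source

theorem metricInChart_transition (he : e ∈ IsManifold.maximalAtlas (𝓡 n) ∞ M)
    (he' : e' ∈ IsManifold.maximalAtlas (𝓡 n) ∞ M)
    (k : ∀ p : M, TangentSpace (𝓡 n) p →L[ℝ] TangentSpace (𝓡 n) p →L[ℝ] ℝ)
    {y : EuclideanSpace ℝ (Fin n)} (hy : y ∈ e.target ∩ e.symm ⁻¹' e'.source) (i j : Fin n) :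
    metricInChart (𝓡 n) (stdBasis n) e k y i j =
      formOfMatrix (stdBasis n) (metricInChart (𝓡 n) (stdBasis n) e' k (e' (e.symm y)))
        (fderiv ℝ (fun y => e' (e.symm y)) y (stdBasis n i))
        (fderiv ℝ (fun y => e' (e.symm y)) y (stdBasis n j)) := by
  set τ : EuclideanSpace ℝ (Fin n) → EuclideanSpace ℝ (Fin n) := fun y => e' (e.symm y) with hτ
  have hopen := isOpen_transition_domain (e := e) (e' := e')
  have hτd : DifferentiableAt ℝ τ y :=
    ((contDiffOn_transition he he').contDiffAt (hopen.mem_nhds hy)).differentiableAt (by simp)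
  have hev : e.symm =ᶠ[𝓝 y] e'.symm ∘ τ := by
    filter_upwards [hopen.mem_nhds hy] with z hz
    exact (e'.left_inv hz.2).symm
  have hτy : τ y ∈ e'.target := e'.map_source hy.2
  have hpt : e.symm y = e'.symm (τ y) := hev.eq_of_nhds
  have hder : ∀ v : EuclideanSpace ℝ (Fin n), (mfderiv (𝓡 n) (𝓡 n) e.symm y v : EuclideanSpace ℝ (Fin n))
      = mfderiv (𝓡 n) (𝓡 n) e'.symm (τ y) (fderiv ℝ τ y v) := by
    intro v
    have h1 : HasMFDerivAt (𝓡 n) (𝓡 n) (e'.symm ∘ τ) y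
        ((mfderiv (𝓡 n) (𝓡 n) e'.symm (τ y)).comp (fderiv ℝ τ y)) :=
      HasMFDerivAt.comp y (mdifferentiableAt_chart_symm he' hτy).hasMFDerivAt
        hτd.hasFDerivAt.hasMFDerivAt
    have h2 := (h1.congr_of_eventuallyEq hev).mfderiv
    exact congrArg (fun L : EuclideanSpace ℝ (Fin n) →L[ℝ] EuclideanSpace ℝ (Fin n) => L v) h2
  -- The tangent space depends on the base point, which is known only up to a propositional
  -- equality; forms are therefore compared on the model space.
  have hk : ∀ p p' : M, p = p' → ∀ v w : EuclideanSpace ℝ (Fin n),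
      (k p : EuclideanSpace ℝ (Fin n) →L[ℝ] EuclideanSpace ℝ (Fin n) →L[ℝ] ℝ) v w =
      (k p' : EuclideanSpace ℝ (Fin n) →L[ℝ] EuclideanSpace ℝ (Fin n) →L[ℝ] ℝ) v w := by
    rintro p _ rfl v w; rfl
  set L : EuclideanSpace ℝ (Fin n) →L[ℝ] EuclideanSpace ℝ (Fin n) :=
    mfderiv (𝓡 n) (𝓡 n) e'.symm (τ y) with hL
  set β : EuclideanSpace ℝ (Fin n) →L[ℝ] EuclideanSpace ℝ (Fin n) →L[ℝ] ℝ := k (e'.symm (τ y))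
    with hβ
  have h2 : ∀ v w, formOfMatrix (stdBasis n) (metricInChart (𝓡 n) (stdBasis n) e' k (τ y)) v w =
      β (L v) (L w) := fun v w => by
    have := formOfMatrix_of (stdBasis n) (β.bilinearComp L L) v w
    exact this
  rw [h2]
  calc metricInChart (𝓡 n) (stdBasis n) e k y i j
      = (k (e.symm y) : EuclideanSpace ℝ (Fin n) →L[ℝ] EuclideanSpace ℝ (Fin n) →L[ℝ] ℝ)
        (mfderiv (𝓡 n) (𝓡 n) e.symm y (stdBasis n i))
        (mfderiv (𝓡 n) (𝓡 n) e.symm y (stdBasis n j)) := rfl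
    _ = β (mfderiv (𝓡 n) (𝓡 n) e.symm y (stdBasis n i))
        (mfderiv (𝓡 n) (𝓡 n) e.symm y (stdBasis n j)) := hk _ _ hpt _ _
    _ = _ := by
      have h3 := hder (stdBasis n i)
      have h4 := hder (stdBasis n j)
      exact congrArg₂ (fun v w => β v w) h3 h4

end MetricInChart

/-! ### A smooth family of metrics in a chart. -/

section ChartFamily

variable {n : ℕ} {M : Type*} [TopologicalSpace M] [ChartedSpace (EuclideanSpace ℝ (Fin n)) M]
  [IsManifold (𝓡 n) ∞ M] {e : OpenPartialHomeomorph M (EuclideanSpace ℝ (Fin n))} {ε : ℝ}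
  {k : ℝ → ∀ p : M, TangentSpace (𝓡 n) p →L[ℝ] TangentSpace (𝓡 n) p →L[ℝ] ℝ}

/-- The components of the family of metrics `k` in the chart `e`. -/
noncomputable def chartFamily
    (k : ℝ → ∀ p : M, TangentSpace (𝓡 n) p →L[ℝ] TangentSpace (𝓡 n) p →L[ℝ] ℝ)
    (e : OpenPartialHomeomorph M (EuclideanSpace ℝ (Fin n))) :
    EuclideanSpace ℝ (Fin n) × ℝ → Matrix (Fin n) (Fin n) ℝ :=
  fun q => metricInChart (𝓡 n) (stdBasis n) e (k q.2) q.1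

theorem mfderiv_chart_symm_injective (he : e ∈ IsManifold.maximalAtlas (𝓡 n) ∞ M)
    {y : EuclideanSpace ℝ (Fin n)} (hy : y ∈ e.target) :
    Function.Injective (mfderiv (𝓡 n) (𝓡 n) e.symm y) := by
  have h : e.MDifferentiable (𝓡 n) (𝓡 n) :=
    ⟨(contMDiffOn_of_mem_maximalAtlas he).mdifferentiableOn (by simp),
      (contMDiffOn_symm_of_mem_maximalAtlas he).mdifferentiableOn (by simp)⟩
  exact h.symm.mfderiv_injective hy

theorem contMDiffOn_collar_chart_symm (he : e ∈ IsManifold.maximalAtlas (𝓡 n) ∞ M) (I : Set ℝ) :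
    ContMDiffOn 𝓘(ℝ, EuclideanSpace ℝ (Fin n) × ℝ) (collarModel n) ∞
      (fun q : EuclideanSpace ℝ (Fin n) × ℝ => (e.symm q.1, q.2)) (e.target ×ˢ I) :=
  ((contMDiffOn_symm_of_mem_maximalAtlas he).comp contDiff_fst.contMDiff.contMDiffOn
    fun q hq => hq.1).prodMk contDiff_snd.contMDiff.contMDiffOn

theorem contMDiffOn_coordinate_field (he : e ∈ IsManifold.maximalAtlas (𝓡 n) ∞ M)
    (v : EuclideanSpace ℝ (Fin n)) :
    ContMDiffOn (𝓡 n) (𝓡 n).tangent ∞ (fun y => (TotalSpace.mk' (EuclideanSpace ℝ (Fin n))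
      (e.symm y) (mfderiv (𝓡 n) (𝓡 n) e.symm y v) : TangentBundle (𝓡 n) M)) e.target := by
  have h1 := (contMDiffOn_symm_of_mem_maximalAtlas he).contMDiffOn_tangentMapWithin (m := ∞)
    (by simp) e.open_target.uniqueMDiffOn
  have h2 : ContMDiff (𝓡 n) (𝓡 n).tangent ∞ (fun y => (⟨y, v⟩ :
      TangentBundle (𝓡 n) (EuclideanSpace ℝ (Fin n)))) :=
    contMDiff_vectorSpace_iff_contDiff.2 contDiff_const
  refine (h1.comp h2.contMDiffOn fun y hy => hy).congr fun y hy => ?_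
  simp only [Function.comp, tangentMapWithin, mfderivWithin_of_isOpen e.open_target hy]

/-- The coordinate fields are smooth sections along the inverse chart. A smooth section of the
bundle of forms evaluated on smooth sections is smooth, and this includes `x = 0`. -/
theorem IsSmoothMetricFamily.smooth_chartFamily (hk : IsSmoothMetricFamily ε k)
    (he : e ∈ IsManifold.maximalAtlas (𝓡 n) ∞ M) (i j : Fin n) :
    SmoothUpTo e.target ε (fun q => chartFamily k e q i j) := by
  have h1 := hk.smooth.comp (contMDiffOn_collar_chart_symm he (Ico 0 ε))
    fun q hq => ⟨mem_univ _, hq.2⟩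
  have h2 : ∀ i, ContMDiffOn 𝓘(ℝ, EuclideanSpace ℝ (Fin n) × ℝ) (𝓡 n).tangent ∞
      (fun q : EuclideanSpace ℝ (Fin n) × ℝ => (TotalSpace.mk' (EuclideanSpace ℝ (Fin n))
      (e.symm q.1) (mfderiv (𝓡 n) (𝓡 n) e.symm q.1 (stdBasis n i)) : TangentBundle (𝓡 n) M))
      (e.target ×ˢ Ico 0 ε) := fun i =>
    (contMDiffOn_coordinate_field he (stdBasis n i)).comp contDiff_fst.contMDiff.contMDiffOn
      fun q hq => hq.1
  have h3 : ContMDiffOn 𝓘(ℝ, EuclideanSpace ℝ (Fin n) × ℝ) ((𝓡 n).prod 𝓘(ℝ, ℝ)) ∞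
      (fun q : EuclideanSpace ℝ (Fin n) × ℝ => TotalSpace.mk' ℝ (E := Bundle.Trivial M ℝ)
        (e.symm q.1) (k q.2 (e.symm q.1) (mfderiv (𝓡 n) (𝓡 n) e.symm q.1 (stdBasis n i))
          (mfderiv (𝓡 n) (𝓡 n) e.symm q.1 (stdBasis n j)))) (e.target ×ˢ Ico 0 ε) :=
    ContMDiffOn.clm_bundle_apply₂ (F₁ := EuclideanSpace ℝ (Fin n))
      (F₂ := EuclideanSpace ℝ (Fin n)) h1 (h2 i) (h2 j)
  refine contMDiffOn_iff_contDiffOn.1 fun q hq => ?_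
  have := h3 q hq
  simp only [contMDiffWithinAt_totalSpace] at this
  exact this.2

theorem IsSmoothMetricFamily.isMetricFamily (hk : IsSmoothMetricFamily ε k)
    (he : e ∈ IsManifold.maximalAtlas (𝓡 n) ∞ M) :
    IsMetricFamily e.target ε (chartFamily k e) := by
  refine ⟨e.open_target, hk.smooth_chartFamily he, fun q hq => ?_⟩
  set L : EuclideanSpace ℝ (Fin n) →L[ℝ] EuclideanSpace ℝ (Fin n) :=
    mfderiv (𝓡 n) (𝓡 n) e.symm q.1 with hL
  set β : EuclideanSpace ℝ (Fin n) →L[ℝ] EuclideanSpace ℝ (Fin n) →L[ℝ] ℝ := k q.2 (e.symm q.1)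
    with hβ
  have hsymm : ∀ v w, β v w = β w v := hk.symm q.2 hq.2 (e.symm q.1)
  have hpos : ∀ v, v ≠ 0 → 0 < β v v := hk.pos q.2 hq.2 (e.symm q.1)
  have hinj : Function.Injective L := mfderiv_chart_symm_injective he hq.1
  have hent : ∀ i j, chartFamily k e q i j = β (L (stdBasis n i)) (L (stdBasis n j)) :=
    fun i j => rfl
  refine Matrix.PosDef.of_dotProduct_mulVec_pos ?_ fun x hx => ?_
  · ext i j
    simp only [Matrix.conjTranspose_apply, hent, star_trivial]
    exact hsymm _ _
  · have e1 : star x ⬝ᵥ (chartFamily k e q).mulVec x =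
        β (L (∑ i, x i • stdBasis n i)) (L (∑ i, x i • stdBasis n i)) := by
      simp only [dotProduct, Matrix.mulVec, hent, map_sum, map_smul, sum_apply, smul_apply,
        smul_eq_mul, Pi.star_apply, star_trivial, Finset.mul_sum]
      rw [Finset.sum_comm]
      refine Finset.sum_congr rfl fun i _ => Finset.sum_congr rfl fun j _ => ?_
      rw [hsymm]; ring
    rw [e1]
    refine hpos _ fun h0 => hx ?_
    have h1 : ∑ i, x i • stdBasis n i = 0 := hinj (h0.trans (map_zero L).symm)
    funext i
    have := congrArg (fun v => (stdBasis n).repr v i) h1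
    simpa [Finsupp.single_apply] using this

theorem HasNormalForm.metricInChart_eq
    {g : ∀ q : M × ℝ, TangentSpace (collarModel n) q →L[ℝ] TangentSpace (collarModel n) q →L[ℝ] ℝ}
    (hg : HasNormalForm ε k g) (he : e ∈ IsManifold.maximalAtlas (𝓡 n) ∞ M)
    {q : EuclideanSpace ℝ (Fin n) × ℝ} (hq : q ∈ e.target ×ˢ Ioo 0 ε) :
    metricInChart (collarModel n) (collarBasis n) (collarChart e) g q =
      collarMatrix (chartFamily k e) q := by
  set L : EuclideanSpace ℝ (Fin n) →L[ℝ] EuclideanSpace ℝ (Fin n) :=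
    mfderiv (𝓡 n) (𝓡 n) e.symm q.1 with hL
  set β : EuclideanSpace ℝ (Fin n) →L[ℝ] EuclideanSpace ℝ (Fin n) →L[ℝ] ℝ := k q.2 (e.symm q.1)
    with hβ
  have h1 : HasMFDerivAt 𝓘(ℝ, EuclideanSpace ℝ (Fin n) × ℝ) (𝓡 n)
      (fun q : EuclideanSpace ℝ (Fin n) × ℝ => e.symm q.1) q
      (L.comp (ContinuousLinearMap.fst ℝ (EuclideanSpace ℝ (Fin n)) ℝ)) :=
    HasMFDerivAt.comp q (mdifferentiableAt_chart_symm he hq.1).hasMFDerivAt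
      (hasFDerivAt_fst (𝕜 := ℝ)).hasMFDerivAt
  have h2 : HasMFDerivAt 𝓘(ℝ, EuclideanSpace ℝ (Fin n) × ℝ) 𝓘(ℝ, ℝ)
      (fun q : EuclideanSpace ℝ (Fin n) × ℝ => q.2) q
      (ContinuousLinearMap.snd ℝ (EuclideanSpace ℝ (Fin n)) ℝ) :=
    (hasFDerivAt_snd (𝕜 := ℝ)).hasMFDerivAt
  have h3 := (h1.prodMk h2).mfderiv
  have h4 : ∀ v s, (mfderiv 𝓘(ℝ, EuclideanSpace ℝ (Fin n) × ℝ) (collarModel n)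
      ((collarChart e).extend (collarModel n)).symm q ((v, s) : EuclideanSpace ℝ (Fin n) × ℝ) :
        EuclideanSpace ℝ (Fin n) × ℝ) = (L v, s) := fun v s =>
    congrArg (fun T : EuclideanSpace ℝ (Fin n) × ℝ →L[ℝ] EuclideanSpace ℝ (Fin n) × ℝ => T (v, s)) h3
  have h5 : ∀ v s w t, (g (e.symm q.1, q.2) : EuclideanSpace ℝ (Fin n) × ℝ →L[ℝ]
      EuclideanSpace ℝ (Fin n) × ℝ →L[ℝ] ℝ) (L v, s) (L w, t) =
      (q.2 ^ 2)⁻¹ * (β (L v) (L w) + s * t) := fun v s w t =>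
    hg (e.symm q.1) q.2 hq.2 (L v) (L w) s t
  have h6 : ∀ i j, metricInChart (collarModel n) (collarBasis n) (collarChart e) g q i j =
      (q.2 ^ 2)⁻¹ * (β (L (collarBasis n i).1) (L (collarBasis n j).1)
        + (collarBasis n i).2 * (collarBasis n j).2) := fun i j => by
    rw [← h5]
    exact congrArg₂ (fun v w => (g (e.symm q.1, q.2) : EuclideanSpace ℝ (Fin n) × ℝ →L[ℝ]
      EuclideanSpace ℝ (Fin n) × ℝ →L[ℝ] ℝ) v w) (h4 (collarBasis n i).1 (collarBasis n i).2)
      (h4 (collarBasis n j).1 (collarBasis n j).2)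
  have hent : ∀ i j, chartFamily k e q i j =
      β (L (stdBasis n i)) (L (stdBasis n j)) := fun i j => rfl
  ext i j
  rw [h6]
  rcases i with i | i <;> rcases j with j | j
  · simp [collarMatrix, hent]
  all_goals simp [collarMatrix]

end ChartFamily

/-! ### Smoothness of the Einstein defects up to the boundary. -/

namespace IsMetricFamily

variable {n : ℕ} {S : Set (EuclideanSpace ℝ (Fin n))} {ε : ℝ}
  {K : EuclideanSpace ℝ (Fin n) × ℝ → Matrix (Fin n) (Fin n) ℝ}

theorem smooth_sliceRicci (h : IsMetricFamily S ε K) (i j : Fin n) :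
    SmoothUpTo S ε (sliceRicci K i j) := by
  have hΓ := h.smooth_sliceChristoffel
  have hd : ∀ a k i j, SmoothUpTo S ε (tangDeriv a (sliceChristoffel K k i j)) := fun a k i j =>
    (hΓ k i j).halfDeriv h.isOpen _
  exact SmoothUpTo.add
    (ContDiffOn.sum fun k _ => (hd k k i j).sub (hd j k i k))
    (ContDiffOn.sum fun k _ => ContDiffOn.sum fun l _ =>
      ((hΓ k k l).mul (hΓ l i j)).sub ((hΓ k j l).mul (hΓ l i k)))

theorem smooth_tangentialDefect (h : IsMetricFamily S ε K) (i j : Fin n) :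
    SmoothUpTo S ε (tangentialDefect K i j) := by
  have hN : ∀ i j, SmoothUpTo S ε (normalDeriv fun z => K z i j) := fun i j =>
    (h.smooth i j).normalDeriv h.isOpen
  have hT := h.smooth_traceDeriv
  have hx : SmoothUpTo S ε (fun q : EuclideanSpace ℝ (Fin n) × ℝ => q.2) := smoothUpTo_snd
  exact (((((hx.mul (h.smooth_sliceRicci i j)).add
    ((SmoothUpTo.const _).mul (hx.mul ((hN i j).normalDeriv h.isOpen)))).add
    ((SmoothUpTo.const _).mul (hN i j))).add
    ((SmoothUpTo.const _).mul ((h.smooth i j).mul hT))).add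
    ((SmoothUpTo.const _).mul (hx.mul (hT.mul (hN i j))))).add
    ((SmoothUpTo.const _).mul (hx.mul (ContDiffOn.sum fun k _ => ContDiffOn.sum fun l _ =>
      (hN i k).mul ((h.smooth_inv k l).mul (hN j l)))))

theorem smooth_normalDefect (h : IsMetricFamily S ε K) : SmoothUpTo S ε (normalDefect K) := by
  have hN : ∀ i j, SmoothUpTo S ε (normalDeriv fun z => K z i j) := fun i j =>
    (h.smooth i j).normalDeriv h.isOpen
  have hT := h.smooth_traceDeriv
  have hx : SmoothUpTo S ε (fun q : EuclideanSpace ℝ (Fin n) × ℝ => q.2) := smoothUpTo_snd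
  exact (((SmoothUpTo.const _).mul (hx.mul (hT.normalDeriv h.isOpen))).add
    ((SmoothUpTo.const _).mul hT)).add
    ((SmoothUpTo.const _).mul (hx.mul (ContDiffOn.sum fun i _ => ContDiffOn.sum fun j _ =>
      ContDiffOn.sum fun k _ => ContDiffOn.sum fun l _ =>
        ((h.smooth_inv i j).mul (hN j k)).mul ((h.smooth_inv k l).mul (hN l i)))))

theorem smooth_traceDefect (h : IsMetricFamily S ε K) : SmoothUpTo S ε (traceDefect K) :=
  SmoothUpTo.add (ContDiffOn.sum fun i _ => ContDiffOn.sum fun j _ =>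
    (h.smooth_inv i j).mul (h.smooth_tangentialDefect i j)) h.smooth_normalDefect

/-- The inverse metric supplies `x²`, while each defect is `x` times a component of the Einstein
tensor; one factor `x` remains. -/
theorem trace_collarMatrix (h : IsMetricFamily S ε K) {q : EuclideanSpace ℝ (Fin n) × ℝ}
    (hq : q ∈ S ×ˢ Ioo 0 ε) :
    ∑ i, ∑ j, (collarMatrix K q)⁻¹ i j * (ricciCoord (collarBasis n) (collarMatrix K) i j q
      + n * collarMatrix K q i j) = q.2 * traceDefect K q := by
  rw [h.inv_collarMatrix hq, Fintype.sum_sum_type]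
  simp only [Fintype.sum_sum_type, Matrix.smul_apply, Matrix.fromBlocks_apply₁₁,
    Matrix.fromBlocks_apply₁₂, Matrix.fromBlocks_apply₂₁, Matrix.fromBlocks_apply₂₂,
    Matrix.zero_apply, smul_eq_mul, traceDefect, mul_add (q.2), Finset.mul_sum, ← h.ricciCoord_normal hq () (),
    ← h.ricciCoord_tangential hq]
  simp
  refine congrArg₂ (· + ·) (Finset.sum_congr rfl fun i _ => Finset.sum_congr rfl fun j _ => ?_) ?_
  all_goals ring

end IsMetricFamily

/-! ### From decay to vanishing Taylor coefficients. -/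

section Vanishing

variable {V : Type*} [NormedAddCommGroup V] [NormedSpace ℝ V] {S : Set V} {ε : ℝ} {f : V × ℝ → ℝ}

theorem SmoothUpTo.coeff_eq_zero_of_isBigO (hS : IsOpen S) (hε : 0 < ε) (hf : SmoothUpTo S ε f)
    {N : ℕ} (h : IsBigOAtBoundary S f fun x => x ^ N) {y : V} (hy : y ∈ S) {m : ℕ} (hm : m < N) :
    PowerSeries.coeff m (bdrySeries f y) = 0 := by
  induction m using Nat.strong_induction_on with
  | _ m ih =>
    exact coeff_eq_zero_of_isLittleO hS hε hf hy (fun j hj => ih j hj (hj.trans hm))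
      ((h.at_point hy).trans_isLittleO
        ((Asymptotics.isLittleO_pow_pow (𝕜 := ℝ) hm).mono nhdsWithin_le_nhds))

end Vanishing

/-! ### A Poincaré metric and its Laplacian in a chart. -/

section PoincareChart

variable {n : ℕ} {M : Type*} [TopologicalSpace M] [ChartedSpace (EuclideanSpace ℝ (Fin n)) M]
  [IsManifold (𝓡 n) ∞ M] {e e' : OpenPartialHomeomorph M (EuclideanSpace ℝ (Fin n))} {ε : ℝ}
  {k : ℝ → ∀ p : M, TangentSpace (𝓡 n) p →L[ℝ] TangentSpace (𝓡 n) p →L[ℝ] ℝ}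
  {g : ∀ q : M × ℝ, TangentSpace (collarModel n) q →L[ℝ] TangentSpace (collarModel n) q →L[ℝ] ℝ}
  {q : EuclideanSpace ℝ (Fin n) × ℝ}

theorem HasNormalForm.metricInChart_eventuallyEq (hg : HasNormalForm ε k g)
    (he : e ∈ IsManifold.maximalAtlas (𝓡 n) ∞ M) (hq : q ∈ e.target ×ˢ Ioo 0 ε) :
    metricInChart (collarModel n) (collarBasis n) (collarChart e) g =ᶠ[𝓝 q]
      collarMatrix (chartFamily k e) :=
  mem_of_superset ((e.open_target.prod isOpen_Ioo).mem_nhds hq) fun _ hz =>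
    hg.metricInChart_eq he hz

theorem HasNormalForm.einsteinDefect_eq (hg : HasNormalForm ε k g)
    (he : e ∈ IsManifold.maximalAtlas (𝓡 n) ∞ M) (hq : q ∈ e.target ×ˢ Ioo 0 ε)
    (i j : Fin n ⊕ Unit) :
    einsteinDefect g e i j q = ricciCoord (collarBasis n) (collarMatrix (chartFamily k e)) i j q
      + n * collarMatrix (chartFamily k e) q i j := by
  rw [einsteinDefect, (hg.metricInChart_eventuallyEq he hq).ricciCoord_eq,
    hg.metricInChart_eq he hq]

/-- The coordinate representation of a Poincaré metric in a chart. -/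
noncomputable def IsPoincareMetric.toPoincareData {h : SmoothMetric n M}
    (hg : IsPoincareMetric ε h g) (hε : 0 < ε) (hn : 2 < n) (hk : IsSmoothMetricFamily ε k)
    (hnf : HasNormalForm ε k g) (he : e ∈ IsManifold.maximalAtlas (𝓡 n) ∞ M) :
    PoincareData n where
  S := e.target
  ε := ε
  K := chartFamily k e
  isOpen := e.open_target
  ε_pos := hε
  smooth := hk.smooth_chartFamily he
  posDef := (hk.isMetricFamily he).posDef
  tangential := by
    intro i j y hy m hm
    have hK := hk.isMetricFamily he
    -- The extra factor `x` in the defect improves `O(xⁿ⁻²)` to `O(xⁿ⁻¹)`, which covers exactly the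
    -- orders `m < n - 1`.
    refine (hK.smooth_tangentialDefect i j).coeff_eq_zero_of_isBigO e.open_target hε (N := n - 1)
      ?_ hy (by omega)
    have h1 := (IsBigOAtBoundary.of_snd (fun x : ℝ => x)).mul
      (hg.einstein e he (Sum.inl i) (Sum.inl j))
    have e1 : (fun x : ℝ => x * x ^ (n - 2)) = fun x => x ^ (n - 1) := by
      funext x
      rw [← pow_succ']
      congr 1; omega
    rw [e1] at h1
    refine h1.congr' hε fun q hq => ?_
    rw [hnf.einsteinDefect_eq he hq, hK.ricciCoord_tangential hq]
  trace := by
    intro y hy m hm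
    have hK := hk.isMetricFamily he
    -- Division by `x` leaves `O(xⁿ⁺¹)`, enough for all orders below `n`.
    refine hK.smooth_traceDefect.coeff_eq_zero_of_isBigO e.open_target hε (N := n + 1)
      ?_ hy (by omega)
    have h1 := (IsBigOAtBoundary.of_snd (fun x : ℝ => x⁻¹)).mul (hg.trace_einstein e he)
    refine (h1.trans (w' := fun x : ℝ => x ^ (n + 1)) ?_).congr' hε fun q hq => ?_
    · refine EventuallyEq.isBigO ?_
      filter_upwards [self_mem_nhdsWithin] with x hx
      have : x ≠ 0 := ne_of_gt hx
      rw [show n + 2 = n + 1 + 1 from rfl, pow_succ]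
      field_simp
    · simp only [hnf.einsteinDefect_eq he hq, hnf.metricInChart_eq he hq, hK.trace_collarMatrix hq]
      have := hq.2.1.ne'
      field_simp

theorem IsPoincareMetric.toPoincareData_jet {h : SmoothMetric n M}
    (hg : IsPoincareMetric ε h g) (hε : 0 < ε) (hn : 2 < n) (hk : IsSmoothMetricFamily ε k)
    (hk0 : k 0 = h.inner)
    (hnf : HasNormalForm ε k g) (he : e ∈ IsManifold.maximalAtlas (𝓡 n) ∞ M)
    (y : EuclideanSpace ℝ (Fin n)) :
    (hg.toPoincareData hε hn hk hnf he).jet y = metricJet h e y := by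
  have h1 : (fun z => chartFamily k e (z, 0)) =
      metricInChart (𝓡 n) (stdBasis n) e h.inner := by
    funext z
    rw [chartFamily, hk0]
  change matrixJet (fun z => chartFamily k e (z, 0)) y = _
  rw [h1]
  funext v
  rcases v with ⟨i, j⟩ | ⟨l, i, j⟩ <;> rfl

/-- The Laplacian of `g` in the chart induced by an arbitrary chart of `M`. -/
theorem HasNormalForm.laplacian_eq (hnf : HasNormalForm ε k g) (hk : IsSmoothMetricFamily ε k)
    (he : e ∈ IsManifold.maximalAtlas (𝓡 n) ∞ M) {U : M × ℝ → ℝ}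
    (hU : ContMDiffOn (collarModel n) 𝓘(ℝ, ℝ) ∞ U (univ ×ˢ Ioo 0 ε))
    (hq : q ∈ e.target ×ˢ Ioo 0 ε) :
    laplacian (collarModel n) (collarBasis n) g U (e.symm q.1, q.2) =
      laplacianCoord (collarBasis n) (collarMatrix (chartFamily k e))
        (fun z => U (e.symm z.1, z.2)) q := by
  set c := chartAt (EuclideanSpace ℝ (Fin n)) (e.symm q.1) with hc
  have hcm : c ∈ IsManifold.maximalAtlas (𝓡 n) ∞ M := IsManifold.chart_mem_maximalAtlas _
  have hcs : e.symm q.1 ∈ c.source := mem_chart_source _ _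
  have hsm : ∀ e ∈ IsManifold.maximalAtlas (𝓡 n) ∞ M, ContDiffOn ℝ ∞
      (fun z : EuclideanSpace ℝ (Fin n) × ℝ => U (e.symm z.1, z.2)) (e.target ×ˢ Ioo 0 ε) :=
    fun e he => contMDiffOn_iff_contDiffOn.1
      (hU.comp (contMDiffOn_collar_chart_symm he _) fun z hz => ⟨mem_univ _, hz.2⟩)
  have hqc : (c (e.symm q.1), q.2) ∈ c.target ×ˢ Ioo 0 ε := ⟨c.map_source hcs, hq.2⟩
  -- The preferred chart of `M × ℝ` is by definition the collar chart of the preferred chart of `M`.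
  have h1 : laplacian (collarModel n) (collarBasis n) g U (e.symm q.1, q.2) =
      laplacianCoord (collarBasis n)
        (metricInChart (collarModel n) (collarBasis n) (collarChart c) g)
        (fun z => U (c.symm z.1, z.2)) (c (e.symm q.1), q.2) := rfl
  have hqm : q ∈ (e.target ∩ e.symm ⁻¹' c.source) ×ˢ Ioo 0 ε := ⟨⟨hq.1, hcs⟩, hq.2⟩
  have hopen := isOpen_transition_domain (e := e) (e' := c)
  rw [h1, (hnf.metricInChart_eventuallyEq hcm hqc).laplacianCoord_eq _ EventuallyEq.rfl,
    ← ((hk.isMetricFamily he).mono hopen inter_subset_left).laplacianCoord_comp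
      (hk.isMetricFamily hcm) (τ := fun y => c (e.symm y)) (contDiffOn_transition he hcm)
      (fun y hy => c.map_source hy.2)
      (fun z hz i j => metricInChart_transition he hcm (k z.2) hz.1 i j) hqm
      ((hsm c hcm).contDiffAt ((c.open_target.prod isOpen_Ioo).mem_nhds hqc))]
  refine EventuallyEq.rfl.laplacianCoord_eq _ ?_
  filter_upwards [(hopen.prod isOpen_Ioo).mem_nhds hqm] with z hz
  simp only [c.left_inv hz.1.2]

end PoincareChart

/-! ### From charts to the manifold. -/

section Globalization

variable {n : ℕ} {M : Type*} [TopologicalSpace M] [ChartedSpace (EuclideanSpace ℝ (Fin n)) M]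

/-- Induction on compact sets: the bound passes to subsets and unions, and each point has a
neighbourhood that its chart maps into a compact subset of the chart target. -/
theorem IsBigOAtBoundary.of_charts {f : M × ℝ → ℝ} {w : ℝ → ℝ}
    (h : ∀ p : M, IsBigOAtBoundary (chartAt (EuclideanSpace ℝ (Fin n)) p).target
      (fun q => f ((chartAt (EuclideanSpace ℝ (Fin n)) p).symm q.1, q.2)) w) :
    IsBigOAtBoundary univ f w := by
  intro C _ hC
  refine hC.induction_on (p := fun s => f =O[𝓟 s ×ˢ 𝓝[>] (0 : ℝ)] fun q => w q.2) ?_ ?_ ?_ ?_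
  · simp
  · exact fun s t hst ht => ht.mono (prod_mono (principal_mono.2 hst) le_rfl)
  · intro s t hs ht
    rw [← sup_principal, sup_prod]
    exact hs.sup ht
  · intro p _
    set e := chartAt (EuclideanSpace ℝ (Fin n)) p with he
    have hp : p ∈ e.source := mem_chart_source _ p
    obtain ⟨D, hD, hDt, hDc⟩ := local_compact_nhds (e.open_target.mem_nhds (e.map_source hp))
    refine ⟨e.source ∩ e ⁻¹' D, mem_nhdsWithin_of_mem_nhds
      (inter_mem (e.open_source.mem_nhds hp) ((e.continuousAt hp).preimage_mem_nhds hD)), ?_⟩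
    have ht : Tendsto (fun q : M × ℝ => (e q.1, q.2)) (𝓟 (e.source ∩ e ⁻¹' D) ×ˢ 𝓝[>] 0)
        (𝓟 D ×ˢ 𝓝[>] 0) :=
      Tendsto.prodMap (tendsto_principal_principal.2 fun y hy => hy.2) tendsto_id
    refine ((h p D hDt hDc).comp_tendsto ht).congr' ?_ EventuallyEq.rfl
    have : ∀ᶠ q in 𝓟 (e.source ∩ e ⁻¹' D) ×ˢ 𝓝[>] (0 : ℝ), q.1 ∈ e.source :=
      tendsto_fst.eventually (eventually_principal.2 fun y hy => hy.1)
    filter_upwards [this] with q hq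
    simp only [Function.comp, ← he, e.left_inv hq]

theorem contMDiffOn_of_charts [IsManifold (𝓡 n) ∞ M] {f : M × ℝ → ℝ} {I : Set ℝ}
    (h : ∀ p : M, ContDiffOn ℝ ∞ (fun q : EuclideanSpace ℝ (Fin n) × ℝ =>
      f ((chartAt (EuclideanSpace ℝ (Fin n)) p).symm q.1, q.2))
        ((chartAt (EuclideanSpace ℝ (Fin n)) p).target ×ˢ I)) :
    ContMDiffOn (collarModel n) 𝓘(ℝ, ℝ) ∞ f (univ ×ˢ I) := by
  rintro ⟨p, x⟩ ⟨-, hx⟩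
  set e := chartAt (EuclideanSpace ℝ (Fin n)) p with he
  have hp : p ∈ e.source := mem_chart_source _ p
  have h1 : ContMDiffOn (collarModel n) (𝓡 n) ∞ (fun q : M × ℝ => e q.1) (e.source ×ˢ I) :=
    (contMDiffOn_of_mem_maximalAtlas (IsManifold.chart_mem_maximalAtlas p)).comp
      contMDiff_fst.contMDiffOn fun q hq => hq.1
  have h2 : ContMDiffOn (collarModel n) 𝓘(ℝ, EuclideanSpace ℝ (Fin n) × ℝ) ∞
      (fun q : M × ℝ => (e q.1, q.2)) (e.source ×ˢ I) :=
    h1.prodMk_space contMDiff_snd.contMDiffOn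
  have h3 : ContMDiffOn (collarModel n) 𝓘(ℝ, ℝ) ∞ f (e.source ×ˢ I) :=
    ((contMDiffOn_iff_contDiffOn.2 (h p)).comp h2 fun q hq => ⟨e.map_source hq.1, hq.2⟩).congr
      fun q hq => by simp only [Function.comp, ← he, e.left_inv hq.1]
  refine (h3 (p, x) ⟨hp, hx⟩).mono_of_mem_nhdsWithin ?_
  exact mem_nhdsWithin.2 ⟨e.source ×ˢ univ, e.open_source.prod isOpen_univ, ⟨hp, mem_univ _⟩,
    fun q hq => ⟨hq.1.1, hq.2.2⟩⟩

end Globalization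

/-! ### The theorem on the manifold. -/

section Main

variable {n : ℕ} {M : Type*} [TopologicalSpace M] [ChartedSpace (EuclideanSpace ℝ (Fin n)) M]
  [IsManifold (𝓡 n) ∞ M] {e e' : OpenPartialHomeomorph M (EuclideanSpace ℝ (Fin n))} {ε : ℝ}
  {k : ℝ → ∀ p : M, TangentSpace (𝓡 n) p →L[ℝ] TangentSpace (𝓡 n) p →L[ℝ] ℝ}
  {g : ∀ q : M × ℝ, TangentSpace (collarModel n) q →L[ℝ] TangentSpace (collarModel n) q →L[ℝ] ℝ}
  {h : SmoothMetric n M} {U A B U' A' B' : M × ℝ → ℝ}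

theorem IsFormalSolution.isLocalSolution (hU : IsFormalSolution ε g U A B) (hε : 0 < ε)
    (hk : IsSmoothMetricFamily ε k) (hnf : HasNormalForm ε k g)
    (he : e ∈ IsManifold.maximalAtlas (𝓡 n) ∞ M) :
    IsLocalSolution e.target ε (chartFamily k e) (fun q => U (e.symm q.1, q.2))
      (fun q => A (e.symm q.1, q.2)) (fun q => B (e.symm q.1, q.2)) := by
  have hc := e.symm.continuousOn
  have hm : MapsTo e.symm e.target univ := fun _ _ => mem_univ _
  refine ⟨?_, ?_, ?_, fun y _ => hU.A_boundary _, hU.expansion.comp hc hm,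
    (hU.equation.comp hc hm).congr' hε fun q hq => ?_⟩
  · exact contMDiffOn_iff_contDiffOn.1
      (hU.smooth_U.comp (contMDiffOn_collar_chart_symm he _) fun z hz => ⟨mem_univ _, hz.2⟩)
  · exact contMDiffOn_iff_contDiffOn.1
      (hU.smooth_A.comp (contMDiffOn_collar_chart_symm he _) fun z hz => ⟨mem_univ _, hz.2⟩)
  · exact contMDiffOn_iff_contDiffOn.1
      (hU.smooth_B.comp (contMDiffOn_collar_chart_symm he _) fun z hz => ⟨mem_univ _, hz.2⟩)
  · rw [hnf.laplacian_eq hk he hU.smooth_U hq]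

/-- The polynomials `P j` and `Q` in the jet of the boundary metric define a formal solution for
every Poincaré metric in coordinates. -/
def DefinesFormalSolution (P : ℕ → MvPolynomial (JetVar n) ℝ) (Q : MvPolynomial (JetVar n) ℝ) :
    Prop :=
  ∀ d : PoincareData n, IsLocalSolution d.S d.ε d.K
    (fun q => Real.log q.2
      + ∑ j ∈ Finset.range n, MvPolynomial.eval (d.jet q.1) (P j) * q.2 ^ j
      + MvPolynomial.eval (d.jet q.1) Q * q.2 ^ n * Real.log q.2)
    (fun q => ∑ j ∈ Finset.range n, MvPolynomial.eval (d.jet q.1) (P j) * q.2 ^ j)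
    (fun q => MvPolynomial.eval (d.jet q.1) Q)

theorem exists_definesFormalSolution (hn : 0 < n) :
    ∃ (P : ℕ → MvPolynomial (JetVar n) ℝ) (Q : MvPolynomial (JetVar n) ℝ),
      DefinesFormalSolution P Q := by
  obtain ⟨P, Q, hP, h⟩ := exists_formal_solution (n := n) hn
  exact ⟨P, Q, fun d => d.isLocalSolution hn hP (h d).1 (h d).2⟩

variable {P : ℕ → MvPolynomial (JetVar n) ℝ} {Q : MvPolynomial (JetVar n) ℝ}

namespace IsPoincareMetric

theorem isLocalSolution (hg : IsPoincareMetric ε h g) (hPQ : DefinesFormalSolution P Q)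
    (hε : 0 < ε) (hn : 2 < n) (hk : IsSmoothMetricFamily ε k) (hk0 : k 0 = h.inner)
    (hnf : HasNormalForm ε k g) (he : e ∈ IsManifold.maximalAtlas (𝓡 n) ∞ M) :
    IsLocalSolution e.target ε (chartFamily k e)
      (fun q => Real.log q.2
        + ∑ j ∈ Finset.range n, MvPolynomial.eval (metricJet h e q.1) (P j) * q.2 ^ j
        + MvPolynomial.eval (metricJet h e q.1) Q * q.2 ^ n * Real.log q.2)
      (fun q => ∑ j ∈ Finset.range n, MvPolynomial.eval (metricJet h e q.1) (P j) * q.2 ^ j)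
      (fun q => MvPolynomial.eval (metricJet h e q.1) Q) := by
  have h1 := hPQ (hg.toPoincareData hε hn hk hnf he)
  simp only [hg.toPoincareData_jet hε hn hk hk0 hnf he] at h1
  exact h1

theorem contDiffOn_eval_metricJet (hg : IsPoincareMetric ε h g)
    (hε : 0 < ε) (hn : 2 < n) (hk : IsSmoothMetricFamily ε k) (hk0 : k 0 = h.inner)
    (hnf : HasNormalForm ε k g) (he : e ∈ IsManifold.maximalAtlas (𝓡 n) ∞ M)
    (R : MvPolynomial (JetVar n) ℝ) :
    ContDiffOn ℝ ∞ (fun y => MvPolynomial.eval (metricJet h e y) R) e.target := by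
  have h1 := (hg.toPoincareData hε hn hk hnf he).contDiffOn_eval_jet R
  simp only [hg.toPoincareData_jet hε hn hk hk0 hnf he] at h1
  exact h1

/-- The values of the polynomials `P j` and `Q` do not depend on the chart. -/
theorem eval_metricJet_transition (hg : IsPoincareMetric ε h g) (hPQ : DefinesFormalSolution P Q)
    (hε : 0 < ε) (hn : 2 < n) (hk : IsSmoothMetricFamily ε k) (hk0 : k 0 = h.inner)
    (hnf : HasNormalForm ε k g) (he : e ∈ IsManifold.maximalAtlas (𝓡 n) ∞ M)
    (he' : e' ∈ IsManifold.maximalAtlas (𝓡 n) ∞ M) {y : EuclideanSpace ℝ (Fin n)}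
    (hy : y ∈ e.target ∩ e.symm ⁻¹' e'.source) :
    (∀ j < n, MvPolynomial.eval (metricJet h e y) (P j) =
      MvPolynomial.eval (metricJet h e' (e' (e.symm y))) (P j)) ∧
    MvPolynomial.eval (metricJet h e y) Q =
      MvPolynomial.eval (metricJet h e' (e' (e.symm y))) Q := by
  have hopen := isOpen_transition_domain (e := e) (e' := e')
  have hK := (hk.isMetricFamily he).mono hopen inter_subset_left
  have hm : MapsTo (fun y => e' (e.symm y)) (e.target ∩ e.symm ⁻¹' e'.source) e'.target :=
    fun y hy => e'.map_source hy.2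
  have hτ := contDiffOn_transition he he'
  have h1 := (hg.isLocalSolution hPQ hε hn hk hk0 hnf he).mono
    (S' := e.target ∩ e.symm ⁻¹' e'.source) inter_subset_left
  -- The solution built in `e'` and rewritten in the coordinates of `e` solves the same problem as
  -- the one built in `e`. Uniqueness identifies their coefficients, so no transformation law of the
  -- polynomials has to be known.
  have h2 := (hg.isLocalSolution hPQ hε hn hk hk0 hnf he').comp hK (hk.isMetricFamily he') hε
    hτ hm (fun z hz i j => metricInChart_transition he he' (k z.2) hz.1 i j)
  obtain ⟨h3, h4⟩ := h1.unique h2 hK hε (by omega)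
  refine ⟨fun j hj => ?_, h4 y hy⟩
  have h5 := h3 j hj y hy
  rwa [coeff_bdrySeries_polynomial hopen hε
      (c := fun j y => MvPolynomial.eval (metricJet h e y) (P j))
      (fun j _ => (hg.contDiffOn_eval_metricJet hε hn hk hk0 hnf he (P j)).mono inter_subset_left)
      hy hj,
    coeff_bdrySeries_polynomial hopen hε
      (c := fun j y => MvPolynomial.eval (metricJet h e' (e' (e.symm y))) (P j))
      (fun j _ => (hg.contDiffOn_eval_metricJet hε hn hk hk0 hnf he' (P j)).comp hτ hm)
      hy hj] at h5

/-- Chart independence turns the polynomials into functions on `M`, defined at each point by its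
preferred chart, and all conditions are checked chart by chart. No partition of unity is needed. -/
theorem exists_isFormalSolution (hg : IsPoincareMetric ε h g) (hPQ : DefinesFormalSolution P Q)
    (hε : 0 < ε) (hn : 2 < n) (hk : IsSmoothMetricFamily ε k) (hk0 : k 0 = h.inner)
    (hnf : HasNormalForm ε k g) :
    ∃ U A B : M × ℝ → ℝ, IsFormalSolution ε g U A B ∧ ∀ (p : M), ∀ x ∈ Ioo 0 ε,
      U (p, x) = Real.log x + A (p, x) + B (p, x) * x ^ n * Real.log x := by
  set a : MvPolynomial (JetVar n) ℝ → M → ℝ := fun R p => MvPolynomial.eval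
    (metricJet h (chartAt (EuclideanSpace ℝ (Fin n)) p)
      (chartAt (EuclideanSpace ℝ (Fin n)) p p)) R with ha
  have hchart : ∀ e ∈ IsManifold.maximalAtlas (𝓡 n) ∞ M, ∀ y ∈ e.target,
      (∀ j < n, a (P j) (e.symm y) = MvPolynomial.eval (metricJet h e y) (P j)) ∧
      a Q (e.symm y) = MvPolynomial.eval (metricJet h e y) Q := fun e he y hy => by
    obtain ⟨h1, h2⟩ := hg.eval_metricJet_transition hPQ hε hn hk hk0 hnf he
      (IsManifold.chart_mem_maximalAtlas (e.symm y)) ⟨hy, mem_chart_source _ (e.symm y)⟩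
    exact ⟨fun j hj => (h1 j hj).symm, h2.symm⟩
  set A : M × ℝ → ℝ := fun q => ∑ j ∈ Finset.range n, a (P j) q.1 * q.2 ^ j with hA
  set B : M × ℝ → ℝ := fun q => a Q q.1 with hB
  set U : M × ℝ → ℝ := fun q => Real.log q.2 + A q + B q * q.2 ^ n * Real.log q.2 with hU
  have hAe : ∀ e ∈ IsManifold.maximalAtlas (𝓡 n) ∞ M, ∀ y ∈ e.target, ∀ x : ℝ,
      A (e.symm y, x) =
        ∑ j ∈ Finset.range n, MvPolynomial.eval (metricJet h e y) (P j) * x ^ j :=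
    fun e he y hy x => Finset.sum_congr rfl fun j hj => by
      rw [(hchart e he y hy).1 j (Finset.mem_range.1 hj)]
  have hBe : ∀ e ∈ IsManifold.maximalAtlas (𝓡 n) ∞ M, ∀ y ∈ e.target, ∀ x : ℝ,
      B (e.symm y, x) = MvPolynomial.eval (metricJet h e y) Q :=
    fun e he y hy x => (hchart e he y hy).2
  have hUe : ∀ e ∈ IsManifold.maximalAtlas (𝓡 n) ∞ M, ∀ y ∈ e.target, ∀ x : ℝ,
      U (e.symm y, x) = Real.log x
        + ∑ j ∈ Finset.range n, MvPolynomial.eval (metricJet h e y) (P j) * x ^ j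
        + MvPolynomial.eval (metricJet h e y) Q * x ^ n * Real.log x := fun e he y hy x => by
    simp only [hU, hAe e he y hy, hBe e he y hy]
  have hcm : ∀ p : M, chartAt (EuclideanSpace ℝ (Fin n)) p ∈ IsManifold.maximalAtlas (𝓡 n) ∞ M :=
    fun p => IsManifold.chart_mem_maximalAtlas p
  have hloc := fun p => hg.isLocalSolution hPQ hε hn hk hk0 hnf (hcm p)
  have hsU : ContMDiffOn (collarModel n) 𝓘(ℝ, ℝ) ∞ U (univ ×ˢ Ioo 0 ε) :=
    contMDiffOn_of_charts fun p => (hloc p).smooth_U.congr fun q hq => hUe _ (hcm p) _ hq.1 _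
  refine ⟨U, A, B, ⟨hsU, ?_, ?_, fun p => ?_, ?_, ?_⟩, fun p x _ => rfl⟩
  · exact contMDiffOn_of_charts fun p => ContDiffOn.congr (hloc p).smooth_A
      fun q hq => hAe _ (hcm p) _ hq.1 _
  · exact contMDiffOn_of_charts fun p => ContDiffOn.congr (hloc p).smooth_B
      fun q hq => hBe _ (hcm p) _ hq.1 _
  · set e := chartAt (EuclideanSpace ℝ (Fin n)) p
    have hp : p ∈ e.source := mem_chart_source _ p
    have h1 := (hloc p).A_boundary (e p) (e.map_source hp)
    have h2 := hAe e (hcm p) (e p) (e.map_source hp) 0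
    rw [e.left_inv hp] at h2
    exact h2.trans h1
  · intro C _ _
    simp only [hU, sub_self]
    exact Asymptotics.isBigO_zero _ _
  · refine IsBigOAtBoundary.of_charts fun p => (hloc p).equation.congr' hε fun q hq => ?_
    rw [hnf.laplacian_eq hk (hcm p) hsU hq]
    congr 1
    refine EventuallyEq.rfl.laplacianCoord_eq _ ?_
    filter_upwards [((chartAt (EuclideanSpace ℝ (Fin n)) p).open_target.prod
      isOpen_Ioo).mem_nhds hq] with z hz
    exact hUe _ (hcm p) _ hz.1 _

/-- The given solution and the polynomial one solve the same problem in the chart. Equality of the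
coefficients of `A` below order `n` becomes an `O(xⁿ)` bound because both functions are smooth up to
the boundary. -/
theorem expansion_of_isFormalSolution (hg : IsPoincareMetric ε h g)
    (hPQ : DefinesFormalSolution P Q)
    (hε : 0 < ε) (hn : 2 < n) (hk : IsSmoothMetricFamily ε k) (hk0 : k 0 = h.inner)
    (hnf : HasNormalForm ε k g) (hU : IsFormalSolution ε g U A B)
    (he : e ∈ IsManifold.maximalAtlas (𝓡 n) ∞ M) :
    IsBigOAtBoundary e.target (fun y => A (e.symm y.1, y.2)
        - ∑ j ∈ Finset.range n, MvPolynomial.eval (metricJet h e y.1) (P j) * y.2 ^ j)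
      (fun x => x ^ n) ∧
    ∀ y ∈ e.target, B (e.symm y, 0) = MvPolynomial.eval (metricJet h e y) Q := by
  have h1 := hU.isLocalSolution hε hk hnf he
  have h2 := hg.isLocalSolution hPQ hε hn hk hk0 hnf he
  obtain ⟨h3, h4⟩ := h1.unique h2 (hk.isMetricFamily he) hε (by omega)
  refine ⟨?_, h4⟩
  have h5 := h1.smooth_A.sub h2.smooth_A
  refine h5.isBigOAtBoundary e.open_target hε fun j hj y hy => ?_
  rw [bdrySeries_sub e.open_target hε h1.smooth_A h2.smooth_A hy, map_sub, h3 j hj y hy, sub_self]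

/-- In a chart `A - A'` is `O(xⁿ)`, and `B - B'` vanishes on the boundary, hence is `O(x)`. This
factor `x` absorbs the logarithm in `(B - B') xⁿ log x`. -/
theorem sub_isBigO (hg : IsPoincareMetric ε h g)
    (hε : 0 < ε) (hn : 2 < n) (hk : IsSmoothMetricFamily ε k)
    (hnf : HasNormalForm ε k g) (hU : IsFormalSolution ε g U A B)
    (hU' : IsFormalSolution ε g U' A' B') :
    IsBigOAtBoundary univ (fun q => U q - U' q) (fun x => x ^ n) := by
  refine IsBigOAtBoundary.of_charts (n := n) fun p => ?_
  set e := chartAt (EuclideanSpace ℝ (Fin n)) p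
  have he : e ∈ IsManifold.maximalAtlas (𝓡 n) ∞ M := IsManifold.chart_mem_maximalAtlas p
  have h1 := hU.isLocalSolution hε hk hnf he
  have h2 := hU'.isLocalSolution hε hk hnf he
  obtain ⟨h3, h4⟩ := h1.unique h2 (hk.isMetricFamily he) hε (by omega)
  have hA := (h1.smooth_A.sub h2.smooth_A).isBigOAtBoundary e.open_target hε (m := n)
    fun j hj y hy => by
      rw [bdrySeries_sub e.open_target hε h1.smooth_A h2.smooth_A hy, map_sub, h3 j hj y hy,
        sub_self]
  have hB := (h1.smooth_B.sub h2.smooth_B).isBigOAtBoundary e.open_target hε (m := 1)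
    fun j hj y hy => by
      obtain rfl : j = 0 := by omega
      rw [coeff_zero_bdrySeries]
      exact sub_eq_zero.2 (h4 y hy)
  have hlog : (fun x : ℝ => x ^ 1 * (x ^ n * Real.log x)) =O[𝓝[>] 0] fun x => x ^ n := by
    have := isBigO_pow_mul_log_rpow (m := n + 1) (t := (n : ℝ)) (by push_cast; linarith)
    simp only [Real.rpow_natCast] at this
    exact this.congr_left fun x => by ring
  have hB' := (hB.mul (IsBigOAtBoundary.of_snd fun x : ℝ => x ^ n * Real.log x)).trans hlog
  refine (((h1.expansion.sub h2.expansion).add hA).add hB').congr' hε fun q _ => ?_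
  simp only [Pi.sub_apply]
  ring

end IsPoincareMetric

end Main

theorem theorem3p1 (n : ℕ) (hn : Even n) (hn2 : 2 < n) :
    ∃ (P : ℕ → MvPolynomial (JetVar n) ℝ) (Q : MvPolynomial (JetVar n) ℝ),
      ∀ (M : Type*) [TopologicalSpace M] [T2Space M] [SecondCountableTopology M]
        [ChartedSpace (EuclideanSpace ℝ (Fin n)) M] [IsManifold (𝓡 n) ∞ M]
        (ε : ℝ) (_ : 0 < ε) (h : SmoothMetric n M)
        (g : ∀ q : M × ℝ,
          TangentSpace (collarModel n) q →L[ℝ] TangentSpace (collarModel n) q →L[ℝ] ℝ)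
        (_ : IsPoincareMetric ε h g),
        -- existence
        (∃ U A B : M × ℝ → ℝ, IsFormalSolution ε g U A B ∧
          ∀ (p : M), ∀ x ∈ Ioo 0 ε,
            U (p, x) = Real.log x + A (p, x) + B (p, x) * x ^ n * Real.log x) ∧
        -- uniqueness of the solution modulo `O(x^n)`
        (∀ U A B U' A' B' : M × ℝ → ℝ,
          IsFormalSolution ε g U A B → IsFormalSolution ε g U' A' B' →
            IsBigOAtBoundary univ (fun q => U q - U' q) (fun x => x ^ n)) ∧
        -- `A` modulo `O(x^n)` and `B` on the boundary are given by universal polynomials in the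
        -- inverse of `h` and the partial derivatives of `h`, in every smooth chart
        (∀ U A B : M × ℝ → ℝ, IsFormalSolution ε g U A B →
          ∀ e ∈ IsManifold.maximalAtlas (𝓡 n) ∞ M,
            IsBigOAtBoundary e.target
              (fun y => A (e.symm y.1, y.2)
                - ∑ j ∈ Finset.range n, MvPolynomial.eval (metricJet h e y.1) (P j) * y.2 ^ j)
              (fun x => x ^ n) ∧
            ∀ y ∈ e.target, B (e.symm y, 0) = MvPolynomial.eval (metricJet h e y) Q) := by

  -- The polynomials are fixed by `n` alone, before the manifold and the metric are introduced.
  obtain ⟨P, Q, hPQ⟩ := exists_definesFormalSolution (n := n) (by omega)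
  refine ⟨P, Q, fun M _ _ _ _ _ ε hε h g hg => ?_⟩
  obtain ⟨k, hk, hk0, hnf⟩ := hg.normal_form
  exact ⟨hg.exists_isFormalSolution hPQ hε hn2 hk hk0 hnf,
    fun U A B U' A' B' hU hU' => hg.sub_isBigO hε hn2 hk hnf hU hU',
    fun U A B hU e he => hg.expansion_of_isFormalSolution hPQ hε hn2 hk hk0 hnf hU he⟩
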